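/- Notation. For $s>0$ let $D_s=\{\xi\in\mathbb C:|\xi|<s\}$ and $D=D_1$; a prime and a superscript $(n)$ denote derivatives in $\xi$. For an open set $U\subseteq\mathbb C$ let $H(U)$ be the space of analytic functions on $U$ with the topology of locally uniform convergence. For $E\subseteq\mathbb C$ let $O(E)$ be the set of functions $f$ that are analytic and univalent in a neighbourhood of $E$ and satisfy $f(0)=0$, $f'(0)>0$. For power series put \[ \Big|\sum_{i\ge0}a_i\xi^i\Big|_{M(r)}=\sum_{i\ge0}|a_i|r^i,\qquad \Big\|\sum_{j\ge1}v_j\xi^j\Big\|_{\rho,n}=\sum_{j\ge1}|v_j|\,\rho^j j^{\frac12+n}. \] Let $\sigma=1$ (injection) or $\sigma=-1$ (suction). A strong solution on a time interval $I$ of the Polubarinova–Galin equation \[ \operatorname{Re}\big[f_t(\xi,t)\,\overline{f'(\xi,t)\,\xi}\big]=\sigma,\qquad |\xi|=1,\ t\in I, \tag{PG} \] is a function $f$ satisfying (PG) such that $f(\cdot,t)\in O(\overline D)$ for every $t\in I$ and $f$ is continuously differentiable in $t$ (one-sidedly at end points of $I$ that belong to $I$), in the sense that every $t\in I$ has a neighbourhood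 $J$ in $I$ and an $R>1$ with $f\in C^1(J,H(D_R))$. Theorem. Let $T_0>0$ and $r>1$, and let $f_{k_0}$ be a strong solution of (PG) on $[0,T_0]$ such that for every $t\in[0,T_0]$ the function $f_{k_0}(\cdot,t)$ is a polynomial of degree $k_0$ and $f_{k_0}(\cdot,t)\in O(\overline{D_r})$. Then for every $\varepsilon>0$, every integer $k\ge0$ and every $r'$ with $1<r'<r$ there are $\delta>0$ and $\rho>1$ such that the following holds for every function $f_0$ that is analytic in a neighbourhood of $\overline D$ and satisfies $f_0(0)=0$, $f_0'(0)>0$ and \[ \|f_0-f_{k_0}(\cdot,0)\|_{\rho,k}<\delta . \] There is a strong solution $f$ of (PG) on $[0,T_0]$ with $f(\cdot,0)=f_0$ on $\overline D$. It is unique: every strong solution of (PG) on an interval $[0,b)$, $b>0$, with initial function $f_0$ agrees with $f$ on $\overline D$ for all $t\in[0,b)\cap[0,T_0]$. Moreover, $f(\cdot,t)\in O(\overline{D_{r'}})$ for all $t\in[0,T_0]$, $f\in C^1([0,T_0],H(D_r))$, and \[ \big|f_{k_0}^{(n)}(\cdot,t)-f^{(n)}(\cdot,t)\big|_{M(r)}<\varepsilon\qquad(0\le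 n\le k,\ 0\le t\le T_0). \] -/

import Mathlib

open Set Filter Topology

noncomputable section

namespace HeleShaw

/-- The class `O(E)`: `f` is analytic and univalent (injective) in a neighbourhood of `E`,
`f 0 = 0`, and `f' 0` is a positive real number. -/
def InO (E : Set ℂ) (f : ℂ → ℂ) : Prop :=
  (∃ U : Set ℂ, IsOpen U ∧ E ⊆ U ∧ DifferentiableOn ℂ f U ∧ InjOn f U) ∧
    f 0 = 0 ∧ 0 < (deriv f 0).re ∧ (deriv f 0).im = 0

/-- On the set of times `I`, the map `t ↦ f t` is continuously differentiable with derivative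
`t ↦ ft t`, as a map into the space `H(U)` of analytic functions on the open set `U` with the
topology of locally uniform convergence. At end points of `I` derivatives are one-sided. -/
structure HasContTimeDeriv (U : Set ℂ) (I : Set ℝ) (f ft : ℝ → ℂ → ℂ) : Prop where
  analytic : ∀ t ∈ I, DifferentiableOn ℂ (f t) U
  analytic_deriv : ∀ t ∈ I, DifferentiableOn ℂ (ft t) U
  hasDeriv : ∀ t ∈ I, TendstoLocallyUniformlyOn
    (fun (s : ℝ) (ξ : ℂ) => (f s ξ - f t ξ) / ((s : ℂ) - (t : ℂ))) (ft t) (𝓝[I \ {t}] t) U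
  cont : ∀ t ∈ I, TendstoLocallyUniformlyOn ft (ft t) (𝓝[I] t) U

/-- `f ∈ C¹(I, H(U))`. -/
def IsC1InH (U : Set ℂ) (I : Set ℝ) (f : ℝ → ℂ → ℂ) : Prop :=
  ∃ ft : ℝ → ℂ → ℂ, HasContTimeDeriv U I f ft

/-- `f` is a strong solution, for times in the interval `I`, of the Polubarinova–Galin equation
`Re [f_t(ξ,t) * conj (f'(ξ,t) ξ)] = σ` on `|ξ| = 1` (`σ = 1`: injection, `σ = -1`: suction).
Every `f t` is univalent and analytic in a neighbourhood of the closed unit disk, normalised at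
`0`, and `f` is continuously differentiable in time, locally in time as a map into the analytic
functions on a common neighbourhood of the closed unit disk. -/
def IsStrongSolution (σ : ℝ) (I : Set ℝ) (f : ℝ → ℂ → ℂ) : Prop :=
  (∀ t ∈ I, InO (Metric.closedBall 0 1) (f t)) ∧
  ∃ ft : ℝ → ℂ → ℂ,
    (∀ t ∈ I, ∃ R > (1 : ℝ), ∃ η > (0 : ℝ),
      HasContTimeDeriv (Metric.ball 0 R) (I ∩ Metric.ball t η) f ft) ∧
    ∀ t ∈ I, ∀ ξ : ℂ, ‖ξ‖ = 1 →
      (ft t ξ * (starRingEnd ℂ) (deriv (f t) ξ * ξ)).re = σ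

/-- The `n`-th Taylor coefficient of `f` at `0`. -/
def taylorCoeff (f : ℂ → ℂ) (n : ℕ) : ℂ := iteratedDeriv n f 0 / (n.factorial : ℂ)

/-- The norm `|∑ aᵢ ξⁱ|_{M(r)} = ∑ |aᵢ| rⁱ`, with values in `[0, ∞]`. -/
def normM (r : ℝ) (f : ℂ → ℂ) : ENNReal :=
  ∑' i : ℕ, ENNReal.ofReal (‖taylorCoeff f i‖ * r ^ i)

/-- The norm `‖∑_{j ≥ 1} vⱼ ξʲ‖_{ρ,n} = ∑_{j ≥ 1} |vⱼ| ρʲ j^{1/2+n}`, with values in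
`[0, ∞]`; the summation index is shifted by one. -/
def normRho (ρ : ℝ) (n : ℕ) (v : ℂ → ℂ) : ENNReal :=
  ∑' j : ℕ, ENNReal.ofReal
    (‖taylorCoeff v (j + 1)‖ * ρ ^ (j + 1) * ((j : ℝ) + 1) ^ ((1 : ℝ) / 2 + (n : ℝ)))

end HeleShaw

end

/-!
For `f = ∑ aₙ ξⁿ` write `D = f'`. Dividing (PG) by `|f'|²` on the unit circle and solving the
resulting Schwarz problem turns it into `f_t = ξ f' H`, where `H` is analytic in the disk, real at
`0`, and has real part `σ / |f'|²` on the circle. As the conjugate of `ξ` is `ξ⁻¹` there, the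
coefficients of `H` are correlations of those of `1 / f'`, so this is an equation between power
series in `ξ` with coefficients in the Banach algebra `C([0, T₀])`, and integration in time gives
`D = D(0) + (ξ ∫ D H)'`.

The outer derivative costs a factor `n` in the coefficient of order `n`. The weights
`(S e^{K (T₀ - t)}) ^ n`, which decrease in time, make the time integral gain `1 / (K n)`, so for
large `K` the difference of `D` and the given polynomial solution is the fixed point of a
contraction of a small ball in a weighted `ℓ¹` space. At time `0` these weights are the powers of a
large radius `ρ`, which is why `f₀` has to be close in a norm with `ρ > 1` large. The same
contraction on short time intervals proves uniqueness, and the univalence of `f` follows from a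
uniform lower bound for the divided differences of the polynomial solution.
-/

namespace HeleShaw

open PowerSeries Finset
open scoped ENNReal

noncomputable section

section WeightedNorm

variable {A : Type*} [NormedCommRing A]

theorem enorm_mul_le_mul_enorm (x y : A) : ‖x * y‖ₑ ≤ ‖x‖ₑ * ‖y‖ₑ :=
  enorm_smul_le

theorem enorm_mul_tsum_le {ι : Type*} (c : A) (x : ι → A) :
    ‖c * ∑' i, x i‖ₑ ≤ ∑' i, ‖c * x i‖ₑ := by
  by_cases h : Summable x
  · rw [← h.tsum_mul_left]
    exact enorm_tsum_le_tsum_enorm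
  · simp [tsum_eq_zero_of_not_summable h]

/-- The weighted `ℓ¹` norm `∑ ‖wⱼ aⱼ‖` of a power series `∑ aⱼ ξʲ`. The weights are elements of
the coefficient ring, so that they may depend on time when the coefficients do. -/
def wnorm (w : ℕ → A) (a : A⟦X⟧) : ℝ≥0∞ := ∑' j, ‖w j * coeff j a‖ₑ

/-- The unweighted `ℓ¹` norm of the coefficients of a power series. -/
abbrev l1norm (a : A⟦X⟧) : ℝ≥0∞ := wnorm (fun _ => 1) a

/-- The weighted `ℓ¹` norm `∑ ‖aⱼ‖ Sʲ` of a power series `∑ aⱼ ξʲ` for a radius `S`. -/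
def rnorm (S : ℝ) (a : A⟦X⟧) : ℝ≥0∞ := ∑' j, ENNReal.ofReal (‖coeff j a‖ * S ^ j)

theorem l1norm_eq_tsum_enorm (a : A⟦X⟧) : l1norm a = ∑' j, ‖coeff j a‖ₑ := by
  simp only [l1norm, wnorm, one_mul]

theorem wnorm_zero (w : ℕ → A) : wnorm w 0 = 0 := by
  simp [wnorm]

theorem wnorm_add_le (w : ℕ → A) (a b : A⟦X⟧) : wnorm w (a + b) ≤ wnorm w a + wnorm w b := by
  unfold wnorm
  rw [← ENNReal.tsum_add]
  refine ENNReal.tsum_le_tsum fun j => ?_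
  rw [map_add, mul_add]
  exact enorm_add_le _ _

theorem wnorm_neg (w : ℕ → A) (a : A⟦X⟧) : wnorm w (-a) = wnorm w a := by
  simp [wnorm]

theorem wnorm_sub_le (w : ℕ → A) (a b : A⟦X⟧) : wnorm w (a - b) ≤ wnorm w a + wnorm w b := by
  rw [sub_eq_add_neg, ← wnorm_neg w b]
  exact wnorm_add_le _ _ _

theorem wnorm_sub_comm (w : ℕ → A) (a b : A⟦X⟧) : wnorm w (a - b) = wnorm w (b - a) := by
  rw [← wnorm_neg, neg_sub]

theorem wnorm_mono {w w' : ℕ → A} (h : ∀ j x, ‖w j * x‖ₑ ≤ ‖w' j * x‖ₑ) (a : A⟦X⟧) :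
    wnorm w a ≤ wnorm w' a :=
  ENNReal.tsum_le_tsum fun j => h j _

theorem enorm_mul_coeff_le_wnorm (w : ℕ → A) (a : A⟦X⟧) (j : ℕ) :
    ‖w j * coeff j a‖ₑ ≤ wnorm w a :=
  ENNReal.le_tsum j

theorem wnorm_C (w : ℕ → A) (c : A) : wnorm w (C c) = ‖w 0 * c‖ₑ := by
  rw [wnorm, tsum_eq_single 0 fun j hj => by simp [coeff_C, hj], coeff_zero_C]

theorem wnorm_smul_le [NormedAlgebra ℝ A] (w : ℕ → A) (σ : ℝ) (a : A⟦X⟧) :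
    wnorm w (σ • a) ≤ ‖σ‖ₑ * wnorm w a := by
  unfold wnorm
  rw [← ENNReal.tsum_mul_left]
  refine ENNReal.tsum_le_tsum fun j => ?_
  rw [coeff_smul, mul_smul_comm]
  exact enorm_smul_le

theorem summable_norm_coeff {a : A⟦X⟧} (ha : l1norm a ≠ ∞) : Summable fun n => ‖coeff n a‖ := by
  rw [l1norm_eq_tsum_enorm] at ha
  simpa using ENNReal.summable_toReal ha

theorem l1norm_ne_top {a : A⟦X⟧} (ha : Summable fun n => ‖coeff n a‖) : l1norm a ≠ ∞ := by
  rw [l1norm_eq_tsum_enorm]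
  simpa [ofReal_norm] using ha.tsum_ofReal_ne_top

theorem exists_forall_norm_coeff_le {a : A⟦X⟧} (ha : l1norm a ≠ ∞) :
    ∃ M, ∀ n, ‖coeff n a‖ ≤ M :=
  ⟨_, fun n => (summable_norm_coeff ha).le_tsum n fun _ _ => norm_nonneg _⟩

theorem tsum_sum_antidiagonal_mul (u v : ℕ → ℝ≥0∞) :
    ∑' n, ∑ p ∈ antidiagonal n, u p.1 * v p.2 = (∑' i, u i) * ∑' j, v j := by
  calc ∑' n, ∑ p ∈ antidiagonal n, u p.1 * v p.2
      = ∑' x : Σ n : ℕ, antidiagonal n, u x.2.1.1 * v x.2.1.2 := by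
        rw [ENNReal.tsum_sigma']
        refine tsum_congr fun n => ?_
        rw [tsum_fintype, ← sum_coe_sort]
    _ = ∑' p : ℕ × ℕ, u p.1 * v p.2 :=
        HasAntidiagonal.sigmaAntidiagonalEquivProd.tsum_eq fun p : ℕ × ℕ => u p.1 * v p.2
    _ = (∑' i, u i) * ∑' j, v j := by
        rw [ENNReal.tsum_prod (f := fun i j => u i * v j), ← ENNReal.tsum_mul_right]
        exact tsum_congr fun i => ENNReal.tsum_mul_left

theorem wnorm_mul_le (μ : A) (a b : A⟦X⟧) :
    wnorm (fun _ => μ) (a * b) ≤ l1norm a * wnorm (fun _ => μ) b := by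
  rw [l1norm_eq_tsum_enorm]
  unfold wnorm
  rw [← tsum_sum_antidiagonal_mul]
  refine ENNReal.tsum_le_tsum fun n => ?_
  rw [coeff_mul, Finset.mul_sum]
  refine (enorm_sum_le _ _).trans (sum_le_sum fun p _ => ?_)
  rw [mul_left_comm]
  exact enorm_mul_le_mul_enorm _ _

end WeightedNorm

section Inverse

variable {A : Type*} [NormedCommRing A]

theorem l1norm_trunc (n : ℕ) (a : A⟦X⟧) :
    l1norm (trunc n a : A⟦X⟧) = ∑ i ∈ range n, ‖coeff i a‖ₑ := by
  rw [l1norm_eq_tsum_enorm, tsum_eq_sum (s := range n)]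
  · exact sum_congr rfl fun i hi => by simp [coeff_trunc, List.mem_range.1 (by simpa using hi)]
  · intro i hi
    simp [coeff_trunc, show ¬ i < n by simpa using hi]

theorem sum_range_enorm_coeff_mul_le (n : ℕ) (a b : A⟦X⟧) :
    ∑ i ∈ range n, ‖coeff i (a * b)‖ₑ ≤ l1norm a * ∑ i ∈ range n, ‖coeff i b‖ₑ := by
  calc ∑ i ∈ range n, ‖coeff i (a * b)‖ₑ
      = ∑ i ∈ range n, ‖coeff i (a * (trunc n b : A⟦X⟧))‖ₑ := by
        refine sum_congr rfl fun i hi => ?_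
        have hi' : i < n := mem_range.1 hi
        rw [coeff_mul_eq_coeff_trunc_mul_trunc a b hi',
          coeff_mul_eq_coeff_trunc_mul_trunc a (trunc n b : A⟦X⟧) hi', trunc_trunc]
    _ ≤ l1norm (a * (trunc n b : A⟦X⟧)) := by
        rw [l1norm_eq_tsum_enorm]
        exact ENNReal.sum_le_tsum _
    _ ≤ l1norm a * ∑ i ∈ range n, ‖coeff i b‖ₑ := by
        rw [← l1norm_trunc]
        exact wnorm_mul_le 1 a _

theorem l1norm_le_two_of_one_add_mul_eq_one [NormOneClass A] {x y : A⟦X⟧}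
    (hx : l1norm x ≤ 2⁻¹) (h : (1 + x) * y = 1) : l1norm y ≤ 2 := by
  rw [l1norm_eq_tsum_enorm]
  refine ENNReal.tsum_le_of_sum_range_le fun n => ?_
  set s := ∑ i ∈ range n, ‖coeff i y‖ₑ
  have hs : s ≠ ∞ := ENNReal.sum_ne_top.2 fun i _ => enorm_ne_top
  have hy : y = 1 - x * y := by linear_combination h
  have hone : ∑ i ∈ range n, ‖coeff i (1 : A⟦X⟧)‖ₑ ≤ 1 := by
    refine (ENNReal.sum_le_tsum _).trans ?_
    rw [← l1norm_eq_tsum_enorm, ← map_one (C (R := A))]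
    exact (wnorm_C _ _).le.trans (by simp)
  have hle : s ≤ 1 + 2⁻¹ * s := by
    calc s = ∑ i ∈ range n, ‖coeff i (1 - x * y)‖ₑ := by rw [← hy]
      _ ≤ ∑ i ∈ range n, (‖coeff i (1 : A⟦X⟧)‖ₑ + ‖coeff i (x * y)‖ₑ) := by
          refine sum_le_sum fun i _ => ?_
          rw [map_sub]
          exact enorm_sub_le
      _ ≤ 1 + 2⁻¹ * s := by
          rw [sum_add_distrib]
          exact add_le_add hone ((sum_range_enorm_coeff_mul_le n x y).trans (by gcongr))
  have hhalf : 2⁻¹ * s ≤ 1 := by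
    refine (ENNReal.add_le_add_iff_right (a := 2⁻¹ * s) (by finiteness)).1 ?_
    rwa [← add_mul, ENNReal.inv_two_add_inv_two, one_mul]
  calc s = 2 * (2⁻¹ * s) := by
        rw [← mul_assoc, ENNReal.mul_inv_cancel two_ne_zero ENNReal.ofNat_ne_top, one_mul]
    _ ≤ 2 := by simpa using mul_le_mul_right hhalf 2

theorem exists_mul_eq_one_of_l1norm_mul_le [NormOneClass A] [CompleteSpace A] {D q V : A⟦X⟧}
    (h : D * q = 1) (hV : l1norm q * l1norm V ≤ 2⁻¹) :
    ∃ q', (D + V) * q' = 1 ∧ l1norm q' ≤ 2 * l1norm q := by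
  have hx : l1norm (q * V) ≤ 2⁻¹ := (wnorm_mul_le 1 q V).trans hV
  have hunit : IsUnit (1 + q * V) := by
    have h0 : ‖coeff 0 (q * V)‖ₑ ≤ 2⁻¹ := by
      simpa only [one_mul] using (enorm_mul_coeff_le_wnorm (fun _ => 1) (q * V) 0).trans hx
    have hlt : ‖-coeff 0 (q * V)‖ < 1 := by
      rw [norm_neg, ← toReal_enorm]
      exact (ENNReal.toReal_mono (by simp) h0).trans_lt (by norm_num)
    rw [PowerSeries.isUnit_iff_constantCoeff]
    simpa [Units.val_oneSub] using (Units.oneSub _ hlt).isUnit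
  obtain ⟨y, hy⟩ := hunit.exists_right_inv
  refine ⟨q * y, by linear_combination hy + y * h, ?_⟩
  calc l1norm (q * y) ≤ l1norm q * l1norm y := wnorm_mul_le 1 q y
    _ ≤ 2 * l1norm q := by
        rw [mul_comm]
        gcongr
        exact l1norm_le_two_of_one_add_mul_eq_one hx hy

theorem ringInverse_eq_of_mul_eq_one {R : Type*} [CommRing R] {a b : R} (h : a * b = 1) :
    Ring.inverse a = b := by
  rw [← mul_one (Ring.inverse a), ← h, Ring.inverse_mul_cancel_left a b (.of_mul_eq_one _ h)]

end Inverse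

section Herglotz

variable {A : Type*} [NormedCommRing A]

/-- The power series `c₀ + 2 ∑_{n ≥ 1} cₙ ξⁿ`: on the unit circle its real part is
`∑_{n ∈ ℤ} cₙ ξⁿ`, where `c₋ₙ` is the conjugate of `cₙ`. -/
def herglotz (c : A⟦X⟧) : A⟦X⟧ := 2 * c - C (coeff 0 c)

theorem herglotz_sub (c c' : A⟦X⟧) : herglotz (c - c') = herglotz c - herglotz c' := by
  simp only [herglotz, map_sub]
  ring

theorem wnorm_herglotz_le (w : ℕ → A) (c : A⟦X⟧) : wnorm w (herglotz c) ≤ 2 * wnorm w c := by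
  unfold wnorm
  rw [← ENNReal.tsum_mul_left]
  refine ENNReal.tsum_le_tsum fun j => ?_
  rw [herglotz, two_mul, map_sub, map_add, two_mul, coeff_C]
  split_ifs with hj
  · rw [hj, add_sub_cancel_right]
    exact le_self_add
  · rw [sub_zero, mul_add]
    exact enorm_add_le _ _

theorem l1norm_herglotz_ne_top {c : A⟦X⟧} (hc : l1norm c ≠ ∞) :
    l1norm (herglotz c) ≠ ∞ :=
  ne_top_of_le_ne_top (ENNReal.mul_ne_top ENNReal.ofNat_ne_top hc) (wnorm_herglotz_le _ c)

end Herglotz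

section Correlation

theorem coeff_add_mul_add {R : Type*} [CommRing R] (a b : R⟦X⟧) (j n : ℕ) :
    coeff (j + n) (a * b) + coeff j a * coeff n b =
      ∑ p ∈ antidiagonal j, coeff p.1 a * coeff (p.2 + n) b +
        ∑ p ∈ antidiagonal n, coeff (j + p.1) a * coeff p.2 b := by
  rw [coeff_mul, Nat.sum_antidiagonal_eq_sum_range_succ fun i k => coeff i a * coeff k b,
    Nat.sum_antidiagonal_eq_sum_range_succ fun i k => coeff i a * coeff (k + n) b,
    Nat.sum_antidiagonal_eq_sum_range_succ fun i k => coeff (j + i) a * coeff k b,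
    Nat.succ_eq_add_one, add_assoc, sum_range_add, sum_range_succ _ j, Nat.sub_self, zero_add,
    add_right_comm]
  congr 1
  · congr 1
    refine sum_congr rfl fun i hi => ?_
    rw [Nat.sub_add_comm (mem_range.1 hi).le]
  · exact sum_congr rfl fun i _ => by rw [Nat.add_sub_add_left]

variable {A : Type*} [NormedCommRing A] [StarRing A] {a b d : A⟦X⟧}

/-- The correlation `∑ᵢ aₙ₊ᵢ bᵢ*` of two power series: on the unit circle, where `ξ⁻¹` is the
conjugate of `ξ`, this is the part of nonnegative order of the product of `a` and the conjugate
of `b`. -/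
def corr (a b : A⟦X⟧) : A⟦X⟧ := PowerSeries.mk fun n => ∑' i, coeff (n + i) a * star (coeff i b)

theorem coeff_corr (a b : A⟦X⟧) (n : ℕ) :
    coeff n (corr a b) = ∑' i, coeff (n + i) a * star (coeff i b) := by
  simp [corr]

theorem corr_C_right (a : A⟦X⟧) (x : A) : corr a (C x) = a * C (star x) := by
  ext n
  rw [coeff_corr, coeff_mul_C, tsum_eq_single 0 fun i hi => by simp [coeff_C, hi]]
  simp

theorem corr_one_left (a : A⟦X⟧) : corr 1 a = C (star (coeff 0 a)) := by
  ext n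
  rw [coeff_corr, coeff_C, tsum_eq_single 0 fun i hi => by simp [coeff_one, hi]]
  simp [coeff_one]

variable [NormedStarGroup A]

theorem enorm_star_eq (x : A) : ‖star x‖ₑ = ‖x‖ₑ := by
  simp [← ofReal_norm]

theorem star_coeff_zero_corr_self (q : A⟦X⟧) :
    star (coeff 0 (corr q q)) = coeff 0 (corr q q) := by
  rw [coeff_corr, tsum_star]
  simp [mul_comm]

theorem wnorm_corr_le {e : ℕ → A} {μ : A} (he : ∀ x, Monotone fun j => ‖e j * x‖ₑ)
    (hμ : star μ = μ) (a b : A⟦X⟧) :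
    wnorm (fun j => e j * μ) (corr a b) ≤ wnorm e a * wnorm (fun _ => μ) b := by
  have hterm (j i : ℕ) : ‖e j * μ * (coeff (j + i) a * star (coeff i b))‖ₑ ≤
      ‖e (j + i) * coeff (j + i) a‖ₑ * ‖μ * coeff i b‖ₑ := by
    calc ‖e j * μ * (coeff (j + i) a * star (coeff i b))‖ₑ
        = ‖(e j * coeff (j + i) a) * star (μ * coeff i b)‖ₑ := by
          rw [star_mul, hμ]
          congr 1
          ring
      _ ≤ ‖e j * coeff (j + i) a‖ₑ * ‖star (μ * coeff i b)‖ₑ := enorm_mul_le_mul_enorm _ _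
      _ ≤ ‖e (j + i) * coeff (j + i) a‖ₑ * ‖μ * coeff i b‖ₑ := by
          rw [enorm_star_eq]
          gcongr
          exact he _ (Nat.le_add_right j i)
  unfold wnorm
  calc ∑' j, ‖e j * μ * coeff j (corr a b)‖ₑ
      ≤ ∑' j, ∑' i, ‖e (j + i) * coeff (j + i) a‖ₑ * ‖μ * coeff i b‖ₑ := by
        refine ENNReal.tsum_le_tsum fun j => ?_
        rw [coeff_corr]
        exact (enorm_mul_tsum_le _ _).trans (ENNReal.tsum_le_tsum (hterm j))
    _ = ∑' i, (∑' j, ‖e (j + i) * coeff (j + i) a‖ₑ) * ‖μ * coeff i b‖ₑ := by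
        rw [ENNReal.tsum_comm]
        exact tsum_congr fun i => ENNReal.tsum_mul_right
    _ ≤ ∑' i, (∑' j, ‖e j * coeff j a‖ₑ) * ‖μ * coeff i b‖ₑ := by
        refine ENNReal.tsum_le_tsum fun i => mul_le_mul_left ?_ _
        exact ENNReal.tsum_comp_le_tsum_of_injective (add_left_injective i)
          fun j => ‖e j * coeff j a‖ₑ
    _ = _ := ENNReal.tsum_mul_left

theorem wnorm_corr_le_right {μ : A} (hμ : star μ = μ) (a b : A⟦X⟧) :
    wnorm (fun _ => μ) (corr a b) ≤ l1norm a * wnorm (fun _ => μ) b := by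
  simpa only [one_mul] using
    wnorm_corr_le (e := fun _ => 1) (fun _ => monotone_const) hμ a b

theorem wnorm_corr_le_left {w : ℕ → A} (hw : ∀ x, Monotone fun j => ‖w j * x‖ₑ)
    (a b : A⟦X⟧) : wnorm w (corr a b) ≤ wnorm w a * l1norm b := by
  simpa only [mul_one] using wnorm_corr_le hw (star_one A) a b

theorem l1norm_corr_le (a b : A⟦X⟧) : l1norm (corr a b) ≤ l1norm a * l1norm b :=
  wnorm_corr_le_right (star_one A) a b

theorem l1norm_corr_ne_top (ha : l1norm a ≠ ∞) (hb : l1norm b ≠ ∞) : l1norm (corr a b) ≠ ∞ :=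
  ne_top_of_le_ne_top (ENNReal.mul_ne_top ha hb) (l1norm_corr_le a b)

variable [CompleteSpace A]

theorem summable_corr (ha : l1norm a ≠ ∞) (hb : l1norm b ≠ ∞) (n : ℕ) :
    Summable fun i => coeff (n + i) a * star (coeff i b) := by
  obtain ⟨M, hM⟩ := exists_forall_norm_coeff_le ha
  refine .of_norm_bounded ((summable_norm_coeff hb).mul_left M) fun i => ?_
  refine (norm_mul_le _ _).trans ?_
  rw [norm_star]
  gcongr
  exact hM _

theorem corr_sub_left (ha : l1norm a ≠ ∞) (hb : l1norm b ≠ ∞) (hd : l1norm d ≠ ∞) :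
    corr (a - b) d = corr a d - corr b d := by
  ext n
  rw [map_sub, coeff_corr, coeff_corr, coeff_corr,
    ← (summable_corr ha hd n).tsum_sub (summable_corr hb hd n)]
  simp only [map_sub, sub_mul]

theorem corr_sub_right (ha : l1norm a ≠ ∞) (hb : l1norm b ≠ ∞) (hd : l1norm d ≠ ∞) :
    corr a (b - d) = corr a b - corr a d := by
  ext n
  rw [map_sub, coeff_corr, coeff_corr, coeff_corr,
    ← (summable_corr ha hb n).tsum_sub (summable_corr ha hd n)]
  simp only [map_sub, star_sub, mul_sub]

theorem corr_herglotz (ha : l1norm a ≠ ∞) (hb : l1norm b ≠ ∞) :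
    corr a (herglotz b) = 2 * corr a b - a * C (star (coeff 0 b)) := by
  have h : herglotz b = b - (C (coeff 0 b) - b) := by
    rw [herglotz]
    ring
  have hC : l1norm (C (coeff 0 b)) ≠ ∞ := by
    rw [l1norm, wnorm_C]
    exact enorm_ne_top
  have hCb : l1norm (C (coeff 0 b) - b) ≠ ∞ :=
    ne_top_of_le_ne_top (ENNReal.add_ne_top.2 ⟨hC, hb⟩) (wnorm_sub_le _ _ _)
  rw [h, corr_sub_right ha hb hCb, corr_sub_right ha hC hb, corr_C_right]
  ring

theorem hasSum_corr_corr (ha : l1norm a ≠ ∞) (hb : l1norm b ≠ ∞) (hd : l1norm d ≠ ∞) (j : ℕ) :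
    HasSum (fun n => (∑ p ∈ antidiagonal n, coeff (j + p.1) a * coeff p.2 b) * star (coeff n d))
      (coeff j (corr a (corr d b))) := by
  let g : ℕ × ℕ → A := fun p => coeff (j + p.1) a * (star (coeff (p.1 + p.2) d) * coeff p.2 b)
  have hg : Summable g := by
    obtain ⟨M, hM⟩ := exists_forall_norm_coeff_le hd
    have hM0 : 0 ≤ M := (norm_nonneg _).trans (hM 0)
    have hbound : Summable fun p : ℕ × ℕ => ‖coeff (j + p.1) a‖ * (M * ‖coeff p.2 b‖) :=
      .mul_of_nonneg (f := fun i => ‖coeff (j + i) a‖) (g := fun m => M * ‖coeff m b‖)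
        ((summable_norm_coeff ha).comp_injective (add_right_injective j))
        ((summable_norm_coeff hb).mul_left M) (fun _ => norm_nonneg _)
        fun _ => mul_nonneg hM0 (norm_nonneg _)
    refine .of_norm_bounded hbound fun p => (norm_mul_le _ _).trans ?_
    gcongr
    refine (norm_mul_le _ _).trans ?_
    rw [norm_star]
    gcongr
    exact hM _
  have hval : coeff j (corr a (corr d b)) = ∑' p, g p := by
    rw [hg.tsum_prod, coeff_corr]
    refine tsum_congr fun i => ?_
    have hs : Summable fun m => star (coeff (i + m) d) * coeff m b := by
      simpa [mul_comm] using (summable_corr hd hb i).star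
    rw [coeff_corr, tsum_star]
    simp only [star_mul', star_star]
    rw [← hs.tsum_mul_left]
  rw [hval]
  refine ((HasAntidiagonal.sigmaAntidiagonalEquivProd.hasSum_iff.2 hg.hasSum).sigma
    fun n => hasSum_fintype _).congr_fun fun n => ?_
  simp only [Function.comp_def, HasAntidiagonal.sigmaAntidiagonalEquivProd_apply]
  rw [sum_coe_sort (antidiagonal n) g, sum_mul]
  refine sum_congr rfl fun p hp => ?_
  rw [← mem_antidiagonal.1 hp]
  ring

-- On the circle, both sides are the part of nonnegative order of `a b d̄`, up to the term of
-- order zero of `b d̄`, which both products on the right contain.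
theorem corr_mul_left (ha : l1norm a ≠ ∞) (hb : l1norm b ≠ ∞) (hd : l1norm d ≠ ∞) :
    corr (a * b) d + a * C (coeff 0 (corr b d)) = a * corr b d + corr a (corr d b) := by
  ext j
  have hab : l1norm (a * b) ≠ ∞ :=
    ne_top_of_le_ne_top (ENNReal.mul_ne_top ha hb) (wnorm_mul_le 1 a b)
  have hleft : HasSum (fun n => (coeff (j + n) (a * b) + coeff j a * coeff n b) * star (coeff n d))
      (coeff j (corr (a * b) d + a * C (coeff 0 (corr b d)))) := by
    rw [map_add, coeff_mul_C, coeff_corr, coeff_corr]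
    refine ((summable_corr hab hd j).hasSum.add
      ((summable_corr hb hd 0).hasSum.mul_left (coeff j a))).congr_fun fun n => ?_
    rw [zero_add]
    ring
  have hright : HasSum
      (fun n => (∑ p ∈ antidiagonal j, coeff p.1 a * coeff (p.2 + n) b) * star (coeff n d))
      (coeff j (a * corr b d)) := by
    simp only [coeff_mul, coeff_corr, sum_mul]
    refine hasSum_sum fun p _ => ?_
    simpa only [mul_assoc] using (summable_corr hb hd p.2).hasSum.mul_left (coeff p.1 a)
  refine hleft.unique ?_
  rw [map_add]
  simpa only [coeff_add_mul_add, add_mul] using hright.add (hasSum_corr_corr ha hb hd j)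

theorem mul_herglotz_add_corr_herglotz {D q : A⟦X⟧} (hD : l1norm D ≠ ∞) (hq : l1norm q ≠ ∞)
    (h : D * q = 1) :
    D * herglotz (corr q q) + corr D (herglotz (corr q q)) = C (2 * star (coeff 0 q)) := by
  have key := corr_mul_left hD hq hq
  rw [h, corr_one_left] at key
  rw [corr_herglotz hD (l1norm_corr_ne_top hq hq), star_coeff_zero_corr_self, herglotz,
    map_mul, map_ofNat]
  linear_combination -2 * key

end Correlation

section Lipschitz

variable {A : Type*} [NormedCommRing A] {D₁ D₂ q₁ q₂ : A⟦X⟧} {e : ℕ → A} {μ : A}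
  {Q Φ : ℝ≥0∞}

theorem wnorm_const_le (he : ∀ x, Monotone fun j => ‖e j * x‖ₑ) (he0 : e 0 = 1) (a : A⟦X⟧) :
    wnorm (fun _ => μ) a ≤ wnorm (fun j => e j * μ) a :=
  wnorm_mono (fun j x => by simpa [he0, mul_assoc] using he (μ * x) j.zero_le) a

theorem wnorm_inverse_sub_le (h₁ : D₁ * q₁ = 1) (h₂ : D₂ * q₂ = 1) (hq₁ : l1norm q₁ ≤ Q)
    (hq₂ : l1norm q₂ ≤ Q) :
    wnorm (fun _ => μ) (q₁ - q₂) ≤ Q ^ 2 * wnorm (fun _ => μ) (D₁ - D₂) := by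
  have h : q₁ - q₂ = q₁ * (q₂ * (D₂ - D₁)) := by
    linear_combination q₂ * h₁ - q₁ * h₂
  rw [h, sq, mul_assoc, wnorm_sub_comm _ D₁]
  refine (wnorm_mul_le _ _ _).trans (mul_le_mul' hq₁ ?_)
  exact (wnorm_mul_le _ _ _).trans (mul_le_mul' hq₂ le_rfl)

variable [StarRing A] [NormedStarGroup A]

theorem wnorm_C_two_mul_star_le (hμ : star μ = μ) (he0 : e 0 = 1) (a : A⟦X⟧) :
    wnorm (fun j => e j * μ) (C (2 * star (coeff 0 a))) ≤ 2 * wnorm (fun _ => μ) a := by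
  have h : μ * (2 * star (coeff 0 a)) = star (μ * coeff 0 a) + star (μ * coeff 0 a) := by
    rw [star_mul, hμ]
    ring
  rw [wnorm_C, he0, one_mul, h, two_mul]
  refine (enorm_add_le _ _).trans ?_
  rw [enorm_star_eq]
  gcongr <;> exact enorm_mul_coeff_le_wnorm (fun _ => μ) a 0

variable [CompleteSpace A]

theorem wnorm_corr_self_sub_le (hμ : star μ = μ) (hQ : Q ≠ ∞) (hq₁ : l1norm q₁ ≤ Q)
    (hq₂ : l1norm q₂ ≤ Q) :
    wnorm (fun _ => μ) (corr q₁ q₁ - corr q₂ q₂) ≤ 2 * Q * wnorm (fun _ => μ) (q₁ - q₂) := by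
  have hq₁' : l1norm q₁ ≠ ∞ := ne_top_of_le_ne_top hQ hq₁
  have hq₂' : l1norm q₂ ≠ ∞ := ne_top_of_le_ne_top hQ hq₂
  have h : corr q₁ q₁ - corr q₂ q₂ = corr (q₁ - q₂) q₁ + corr q₂ (q₁ - q₂) := by
    rw [corr_sub_left hq₁' hq₂' hq₁', corr_sub_right hq₂' hq₁' hq₂']
    ring
  rw [h]
  refine (wnorm_add_le _ _ _).trans ?_
  calc wnorm (fun _ => μ) (corr (q₁ - q₂) q₁) + wnorm (fun _ => μ) (corr q₂ (q₁ - q₂))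
      ≤ wnorm (fun _ => μ) (q₁ - q₂) * Q + Q * wnorm (fun _ => μ) (q₁ - q₂) := by
        gcongr
        · exact (wnorm_corr_le_left (fun _ => monotone_const) _ _).trans (by gcongr)
        · exact (wnorm_corr_le_right hμ _ _).trans (by gcongr)
    _ = 2 * Q * wnorm (fun _ => μ) (q₁ - q₂) := by ring

-- The constant depends on the weights only through `wnorm e D₂`: in the term
-- `corr D₂ (herglotz _)`, which replaces the product, the growing weights fall on `D₂` alone.
theorem wnorm_mul_herglotz_sub_le (hμ : star μ = μ) (he : ∀ x, Monotone fun j => ‖e j * x‖ₑ)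
    (he0 : e 0 = 1) (h₁ : D₁ * q₁ = 1) (h₂ : D₂ * q₂ = 1) (hD₁ : l1norm D₁ ≠ ∞)
    (hD₂ : l1norm D₂ ≠ ∞) (hQ : Q ≠ ∞) (hq₁ : l1norm q₁ ≤ Q) (hq₂ : l1norm q₂ ≤ Q)
    (hΦ : wnorm e D₂ ≤ Φ) :
    wnorm (fun j => e j * μ) (D₁ * herglotz (corr q₁ q₁) - D₂ * herglotz (corr q₂ q₂)) ≤
      (4 * Q ^ 2 + 4 * Φ * Q ^ 3) * wnorm (fun j => e j * μ) (D₁ - D₂) := by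
  have hq₁' : l1norm q₁ ≠ ∞ := ne_top_of_le_ne_top hQ hq₁
  have hq₂' : l1norm q₂ ≠ ∞ := ne_top_of_le_ne_top hQ hq₂
  set N := wnorm (fun j => e j * μ) (D₁ - D₂)
  have hq : wnorm (fun _ => μ) (q₁ - q₂) ≤ Q ^ 2 * N :=
    (wnorm_inverse_sub_le h₁ h₂ hq₁ hq₂).trans (by gcongr; exact wnorm_const_le he he0 _)
  have hp₁ : l1norm (herglotz (corr q₁ q₁)) ≤ 2 * Q ^ 2 := by
    refine (wnorm_herglotz_le _ _).trans ?_
    rw [sq]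
    gcongr
    exact (l1norm_corr_le _ _).trans (by gcongr)
  have hp : wnorm (fun _ => μ) (herglotz (corr q₁ q₁) - herglotz (corr q₂ q₂)) ≤
      2 * (2 * Q * (Q ^ 2 * N)) := by
    rw [← herglotz_sub]
    refine (wnorm_herglotz_le _ _).trans ?_
    gcongr
    exact (wnorm_corr_self_sub_le hμ hQ hq₁ hq₂).trans (by gcongr)
  have hpt₁ := l1norm_herglotz_ne_top (l1norm_corr_ne_top hq₁' hq₁')
  have hpt₂ := l1norm_herglotz_ne_top (l1norm_corr_ne_top hq₂' hq₂')
  have hdecomp : D₁ * herglotz (corr q₁ q₁) - D₂ * herglotz (corr q₂ q₂) =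
      C (2 * star (coeff 0 (q₁ - q₂))) - corr (D₁ - D₂) (herglotz (corr q₁ q₁)) -
        corr D₂ (herglotz (corr q₁ q₁) - herglotz (corr q₂ q₂)) := by
    rw [corr_sub_left hD₁ hD₂ hpt₁, corr_sub_right hD₂ hpt₁ hpt₂, map_sub, star_sub, mul_sub,
      map_sub]
    linear_combination mul_herglotz_add_corr_herglotz hD₁ hq₁' h₁ -
      mul_herglotz_add_corr_herglotz hD₂ hq₂' h₂
  have heμ (x : A) : Monotone fun j => ‖e j * μ * x‖ₑ := by
    simpa only [mul_assoc] using he (μ * x)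
  rw [hdecomp]
  refine (wnorm_sub_le _ _ _).trans ((add_le_add_left (wnorm_sub_le _ _ _) _).trans ?_)
  calc _ ≤ 2 * (Q ^ 2 * N) + N * (2 * Q ^ 2) + Φ * (2 * (2 * Q * (Q ^ 2 * N))) := by
        gcongr
        · exact (wnorm_C_two_mul_star_le hμ he0 _).trans (by gcongr)
        · exact (wnorm_corr_le_left heμ _ _).trans (by gcongr)
        · exact (wnorm_corr_le he hμ _ _).trans (by gcongr)
    _ = (4 * Q ^ 2 + 4 * Φ * Q ^ 3) * N := by ring

end Lipschitz

section FixedPoint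

variable {A : Type*} [NormedCommRing A] {m : ℕ → A}

/-- The power series `V` with `mⱼ Vⱼ = xⱼ`, for invertible weights `mⱼ`. It identifies `ℓ¹` with
the space of power series of finite weighted norm. -/
def ofLp (m : ℕ → A) (x : lp (fun _ : ℕ => A) 1) : A⟦X⟧ :=
  PowerSeries.mk fun j => Ring.inverse (m j) * x j

theorem ofLp_sub (x y : lp (fun _ : ℕ => A) 1) : ofLp m (x - y) = ofLp m x - ofLp m y := by
  ext j
  simp [ofLp, mul_sub]

theorem wnorm_ofLp (hm : ∀ j, IsUnit (m j)) (x : lp (fun _ : ℕ => A) 1) :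
    wnorm m (ofLp m x) = ‖x‖ₑ := by
  have hs : Summable fun j => ‖x j‖ := by
    simpa using (lp.memℓp x).summable (by simp)
  rw [← ofReal_norm, lp.norm_eq_tsum_rpow (by simp)]
  simp only [ENNReal.toReal_one, Real.rpow_one, div_one]
  rw [ENNReal.ofReal_tsum_of_nonneg (fun _ => norm_nonneg _) hs]
  simp only [wnorm, ofLp, coeff_mk, ofReal_norm, Ring.mul_inverse_cancel_left _ _ (hm _)]

theorem exists_ofLp_eq (hm : ∀ j, IsUnit (m j)) {V : A⟦X⟧} (hV : wnorm m V ≠ ∞) :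
    ∃ x, ofLp m x = V := by
  have hmem : Memℓp (fun j => m j * coeff j V) 1 :=
    memℓp_gen (by simpa using ENNReal.summable_toReal hV)
  refine ⟨⟨_, hmem⟩, ?_⟩
  ext j
  simp only [ofLp, coeff_mk, Ring.inverse_mul_cancel_left _ _ (hm j)]

theorem exists_wnorm_le_and_eq [CompleteSpace A] (hm : ∀ j, IsUnit (m j)) (Ψ : A⟦X⟧ → A⟦X⟧)
    {η : ℝ≥0∞} (hη : η ≠ ∞) (h0 : wnorm m (Ψ 0) ≤ 2⁻¹ * η)
    (hΨ : ∀ V₁ V₂, wnorm m V₁ ≤ η → wnorm m V₂ ≤ η →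
      wnorm m (Ψ V₁ - Ψ V₂) ≤ 2⁻¹ * wnorm m (V₁ - V₂)) :
    ∃ V, wnorm m V ≤ η ∧ Ψ V = V := by
  have hball (V : A⟦X⟧) (hV : wnorm m V ≤ η) : wnorm m (Ψ V) ≤ η := by
    calc wnorm m (Ψ V) = wnorm m (Ψ V - Ψ 0 + Ψ 0) := by rw [sub_add_cancel]
      _ ≤ 2⁻¹ * wnorm m (V - 0) + 2⁻¹ * η :=
        (wnorm_add_le _ _ _).trans
          (add_le_add (hΨ V 0 hV ((wnorm_zero m).trans_le zero_le)) h0)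
      _ ≤ 2⁻¹ * η + 2⁻¹ * η := by
        rw [sub_zero]
        gcongr
      _ = η := by rw [← add_mul, ENNReal.inv_two_add_inv_two, one_mul]
  let s : Set (lp (fun _ : ℕ => A) 1) := {x | ‖x‖ₑ ≤ η}
  have hlift (x : lp (fun _ : ℕ => A) 1) (hx : x ∈ s) : ∃ y, ofLp m y = Ψ (ofLp m x) :=
    exists_ofLp_eq hm (ne_top_of_le_ne_top hη (hball _ ((wnorm_ofLp hm x).trans_le hx)))
  choose! Φ hΦ using hlift
  have hmaps : MapsTo Φ s s := fun x hx => by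
    change ‖Φ x‖ₑ ≤ η
    rw [← wnorm_ofLp hm, hΦ x hx]
    exact hball _ ((wnorm_ofLp hm x).trans_le hx)
  have hcontr : ContractingWith 2⁻¹ (hmaps.restrict Φ s s) := by
    refine ⟨by rw [← NNReal.coe_lt_coe]; norm_num, fun x y => ?_⟩
    rw [Subtype.edist_eq, Subtype.edist_eq, MapsTo.val_restrict_apply, MapsTo.val_restrict_apply,
      edist_eq_enorm_sub, edist_eq_enorm_sub, ← wnorm_ofLp hm, ← wnorm_ofLp hm, ofLp_sub, ofLp_sub,
      hΦ _ x.2, hΦ _ y.2]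
    refine (hΨ _ _ ((wnorm_ofLp hm _).trans_le x.2) ((wnorm_ofLp hm _).trans_le y.2)).trans_eq ?_
    simp
  have hcomplete : IsComplete s := (isClosed_le continuous_enorm continuous_const).isComplete
  have h0s : (0 : lp (fun _ : ℕ => A) 1) ∈ s := by simp [s]
  obtain ⟨x, hx, hfix, -⟩ := hcontr.exists_fixedPoint' hcomplete hmaps h0s (edist_ne_top _ _)
  exact ⟨ofLp m x, (wnorm_ofLp hm x).trans_le hx, by rw [← hΦ x hx, hfix.eq]⟩

end FixedPoint

section RightHandSide

variable {A : Type*} [NormedCommRing A] [StarRing A] [NormedAlgebra ℝ A]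

/-- The right-hand side of the evolution equation for the Taylor series of `f`: if `D` is the
Taylor series of `f'` and `q` its inverse, then `f_t / (ξ f')` is the analytic function on the
disk with real part `σ |q|²` on the circle and real value at `0`, and `rhs σ D` is the Taylor
series of `f_t / ξ`. -/
def rhs (σ : ℝ) (D : A⟦X⟧) : A⟦X⟧ :=
  σ • (D * herglotz (corr (Ring.inverse D) (Ring.inverse D)))

theorem rhs_eq_of_mul_eq_one {D q : A⟦X⟧} (σ : ℝ) (h : D * q = 1) :
    rhs σ D = σ • (D * herglotz (corr q q)) := by
  rw [rhs, ringInverse_eq_of_mul_eq_one h]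

theorem l1norm_rhs_ne_top [NormedStarGroup A] {D q : A⟦X⟧} (σ : ℝ) (h : D * q = 1)
    (hD : l1norm D ≠ ∞) (hq : l1norm q ≠ ∞) : l1norm (rhs σ D) ≠ ∞ := by
  rw [rhs_eq_of_mul_eq_one σ h]
  refine ne_top_of_le_ne_top (ENNReal.mul_ne_top enorm_ne_top ?_) (wnorm_smul_le _ σ _)
  exact ne_top_of_le_ne_top
    (ENNReal.mul_ne_top hD (l1norm_herglotz_ne_top (l1norm_corr_ne_top hq hq)))
    (wnorm_mul_le 1 _ _)

theorem wnorm_rhs_sub_le [NormedStarGroup A] [CompleteSpace A] (σ : ℝ) {D₁ D₂ q₁ q₂ : A⟦X⟧}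
    {e : ℕ → A} {μ : A} {Q Φ : ℝ≥0∞} (hμ : star μ = μ) (he : ∀ x, Monotone fun j => ‖e j * x‖ₑ)
    (he0 : e 0 = 1) (h₁ : D₁ * q₁ = 1) (h₂ : D₂ * q₂ = 1) (hD₁ : l1norm D₁ ≠ ∞)
    (hD₂ : l1norm D₂ ≠ ∞) (hQ : Q ≠ ∞) (hq₁ : l1norm q₁ ≤ Q) (hq₂ : l1norm q₂ ≤ Q)
    (hΦ : wnorm e D₂ ≤ Φ) :
    wnorm (fun j => e j * μ) (rhs σ D₁ - rhs σ D₂) ≤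
      ‖σ‖ₑ * (4 * Q ^ 2 + 4 * Φ * Q ^ 3) * wnorm (fun j => e j * μ) (D₁ - D₂) := by
  rw [rhs_eq_of_mul_eq_one σ h₁, rhs_eq_of_mul_eq_one σ h₂, ← smul_sub, mul_assoc]
  refine (wnorm_smul_le _ _ _).trans ?_
  gcongr
  exact wnorm_mul_herglotz_sub_le hμ he he0 h₁ h₂ hD₁ hD₂ hQ hq₁ hq₂ hΦ

end RightHandSide

section Primitive

variable {a b : ℝ} (hab : a ≤ b)

/-- The primitive of a continuous function on `[a, b]` that vanishes at `a`. -/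
def prim (x : C(Icc a b, ℂ)) : C(Icc a b, ℂ) where
  toFun t := ∫ τ in a..t, IccExtend hab x τ
  continuous_toFun :=
    (intervalIntegral.continuous_primitive
      (fun _ _ => x.continuous.Icc_extend'.intervalIntegrable _ _) a).comp continuous_subtype_val

theorem prim_apply (x : C(Icc a b, ℂ)) (t : Icc a b) :
    prim hab x t = ∫ τ in a..t, IccExtend hab x τ := rfl

theorem prim_sub (x y : C(Icc a b, ℂ)) : prim hab (x - y) = prim hab x - prim hab y := by
  ext t
  rw [ContinuousMap.sub_apply, prim_apply, prim_apply, prim_apply,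
    ← intervalIntegral.integral_sub (x.continuous.Icc_extend'.intervalIntegrable _ _)
      (y.continuous.Icc_extend'.intervalIntegrable _ _)]
  rfl

theorem integral_exp_neg_mul_sub_le {κ : ℝ} (hκ : 0 < κ) (a t : ℝ) :
    ∫ τ in a..t, Real.exp (-κ * (t - τ)) ≤ κ⁻¹ := by
  have hderiv (τ : ℝ) : HasDerivAt (fun τ => κ⁻¹ * Real.exp (-κ * (t - τ)))
      (Real.exp (-κ * (t - τ))) τ := by
    have hlin : HasDerivAt (fun τ : ℝ => -κ * (t - τ)) (-κ * (-1)) τ :=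
      ((hasDerivAt_id τ).const_sub t).const_mul (-κ)
    refine (hlin.exp.const_mul κ⁻¹).congr_deriv ?_
    field_simp
  rw [intervalIntegral.integral_eq_sub_of_hasDerivAt (fun τ _ => hderiv τ)
    (Continuous.intervalIntegrable (by fun_prop) _ _)]
  simp only [sub_self, mul_zero, Real.exp_zero, mul_one]
  exact sub_le_self _ (by positivity)

theorem norm_mul_prim_le {m : C(Icc a b, ℂ)} {κ : ℝ} (hκ : 0 < κ)
    (hm : ∀ τ t : Icc a b, τ ≤ t → ‖m t‖ ≤ Real.exp (-κ * (t - τ)) * ‖m τ‖)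
    (x : C(Icc a b, ℂ)) : ‖m * prim hab x‖ ≤ κ⁻¹ * ‖m * x‖ := by
  rw [ContinuousMap.norm_le _ (by positivity)]
  intro t
  have hpoint : ∀ τ ∈ Ioc a (t : ℝ),
      ‖m t * IccExtend hab x τ‖ ≤ Real.exp (-κ * (t - τ)) * ‖m * x‖ := by
    intro τ hτ
    have hτ' : τ ∈ Icc a b := ⟨hτ.1.le, hτ.2.trans t.2.2⟩
    rw [IccExtend_of_mem hab _ hτ', norm_mul]
    calc ‖m t‖ * ‖x ⟨τ, hτ'⟩‖ ≤ Real.exp (-κ * (t - τ)) * ‖m ⟨τ, hτ'⟩‖ * ‖x ⟨τ, hτ'⟩‖ := by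
          gcongr
          exact hm ⟨τ, hτ'⟩ t hτ.2
      _ = Real.exp (-κ * (t - τ)) * ‖(m * x) ⟨τ, hτ'⟩‖ := by
          rw [ContinuousMap.mul_apply, norm_mul, mul_assoc]
      _ ≤ Real.exp (-κ * (t - τ)) * ‖m * x‖ := by
          gcongr
          exact ContinuousMap.norm_coe_le_norm _ _
  rw [ContinuousMap.mul_apply, prim_apply, ← intervalIntegral.integral_const_mul]
  refine (intervalIntegral.norm_integral_le_of_norm_le t.2.1 (.of_forall hpoint)
    (Continuous.intervalIntegrable (by fun_prop) _ _)).trans ?_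
  rw [intervalIntegral.integral_mul_const]
  gcongr
  exact integral_exp_neg_mul_sub_le hκ a t

/-- The series `∑ (j + 1) (∫ Wⱼ) ξʲ`, that is, the `ξ`-derivative of the termwise time primitive
of `∑ Wⱼ ξʲ⁺¹`. -/
def primSeries (W : C(Icc a b, ℂ)⟦X⟧) : C(Icc a b, ℂ)⟦X⟧ :=
  PowerSeries.mk fun j => (j + 1) • prim hab (coeff j W)

theorem coeff_primSeries (W : C(Icc a b, ℂ)⟦X⟧) (j : ℕ) :
    coeff j (primSeries hab W) = (j + 1) • prim hab (coeff j W) := by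
  simp only [primSeries, coeff_mk]

theorem primSeries_sub (W W' : C(Icc a b, ℂ)⟦X⟧) :
    primSeries hab (W - W') = primSeries hab W - primSeries hab W' := by
  ext1 j
  simp only [coeff_primSeries, map_sub, prim_sub, smul_sub]

theorem primSeries_zero : primSeries hab 0 = 0 := by
  simpa only [sub_self] using primSeries_sub hab 0 0

-- The factor `j + 1` lost to the `ξ`-derivative is regained from the decay rate of the weights.
theorem wnorm_primSeries_le {m : ℕ → C(Icc a b, ℂ)} {K : ℝ} (hK : 0 < K)
    (hm : ∀ j, ∀ τ t : Icc a b, τ ≤ t →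
      ‖m j t‖ ≤ Real.exp (-(K * (j + 1)) * (t - τ)) * ‖m j τ‖)
    (W : C(Icc a b, ℂ)⟦X⟧) :
    wnorm m (primSeries hab W) ≤ ENNReal.ofReal K⁻¹ * wnorm m W := by
  unfold wnorm
  rw [← ENNReal.tsum_mul_left]
  refine ENNReal.tsum_le_tsum fun j => ?_
  rw [coeff_primSeries, mul_smul_comm, ← ofReal_norm, ← ofReal_norm,
    ← ENNReal.ofReal_mul (by positivity)]
  refine ENNReal.ofReal_le_ofReal ?_
  calc ‖(j + 1) • (m j * prim hab (coeff j W))‖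
      ≤ ((j + 1 : ℕ) : ℝ) * ‖m j * prim hab (coeff j W)‖ := norm_nsmul_le
    _ ≤ ((j + 1 : ℕ) : ℝ) * ((K * (j + 1))⁻¹ * ‖m j * coeff j W‖) := by
        gcongr
        exact norm_mul_prim_le hab (by positivity) (hm j) (coeff j W)
    _ = K⁻¹ * ‖m j * coeff j W‖ := by
        push_cast
        field_simp

end Primitive

section ExponentialWeight

variable {a b S K : ℝ} {k₀ : ℕ}

/-- The weight `S e^{K (b - t)}` on the time interval `[a, b]`. Its powers serve as the weights of
power series with time-dependent coefficients, in the spirit of the Cauchy–Kovalevskaya theorem: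
the radius of analyticity shrinks in time. -/
def expWeight (a b S K : ℝ) : C(Icc a b, ℂ) :=
  ⟨fun t => ((S * Real.exp (K * (b - t)) : ℝ) : ℂ), by fun_prop⟩

theorem norm_expWeight (hS : 1 ≤ S) (t : Icc a b) :
    ‖expWeight a b S K t‖ = S * Real.exp (K * (b - t)) := by
  simp only [expWeight, ContinuousMap.coe_mk, Complex.norm_real, Real.norm_eq_abs]
  exact abs_of_nonneg (by positivity)

theorem le_norm_expWeight (hS : 1 ≤ S) (hK : 0 < K) (t : Icc a b) :
    S ≤ ‖expWeight a b S K t‖ := by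
  rw [norm_expWeight hS]
  have ht : 0 ≤ b - t := sub_nonneg.2 t.2.2
  exact le_mul_of_one_le_right (by positivity) (Real.one_le_exp (by positivity))

theorem norm_expWeight_pow_le (hS : 1 ≤ S) (hK : 0 < K) (t : Icc a b) (n : ℕ) :
    ‖(expWeight a b S K ^ n) t‖ ≤ (S * Real.exp (K * (b - a))) ^ n := by
  rw [ContinuousMap.pow_apply, norm_pow, norm_expWeight hS]
  gcongr
  exact t.2.1

theorem star_expWeight : star (expWeight a b S K) = expWeight a b S K := by
  ext t
  exact Complex.conj_ofReal _

theorem isUnit_expWeight (hS : 1 ≤ S) : IsUnit (expWeight a b S K) := by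
  rw [ContinuousMap.isUnit_iff_forall_ne_zero]
  intro t
  rw [← norm_pos_iff, norm_expWeight hS]
  positivity

theorem norm_expWeight_pow_decay (hS : 1 ≤ S) (hK : 0 < K) {j n : ℕ} (hn : j + 1 ≤ n)
    {τ t : Icc a b} (h : τ ≤ t) :
    ‖(expWeight a b S K ^ n) t‖ ≤
      Real.exp (-(K * (j + 1)) * (t - τ)) * ‖(expWeight a b S K ^ n) τ‖ := by
  have hsub : 0 ≤ (t : ℝ) - τ := sub_nonneg.2 h
  have hstep : ‖expWeight a b S K t‖ = Real.exp (-(K * (t - τ))) * ‖expWeight a b S K τ‖ := by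
    rw [norm_expWeight hS, norm_expWeight hS, mul_left_comm, ← Real.exp_add]
    congr 2
    ring
  rw [ContinuousMap.pow_apply, ContinuousMap.pow_apply, norm_pow, norm_pow, hstep, mul_pow,
    ← Real.exp_nat_mul]
  refine mul_le_mul_of_nonneg_right (Real.exp_le_exp.2 ?_) (by positivity)
  have hn' : (j : ℝ) + 1 ≤ n := by exact_mod_cast hn
  have : K * (t - τ) * (j + 1) ≤ K * (t - τ) * n := by gcongr
  linarith

theorem enorm_mul_le_of_norm_le {X : Type*} [TopologicalSpace X] [CompactSpace X] {e e' : C(X, ℂ)}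
    (h : ∀ t, ‖e t‖ ≤ ‖e' t‖) (x : C(X, ℂ)) : ‖e * x‖ₑ ≤ ‖e' * x‖ₑ := by
  rw [← ofReal_norm, ← ofReal_norm]
  refine ENNReal.ofReal_le_ofReal ((ContinuousMap.norm_le _ (norm_nonneg _)).2 fun t => ?_)
  refine le_trans ?_ (ContinuousMap.norm_coe_le_norm _ t)
  rw [ContinuousMap.mul_apply, ContinuousMap.mul_apply, norm_mul, norm_mul]
  gcongr
  exact h t

theorem enorm_expWeight_pow_mul_mono (hS : 1 ≤ S) (hK : 0 < K) (x : C(Icc a b, ℂ)) :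
    Monotone fun n : ℕ => ‖expWeight a b S K ^ n * x‖ₑ := by
  refine fun n n' h => enorm_mul_le_of_norm_le (fun t => ?_) x
  simp only [ContinuousMap.pow_apply, norm_pow]
  exact pow_le_pow_right₀ (hS.trans (le_norm_expWeight hS hK t)) h

theorem wnorm_expWeight_mono (hS : 1 ≤ S) (hK : 0 < K) {ν ν' : ℕ → ℕ} (h : ∀ j, ν j ≤ ν' j)
    (V : C(Icc a b, ℂ)⟦X⟧) :
    wnorm (fun j => expWeight a b S K ^ ν j) V ≤ wnorm (fun j => expWeight a b S K ^ ν' j) V :=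
  wnorm_mono (fun j x => enorm_expWeight_pow_mul_mono hS hK x (h j)) V

theorem l1norm_le_wnorm_expWeight (hS : 1 ≤ S) (hK : 0 < K) (ν : ℕ → ℕ)
    (V : C(Icc a b, ℂ)⟦X⟧) : l1norm V ≤ wnorm (fun j => expWeight a b S K ^ ν j) V := by
  simpa only [pow_zero] using
    wnorm_expWeight_mono (ν := fun _ => 0) hS hK (fun j => (ν j).zero_le) V

theorem rnorm_le_wnorm_expWeight (hS : 1 ≤ S) (hK : 0 < K) {ν : ℕ → ℕ} (h : ∀ j, j ≤ ν j)
    (V : C(Icc a b, ℂ)⟦X⟧) : rnorm S V ≤ wnorm (fun j => expWeight a b S K ^ ν j) V := by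
  refine ENNReal.tsum_le_tsum fun j => ?_
  have hS0 : 0 ≤ S := zero_le_one.trans hS
  have hconst : ENNReal.ofReal (‖coeff j V‖ * S ^ j) =
      ‖ContinuousMap.const (Icc a b) ((S : ℂ) ^ j) * coeff j V‖ₑ := by
    have h : ContinuousMap.const (Icc a b) ((S : ℂ) ^ j) * coeff j V = (S ^ j) • coeff j V := by
      ext t
      simp
    rw [h, ← ofReal_norm, norm_smul, norm_pow, Real.norm_of_nonneg hS0, mul_comm]
  rw [hconst]
  refine enorm_mul_le_of_norm_le (fun t => ?_) _
  rw [ContinuousMap.const_apply, ContinuousMap.pow_apply, norm_pow, norm_pow, Complex.norm_real,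
    Real.norm_of_nonneg hS0]
  have ht := le_norm_expWeight hS hK t
  exact (pow_le_pow_left₀ hS0 ht j).trans (pow_le_pow_right₀ (hS.trans ht) (h j))

end ExponentialWeight

section CoefficientEquation

variable {a b S K σ : ℝ} {k₀ : ℕ} (hab : a ≤ b) {D₀ q₀ : C(Icc a b, ℂ)⟦X⟧} {Q Φ : ℝ≥0∞}

theorem wnorm_primSeries_rhs_sub_le (hS : 1 ≤ S) (hK : 0 < K) (hk₀ : 1 ≤ k₀)
    {D₁ D₂ q₁ q₂ : C(Icc a b, ℂ)⟦X⟧} (h₁ : D₁ * q₁ = 1) (h₂ : D₂ * q₂ = 1)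
    (hD₁ : l1norm D₁ ≠ ∞) (hD₂ : l1norm D₂ ≠ ∞) (hQ : Q ≠ ∞) (hq₁ : l1norm q₁ ≤ Q)
    (hq₂ : l1norm q₂ ≤ Q) (hΦ : wnorm (fun j => expWeight a b S K ^ (j + 1 - k₀)) D₂ ≤ Φ)
    (hKL : ENNReal.ofReal K⁻¹ * (‖σ‖ₑ * (4 * Q ^ 2 + 4 * Φ * Q ^ 3)) ≤ 2⁻¹) :
    wnorm (fun j => expWeight a b S K ^ max (j + 1) k₀)
        (primSeries hab (rhs σ D₁ - rhs σ D₂)) ≤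
      2⁻¹ * wnorm (fun j => expWeight a b S K ^ max (j + 1) k₀) (D₁ - D₂) := by
  refine (wnorm_primSeries_le hab hK (fun j τ t h =>
    norm_expWeight_pow_decay hS hK (le_max_left _ _) h) _).trans ?_
  have hμ : star (expWeight a b S K ^ k₀) = expWeight a b S K ^ k₀ := by
    rw [star_pow, star_expWeight]
  have he (x : C(Icc a b, ℂ)) : Monotone fun j => ‖expWeight a b S K ^ (j + 1 - k₀) * x‖ₑ :=
    fun i j h => enorm_expWeight_pow_mul_mono hS hK x (by gcongr)
  have hlip := wnorm_rhs_sub_le σ hμ he (by simp [Nat.sub_eq_zero_of_le hk₀]) h₁ h₂ hD₁ hD₂ hQ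
    hq₁ hq₂ hΦ
  simp only [← pow_add, Nat.sub_add_eq_max] at hlip
  calc _ ≤ _ := mul_le_mul_right hlip _
    _ ≤ _ := by
      rw [← mul_assoc]
      gcongr

-- The shift of the exponents by `k₀` makes this bound independent of the rate `K`, which may
-- therefore be chosen after the Lipschitz constant of the right-hand side.
theorem wnorm_expWeight_shift_le (hS : 1 ≤ S) (hK : 0 < K)
    (hD₀ : ∀ j, k₀ ≤ j → coeff j D₀ = 0) (V : C(Icc a b, ℂ)⟦X⟧) :
    wnorm (fun j => expWeight a b S K ^ (j + 1 - k₀)) (D₀ + V) ≤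
      l1norm D₀ + wnorm (fun j => expWeight a b S K ^ max (j + 1) k₀) V := by
  refine (wnorm_add_le _ _ _).trans (add_le_add (ENNReal.tsum_le_tsum fun j => ?_)
    (wnorm_expWeight_mono hS hK (fun j => (Nat.sub_le _ _).trans (le_max_left _ _)) V))
  rcases lt_or_ge j k₀ with hj | hj
  · simp only [Nat.sub_eq_zero_of_le (show j + 1 ≤ k₀ from hj), pow_zero, le_refl]
  · simp [hD₀ j hj]

theorem exists_eq_add_primSeries_of_wnorm_le (hS : 1 ≤ S) (hK : 0 < K) (hk₀ : 1 ≤ k₀)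
    (h₀ : D₀ * q₀ = 1) (hD₀ : ∀ j, k₀ ≤ j → coeff j D₀ = 0) (hD₀_top : l1norm D₀ ≠ ∞)
    (hQ : 2 * l1norm q₀ ≤ Q) (hQ_top : Q ≠ ∞)
    (hKL : ENNReal.ofReal K⁻¹ * (‖σ‖ₑ * (4 * Q ^ 2 + 4 * (l1norm D₀ + 1) * Q ^ 3)) ≤ 2⁻¹)
    {η : ℝ≥0∞} (hη : η ≤ 1) (hqη : l1norm q₀ * η ≤ 2⁻¹) {c : C(Icc a b, ℂ)⟦X⟧}
    (hc : wnorm (fun j => expWeight a b S K ^ max (j + 1) k₀) c ≤ 2⁻¹ * η) :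
    ∃ D q, D * q = 1 ∧ l1norm q ≤ Q ∧
      wnorm (fun j => expWeight a b S K ^ max (j + 1) k₀) (D - D₀) ≤ η ∧
      D = D₀ + c + primSeries hab (rhs σ D - rhs σ D₀) := by
  set m : ℕ → C(Icc a b, ℂ) := fun j => expWeight a b S K ^ max (j + 1) k₀
  have : Nonempty (Icc a b) := ⟨a, left_mem_Icc.2 hab⟩
  have hη_top : η ≠ ∞ := ne_top_of_le_ne_top ENNReal.one_ne_top hη
  have hl1 (V : C(Icc a b, ℂ)⟦X⟧) (hV : wnorm m V ≤ η) : l1norm V ≤ η :=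
    (l1norm_le_wnorm_expWeight hS hK _ V).trans hV
  have hinv (V : C(Icc a b, ℂ)⟦X⟧) (hV : wnorm m V ≤ η) :
      ∃ q, (D₀ + V) * q = 1 ∧ l1norm q ≤ Q := by
    obtain ⟨q, hq, hqQ⟩ := exists_mul_eq_one_of_l1norm_mul_le h₀
      ((mul_le_mul_right (hl1 V hV) _).trans hqη)
    exact ⟨q, hq, hqQ.trans hQ⟩
  have htop (V : C(Icc a b, ℂ)⟦X⟧) (hV : wnorm m V ≤ η) : l1norm (D₀ + V) ≠ ∞ :=
    ne_top_of_le_ne_top (ENNReal.add_ne_top.2 ⟨hD₀_top, hη_top⟩)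
      ((wnorm_add_le _ _ _).trans (add_le_add_right (hl1 V hV) _))
  have hcontr (V₁ V₂ : C(Icc a b, ℂ)⟦X⟧) (hV₁ : wnorm m V₁ ≤ η) (hV₂ : wnorm m V₂ ≤ η) :
      wnorm m (c + primSeries hab (rhs σ (D₀ + V₁) - rhs σ D₀) -
        (c + primSeries hab (rhs σ (D₀ + V₂) - rhs σ D₀))) ≤ 2⁻¹ * wnorm m (V₁ - V₂) := by
    obtain ⟨q₁, hq₁, hqQ₁⟩ := hinv V₁ hV₁
    obtain ⟨q₂, hq₂, hqQ₂⟩ := hinv V₂ hV₂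
    rw [add_sub_add_left_eq_sub, ← primSeries_sub, sub_sub_sub_cancel_right,
      ← add_sub_add_left_eq_sub V₁ V₂ D₀]
    exact wnorm_primSeries_rhs_sub_le hab hS hK hk₀ hq₁ hq₂ (htop V₁ hV₁) (htop V₂ hV₂) hQ_top
      hqQ₁ hqQ₂ ((wnorm_expWeight_shift_le hS hK hD₀ V₂).trans
        (add_le_add_right (hV₂.trans hη) _)) hKL
  obtain ⟨V, hV, hfix⟩ := exists_wnorm_le_and_eq (fun j => (isUnit_expWeight hS).pow _)
    (fun V => c + primSeries hab (rhs σ (D₀ + V) - rhs σ D₀)) hη_top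
    (by simpa only [add_zero, sub_self, primSeries_zero] using hc) hcontr
  obtain ⟨q, hq, hqQ⟩ := hinv V hV
  exact ⟨D₀ + V, q, hq, hqQ, by rwa [add_sub_cancel_left], by rw [add_assoc, hfix]⟩

theorem exists_pos_ofReal_mul_le {L : ℝ≥0∞} (hL : L ≠ ∞) :
    ∃ η : ℝ, 0 < η ∧ ENNReal.ofReal η * L ≤ 2⁻¹ := by
  refine ⟨(2 * (L.toReal + 1))⁻¹, by positivity, ?_⟩
  have hL' : L ≤ ENNReal.ofReal (L.toReal + 1) :=
    (ENNReal.ofReal_toReal hL).symm.le.trans (ENNReal.ofReal_le_ofReal (by linarith))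
  calc _ ≤ ENNReal.ofReal (2 * (L.toReal + 1))⁻¹ * ENNReal.ofReal (L.toReal + 1) := by gcongr
    _ = ENNReal.ofReal 2⁻¹ := by
      rw [← ENNReal.ofReal_mul (by positivity)]
      congr 1
      field_simp
    _ = 2⁻¹ := by rw [ENNReal.ofReal_inv_of_pos two_pos, ENNReal.ofReal_ofNat]

theorem wnorm_expWeight_le_rnorm {s : ℝ} (hS : 1 ≤ S) (hK : 0 < K)
    (hs : S * Real.exp (K * (b - a)) ≤ s) {n : ℕ} {ν : ℕ → ℕ} (hν : ∀ j, ν j ≤ n + j)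
    (V : C(Icc a b, ℂ)⟦X⟧) :
    wnorm (fun j => expWeight a b S K ^ ν j) V ≤ ENNReal.ofReal (s ^ n) * rnorm s V := by
  have : 0 < s := lt_of_lt_of_le (by positivity) hs
  unfold wnorm rnorm
  rw [← ENNReal.tsum_mul_left]
  refine ENNReal.tsum_le_tsum fun j => ?_
  refine (enorm_expWeight_pow_mul_mono hS hK _ (hν j)).trans ?_
  beta_reduce
  rw [← ENNReal.ofReal_mul (by positivity), ← ofReal_norm]
  refine ENNReal.ofReal_le_ofReal ((ContinuousMap.norm_le _ (by positivity)).2 fun t => ?_)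
  rw [ContinuousMap.mul_apply, norm_mul, mul_left_comm, ← pow_add, mul_comm]
  gcongr
  · exact ContinuousMap.norm_coe_le_norm _ _
  · exact (norm_expWeight_pow_le hS hK t _).trans (by gcongr)

theorem rnorm_map_algebraMap_le {s : ℝ} (hs : 0 ≤ s) (c : ℂ⟦X⟧) :
    rnorm s (c.map (algebraMap ℂ C(Icc a b, ℂ))) ≤ rnorm s c := by
  unfold rnorm
  gcongr with j
  rw [coeff_map]
  exact (ContinuousMap.norm_le _ (norm_nonneg _)).2 fun t => le_rfl

theorem exists_eq_add_primSeries (σ : ℝ) (hS : 1 ≤ S) (hk₀ : 1 ≤ k₀) (h₀ : D₀ * q₀ = 1)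
    (hD₀ : ∀ j, k₀ ≤ j → coeff j D₀ = 0) (hq₀ : l1norm q₀ ≠ ∞) {θ : ℝ} (hθ : 0 < θ) :
    ∃ s₀ ≥ S, ∃ δ > 0, ∀ c : ℂ⟦X⟧, rnorm s₀ c ≤ ENNReal.ofReal δ →
      ∃ D q : C(Icc a b, ℂ)⟦X⟧, D * q = 1 ∧ l1norm D ≠ ∞ ∧ l1norm q ≠ ∞ ∧
        rnorm S (D - D₀) ≤ ENNReal.ofReal θ ∧
        D = D₀ + c.map (algebraMap ℂ C(Icc a b, ℂ)) +
          primSeries hab (rhs σ D - rhs σ D₀) := by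
  have hD₀_top : l1norm D₀ ≠ ∞ := l1norm_ne_top <|
    summable_of_ne_finset_zero (s := range k₀) fun j hj => by
      rw [hD₀ j (by simpa using hj), norm_zero]
  have hQ : 2 * l1norm q₀ ≠ ∞ := ENNReal.mul_ne_top ENNReal.ofNat_ne_top hq₀
  obtain ⟨κ, hκ, hκL⟩ := exists_pos_ofReal_mul_le
    (L := ‖σ‖ₑ * (4 * (2 * l1norm q₀) ^ 2 + 4 * (l1norm D₀ + 1) * (2 * l1norm q₀) ^ 3))
    (by finiteness)
  have hK : 0 < κ⁻¹ := inv_pos.2 hκ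
  obtain ⟨η₀, hη₀, hη₀q⟩ := exists_pos_ofReal_mul_le hq₀
  set η := min η₀ (min 1 θ)
  have : 0 < η := by positivity
  set s₀ := S * Real.exp (κ⁻¹ * (b - a))
  have hs₀ : S ≤ s₀ := le_mul_of_one_le_right (by positivity)
    (Real.one_le_exp (mul_nonneg hK.le (sub_nonneg.2 hab)))
  have : 0 < s₀ := by positivity
  refine ⟨s₀, hs₀, (s₀ ^ k₀)⁻¹ * (2⁻¹ * η), by positivity, fun c hc => ?_⟩
  have hcη : wnorm (fun j => expWeight a b S κ⁻¹ ^ max (j + 1) k₀)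
      (c.map (algebraMap ℂ C(Icc a b, ℂ))) ≤ 2⁻¹ * ENNReal.ofReal η := by
    refine (wnorm_expWeight_le_rnorm hS hK le_rfl (n := k₀) (fun j => by omega) _).trans ?_
    calc _ ≤ ENNReal.ofReal (s₀ ^ k₀) * ENNReal.ofReal ((s₀ ^ k₀)⁻¹ * (2⁻¹ * η)) := by
          gcongr
          exact (rnorm_map_algebraMap_le (by positivity) c).trans hc
      _ = ENNReal.ofReal (2⁻¹ * η) := by
        rw [← ENNReal.ofReal_mul (by positivity), mul_inv_cancel_left₀ (by positivity)]
      _ = 2⁻¹ * ENNReal.ofReal η := by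
        rw [ENNReal.ofReal_mul (by positivity), ENNReal.ofReal_inv_of_pos two_pos,
          ENNReal.ofReal_ofNat]
  obtain ⟨D, q, hDq, hq, hV, hD⟩ := exists_eq_add_primSeries_of_wnorm_le hab hS hK hk₀ h₀ hD₀
    hD₀_top le_rfl hQ (by rwa [inv_inv]) (η := ENNReal.ofReal η)
    (ENNReal.ofReal_le_one.2 ((min_le_right _ _).trans (min_le_left _ _)))
    (by
      rw [mul_comm]
      exact (mul_le_mul_left (ENNReal.ofReal_le_ofReal (min_le_left _ _)) _).trans hη₀q) hcη
  refine ⟨D, q, hDq, ?_, ne_top_of_le_ne_top hQ hq, ?_, hD⟩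
  · rw [← sub_add_cancel D D₀]
    exact ne_top_of_le_ne_top (ENNReal.add_ne_top.2 ⟨ne_top_of_le_ne_top ENNReal.ofReal_ne_top
      ((l1norm_le_wnorm_expWeight hS hK _ _).trans hV), hD₀_top⟩) (wnorm_add_le _ _ _)
  · exact ((rnorm_le_wnorm_expWeight hS hK (fun j => j.le_succ.trans (le_max_left _ _)) _).trans
      hV).trans (ENNReal.ofReal_le_ofReal ((min_le_right _ _).trans (min_le_right _ _)))

theorem eq_of_sub_eq_primSeries (hK : 0 < K) (hS : Real.exp (K * (b - a)) ≤ S)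
    {D₁ D₂ q₁ q₂ : C(Icc a b, ℂ)⟦X⟧} (h₁ : D₁ * q₁ = 1) (h₂ : D₂ * q₂ = 1) (hQ : Q ≠ ∞)
    (hq₁ : l1norm q₁ ≤ Q) (hq₂ : l1norm q₂ ≤ Q) (hΦ : Φ ≠ ∞) (hD₁ : rnorm S D₁ ≤ Φ)
    (hD₂ : rnorm S D₂ ≤ Φ)
    (hKL : ENNReal.ofReal K⁻¹ * (‖σ‖ₑ * (4 * Q ^ 2 + 4 * Φ * Q ^ 3)) ≤ 2⁻¹)
    (h : D₁ - D₂ = primSeries hab (rhs σ D₁ - rhs σ D₂)) : D₁ = D₂ := by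
  have hle {n : ℕ} {ν : ℕ → ℕ} (hν : ∀ j, ν j ≤ n + j) {V : C(Icc a b, ℂ)⟦X⟧}
      (hV : rnorm S V ≤ Φ) :
      wnorm (fun j => expWeight a b 1 K ^ ν j) V ≤ ENNReal.ofReal (S ^ n) * Φ :=
    (wnorm_expWeight_le_rnorm (s := S) le_rfl hK (by rwa [one_mul]) hν V).trans (by gcongr)
  have htop {V : C(Icc a b, ℂ)⟦X⟧} (hV : rnorm S V ≤ Φ) : l1norm V ≠ ∞ :=
    ne_top_of_le_ne_top (by finiteness)
      ((l1norm_le_wnorm_expWeight le_rfl hK _ V).trans (hle (fun j => (Nat.zero_add j).ge) hV))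
  set N := wnorm (fun j => expWeight a b 1 K ^ max (j + 1) 1) (D₁ - D₂)
  have hN_top : N ≠ ∞ := by
    have hmax (j : ℕ) : max (j + 1) 1 ≤ 1 + j := by omega
    exact ne_top_of_le_ne_top (by finiteness)
      ((wnorm_sub_le _ _ _).trans (add_le_add (hle hmax hD₁) (hle hmax hD₂)))
  have hhalf : N ≤ N / 2 := by
    have hcontr := wnorm_primSeries_rhs_sub_le hab le_rfl hK le_rfl h₁ h₂ (htop hD₁) (htop hD₂) hQ
      hq₁ hq₂ (by simpa using hle (n := 0) (fun j => by omega) hD₂) hKL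
    rwa [← h, ← ENNReal.div_eq_inv_mul] at hcontr
  have hN : N = 0 := by_contra fun hne => (ENNReal.half_lt_self hne hN_top).not_ge hhalf
  refine sub_eq_zero.1 (PowerSeries.ext fun j => ?_)
  have hj := (ENNReal.tsum_eq_zero.1 hN) j
  rwa [enorm_eq_zero, ((isUnit_expWeight le_rfl).pow _).mul_right_eq_zero] at hj

end CoefficientEquation

section Scalar

/-- The sum of a power series with complex coefficients. -/
def psum (a : ℂ⟦X⟧) (ξ : ℂ) : ℂ := ∑' n, coeff n a * ξ ^ n

variable {a b : ℂ⟦X⟧} {s : ℝ}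

theorem norm_coeff_mul_pow_le {ξ : ℂ} (hξ : ‖ξ‖ ≤ s) (n : ℕ) :
    ‖coeff n a * ξ ^ n‖ ≤ ‖coeff n a‖ * s ^ n := by
  rw [norm_mul, norm_pow]
  gcongr

theorem summable_psum (ha : Summable fun n => ‖coeff n a‖ * s ^ n) {ξ : ℂ} (hξ : ‖ξ‖ ≤ s) :
    Summable fun n => coeff n a * ξ ^ n :=
  Summable.of_norm_bounded ha fun n => norm_coeff_mul_pow_le hξ n

theorem continuousOn_psum (ha : Summable fun n => ‖coeff n a‖ * s ^ n) :
    ContinuousOn (psum a) (Metric.closedBall 0 s) :=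
  continuousOn_tsum (fun n => by fun_prop) ha fun n ξ hξ =>
    norm_coeff_mul_pow_le (by simpa using hξ) n

theorem differentiableOn_psum (ha : Summable fun n => ‖coeff n a‖ * s ^ n) :
    DifferentiableOn ℂ (psum a) (Metric.ball 0 s) :=
  Complex.differentiableOn_tsum_of_summable_norm ha (fun n => by fun_prop) Metric.isOpen_ball
    fun n ξ hξ => norm_coeff_mul_pow_le (mem_ball_zero_iff.1 hξ).le n

theorem psum_mul (ha : Summable fun n => ‖coeff n a‖ * s ^ n)
    (hb : Summable fun n => ‖coeff n b‖ * s ^ n) {ξ : ℂ} (hξ : ‖ξ‖ ≤ s) :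
    psum (a * b) ξ = psum a ξ * psum b ξ := by
  have ha' : Summable fun n => ‖coeff n a * ξ ^ n‖ :=
    Summable.of_nonneg_of_le (fun _ => norm_nonneg _) (fun n => norm_coeff_mul_pow_le hξ n) ha
  have hb' : Summable fun n => ‖coeff n b * ξ ^ n‖ :=
    Summable.of_nonneg_of_le (fun _ => norm_nonneg _) (fun n => norm_coeff_mul_pow_le hξ n) hb
  unfold psum
  rw [tsum_mul_tsum_eq_tsum_sum_antidiagonal_of_summable_norm ha' hb']
  refine tsum_congr fun n => ?_
  rw [coeff_mul, sum_mul]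
  refine sum_congr rfl fun p hp => ?_
  rw [← mem_antidiagonal.1 hp, pow_add]
  ring

theorem psum_one (ξ : ℂ) : psum 1 ξ = 1 := by
  unfold psum
  rw [tsum_eq_single 0 (by intro n hn; simp [coeff_one, hn])]
  simp

theorem psum_apply_zero (a : ℂ⟦X⟧) : psum a 0 = coeff 0 a := by
  unfold psum
  rw [tsum_eq_single 0 fun n hn => by simp [hn]]
  simp

theorem summable_pow_one (ha : l1norm a ≠ ∞) : Summable fun n => ‖coeff n a‖ * (1 : ℝ) ^ n := by
  simpa using summable_norm_coeff ha

theorem hasSum_taylorCoeff {f : ℂ → ℂ} {R : ℝ} (hf : DifferentiableOn ℂ f (Metric.ball 0 R)) {ξ : ℂ}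
    (hξ : ‖ξ‖ < R) : HasSum (fun n => taylorCoeff f n * ξ ^ n) (f ξ) := by
  have := Complex.hasSum_taylorSeries_on_ball hf (z := ξ) (by simpa using hξ)
  refine this.congr_fun fun n => ?_
  simp only [taylorCoeff, sub_zero, smul_eq_mul]
  field_simp

theorem norm_taylorCoeff_le {f : ℂ → ℂ} {R B : ℝ} (hR : 0 < R)
    (hf : DiffContOnCl ℂ f (Metric.ball 0 R)) (hB : ∀ ξ ∈ Metric.sphere (0 : ℂ) R, ‖f ξ‖ ≤ B)
    (n : ℕ) : ‖taylorCoeff f n‖ ≤ B / R ^ n := by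
  have := Complex.norm_iteratedDeriv_le_of_forall_mem_sphere_norm_le n hR hf hB
  rw [taylorCoeff, norm_div, Complex.norm_natCast, div_le_iff₀ (by positivity)]
  refine this.trans (le_of_eq ?_)
  ring

theorem taylorCoeff_congr {f g : ℂ → ℂ} (h : f =ᶠ[𝓝 0] g) (n : ℕ) :
    taylorCoeff f n = taylorCoeff g n := by
  simp only [taylorCoeff, h.iteratedDeriv_eq n]

theorem taylorCoeff_eq_of_hasFPowerSeriesAt {f : ℂ → ℂ} {p : FormalMultilinearSeries ℂ ℂ ℂ}
    (h : HasFPowerSeriesAt f p 0) (n : ℕ) : taylorCoeff f n = p.coeff n := by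
  have := h.eq_formalMultilinearSeries
    ((AnalyticAt.hasFPowerSeriesAt ⟨p, h⟩ : HasFPowerSeriesAt f _ 0))
  rw [this]
  simp [taylorCoeff, FormalMultilinearSeries.coeff_ofScalars, div_eq_inv_mul]

theorem taylorCoeff_eq_of_hasSum {f : ℂ → ℂ} (hs : 0 < s) {c : ℕ → ℂ}
    (h : ∀ ξ : ℂ, ‖ξ‖ < s → HasSum (fun n => c n * ξ ^ n) (f ξ)) (n : ℕ) :
    taylorCoeff f n = c n := by
  have hp : HasFPowerSeriesAt f (FormalMultilinearSeries.ofScalars ℂ c) 0 := by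
    rw [hasFPowerSeriesAt_iff]
    filter_upwards [Metric.ball_mem_nhds (0 : ℂ) hs] with z hz
    have := h z (by simpa using hz)
    simpa [FormalMultilinearSeries.coeff_ofScalars, mul_comm] using this
  rw [taylorCoeff_eq_of_hasFPowerSeriesAt hp, FormalMultilinearSeries.coeff_ofScalars]

theorem taylorCoeff_psum (hs : 0 < s) (ha : Summable fun n => ‖coeff n a‖ * s ^ n) (n : ℕ) :
    taylorCoeff (psum a) n = coeff n a :=
  taylorCoeff_eq_of_hasSum hs (fun _ hξ => (summable_psum ha hξ.le).hasSum) n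

theorem taylorCoeff_zero (f : ℂ → ℂ) : taylorCoeff f 0 = f 0 := by
  simp [taylorCoeff]

theorem taylorCoeff_one (f : ℂ → ℂ) : taylorCoeff f 1 = deriv f 0 := by
  simp [taylorCoeff]

theorem taylorCoeff_iteratedDeriv (f : ℂ → ℂ) (n i : ℕ) :
    taylorCoeff (iteratedDeriv n f) i = ((i + n).descFactorial n : ℂ) * taylorCoeff f (i + n) := by
  have hiter : iteratedDeriv i (iteratedDeriv n f) = iteratedDeriv (i + n) f := by
    simp only [iteratedDeriv_eq_iterate, Function.iterate_add_apply]
  have hfact : ((i + n).factorial : ℂ) = i.factorial * (i + n).descFactorial n := by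
    rw [← Nat.factorial_mul_descFactorial (Nat.le_add_left n i), Nat.add_sub_cancel, Nat.cast_mul]
  have hne : ((i + n).descFactorial n : ℂ) ≠ 0 :=
    Nat.cast_ne_zero.2 (Nat.descFactorial_pos.2 (Nat.le_add_left n i)).ne'
  rw [taylorCoeff, taylorCoeff, hiter, hfact]
  field_simp

theorem taylorCoeff_deriv (f : ℂ → ℂ) (i : ℕ) :
    taylorCoeff (deriv f) i = ((i : ℂ) + 1) * taylorCoeff f (i + 1) := by
  have := taylorCoeff_iteratedDeriv f 1 i
  simpa [iteratedDeriv_one, Nat.descFactorial_one] using this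

theorem taylorCoeff_sub {f g : ℂ → ℂ} (hf : AnalyticAt ℂ f 0) (hg : AnalyticAt ℂ g 0) (n : ℕ) :
    taylorCoeff (f - g) n = taylorCoeff f n - taylorCoeff g n := by
  rw [taylorCoeff, iteratedDeriv_sub hf.contDiffAt hg.contDiffAt, sub_div, taylorCoeff, taylorCoeff]

theorem taylorCoeff_div_const (f : ℂ → ℂ) (c : ℂ) (n : ℕ) :
    taylorCoeff (fun ξ => f ξ / c) n = taylorCoeff f n / c := by
  rw [taylorCoeff, iteratedDeriv_div_const, taylorCoeff, div_right_comm]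

/-- The Taylor series at `0`. -/
def taylorSeries (f : ℂ → ℂ) : ℂ⟦X⟧ := PowerSeries.mk (taylorCoeff f)

theorem coeff_taylorSeries (f : ℂ → ℂ) (n : ℕ) : coeff n (taylorSeries f) = taylorCoeff f n := by
  simp [taylorSeries]

theorem taylorSeries_deriv_sub {f g : ℂ → ℂ} (hf : AnalyticAt ℂ f 0) (hg : AnalyticAt ℂ g 0) :
    taylorSeries (deriv (f - g)) = taylorSeries (deriv f) - taylorSeries (deriv g) := by
  ext n
  simp only [map_sub, coeff_taylorSeries, taylorCoeff_deriv, taylorCoeff_sub hf hg, mul_sub]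

theorem taylorSeries_mul {f g : ℂ → ℂ} (hf : AnalyticAt ℂ f 0) (hg : AnalyticAt ℂ g 0) :
    taylorSeries (f * g) = taylorSeries f * taylorSeries g := by
  ext n
  simp only [coeff_mul, coeff_taylorSeries, taylorCoeff]
  rw [iteratedDeriv_mul hf.contDiffAt hg.contDiffAt, sum_div,
    Nat.sum_antidiagonal_eq_sum_range_succ
      (fun i j => iteratedDeriv i f 0 / i.factorial * (iteratedDeriv j g 0 / j.factorial))]
  refine sum_congr rfl fun i hi => ?_
  have hn : (n.factorial : ℂ) ≠ 0 := Nat.cast_ne_zero.2 n.factorial_ne_zero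
  rw [Nat.cast_choose ℂ (Nat.lt_succ_iff.1 (mem_range.1 hi))]
  field_simp

theorem taylorSeries_mul_taylorSeries_inv {f : ℂ → ℂ} (hf : AnalyticAt ℂ f 0) (h0 : f 0 ≠ 0) :
    taylorSeries f * taylorSeries f⁻¹ = 1 := by
  have hone : f * f⁻¹ =ᶠ[𝓝 0] fun _ => 1 := by
    filter_upwards [hf.continuousAt.eventually_ne h0] with ξ hξ using mul_inv_cancel₀ hξ
  rw [← taylorSeries_mul hf (hf.inv h0)]
  ext n
  rw [coeff_taylorSeries, taylorCoeff_congr hone, coeff_one, taylorCoeff, iteratedDeriv_const]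
  split_ifs with hn <;> simp [hn]

theorem psum_taylorSeries {f : ℂ → ℂ} {R : ℝ} (hf : DifferentiableOn ℂ f (Metric.ball 0 R)) {ξ : ℂ}
    (hξ : ‖ξ‖ < R) : psum (taylorSeries f) ξ = f ξ := by
  simp only [psum, coeff_taylorSeries]
  exact (hasSum_taylorCoeff hf hξ).tsum_eq

theorem summable_norm_taylorCoeff {f : ℂ → ℂ} {R : ℝ} (hf : DifferentiableOn ℂ f (Metric.ball 0 R))
    (hs0 : 0 ≤ s) (hs : s < R) : Summable fun n => ‖taylorCoeff f n‖ * s ^ n := by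
  have := (hasSum_taylorCoeff hf (ξ := (s : ℂ))
    (by rwa [Complex.norm_real, Real.norm_of_nonneg hs0])).summable.norm
  simpa [abs_of_nonneg hs0] using this

end Scalar

section Circle

theorem bijective_diagonal_split : Function.Bijective
    (Sum.elim (fun p => (p.1 + p.2, p.2)) (fun p => (p.2, p.1 + 1 + p.2)) :
      (ℕ × ℕ) ⊕ (ℕ × ℕ) → ℕ × ℕ) := by
  constructor
  · rintro (⟨n, b⟩ | ⟨n, b⟩) (⟨n', b'⟩ | ⟨n', b'⟩) h <;>
      simp only [Sum.elim_inl, Sum.elim_inr, Prod.mk.injEq, Sum.inl.injEq, Sum.inr.injEq,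
        reduceCtorEq] at h ⊢ <;> omega
  · rintro ⟨x, y⟩
    by_cases h : y ≤ x
    · exact ⟨Sum.inl (x - y, y), by simp; omega⟩
    · exact ⟨Sum.inr (y - x - 1, x), by simp; omega⟩

theorem tsum_mul_star_tsum {x : ℕ → ℂ} (hx : Summable fun n => ‖x n‖) :
    (∑' n, x n) * star (∑' n, x n) = ∑' n, ∑' b, x (n + b) * star (x b) +
      star (∑' n, ∑' b, x (n + 1 + b) * star (x b)) := by
  have hx' : Summable fun n => ‖star (x n)‖ := by simpa only [norm_star] using hx
  have hprod : Summable fun p : ℕ × ℕ => x p.1 * star (x p.2) :=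
    summable_mul_of_summable_norm (f := x) (g := fun n => star (x n)) hx hx'
  let u : ℕ × ℕ → ℕ × ℕ := fun p => (p.1 + p.2, p.2)
  let v : ℕ × ℕ → ℕ × ℕ := fun p => (p.2, p.1 + 1 + p.2)
  have huv : Function.Bijective (Sum.elim u v) := bijective_diagonal_split
  have hl : Summable fun p : ℕ × ℕ => x (p.1 + p.2) * star (x p.2) :=
    hprod.comp_injective (i := u) (huv.1.comp Sum.inl_injective)
  have hr : Summable fun p : ℕ × ℕ => x p.2 * star (x (p.1 + 1 + p.2)) :=
    hprod.comp_injective (i := v) (huv.1.comp Sum.inr_injective)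
  have hsplit : HasSum ((fun p : ℕ × ℕ => x p.1 * star (x p.2)) ∘ Sum.elim u v) _ :=
    hl.hasSum.sum hr.hasSum
  calc (∑' n, x n) * star (∑' n, x n)
      = ∑' p : ℕ × ℕ, x p.1 * star (x p.2) := by
        rw [tsum_star, tsum_mul_tsum_of_summable_norm (f := x) (g := fun n => star (x n)) hx hx']
    _ = ∑' p : ℕ × ℕ, x (p.1 + p.2) * star (x p.2) +
          ∑' p : ℕ × ℕ, x p.2 * star (x (p.1 + 1 + p.2)) := by
        rw [← hsplit.tsum_eq, ← (Equiv.ofBijective _ huv).tsum_eq]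
        rfl
    _ = _ := by
        rw [hl.tsum_prod, hr.tsum_prod]
        simp only [tsum_star, star_mul, star_star]

variable {q : ℂ⟦X⟧} {ξ : ℂ}

theorem psum_herglotz {c : ℂ⟦X⟧} (hc : Summable fun n => coeff n c * ξ ^ n) :
    psum (herglotz c) ξ = 2 * psum c ξ - coeff 0 c := by
  have hC : HasSum (fun n => coeff n (C (coeff 0 c)) * ξ ^ n) (coeff 0 c) := by
    convert hasSum_ite_eq 0 (coeff 0 c) using 2 with n
    rw [coeff_C]
    split_ifs with hn <;> simp [hn]
  refine (((hc.hasSum.mul_left 2).sub hC).congr_fun fun n => ?_).tsum_eq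
  rw [herglotz, two_mul, map_sub, map_add]
  ring

theorem tsum_mul_star_eq_coeff_corr (hq : l1norm q ≠ ∞) (hξ : ‖ξ‖ = 1) (n : ℕ) :
    ∑' b, (coeff (n + b) q * ξ ^ (n + b)) * star (coeff b q * ξ ^ b) =
      coeff n (corr q q) * ξ ^ n := by
  have hξ' : ξ * star ξ = 1 := by
    rw [Complex.star_def, Complex.mul_conj, Complex.normSq_eq_norm_sq, hξ, one_pow,
      Complex.ofReal_one]
  rw [coeff_corr, ← (summable_corr hq hq n).tsum_mul_right]
  refine tsum_congr fun b => ?_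
  rw [star_mul, star_pow, pow_add]
  calc _ = coeff (n + b) q * star (coeff b q) * ξ ^ n * (ξ * star ξ) ^ b := by ring
    _ = _ := by rw [hξ', one_pow, mul_one]

theorem norm_psum_sq (hq : l1norm q ≠ ∞) (hξ : ‖ξ‖ = 1) :
    ((‖psum q ξ‖ ^ 2 : ℝ) : ℂ) =
      psum (corr q q) ξ + star (psum (corr q q) ξ) - coeff 0 (corr q q) := by
  have hx : Summable fun n => ‖coeff n q * ξ ^ n‖ := by
    simpa [norm_mul, norm_pow, hξ] using summable_norm_coeff hq
  have hc : Summable fun n => coeff n (corr q q) * ξ ^ n :=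
    summable_psum (summable_pow_one (l1norm_corr_ne_top hq hq)) hξ.le
  have hmul := tsum_mul_star_tsum hx
  simp only [tsum_mul_star_eq_coeff_corr hq hξ] at hmul
  have htail : ∑' n, coeff (n + 1) (corr q q) * ξ ^ (n + 1) =
      psum (corr q q) ξ - coeff 0 (corr q q) := by
    rw [psum, hc.tsum_eq_zero_add, pow_zero, mul_one, add_sub_cancel_left]
  calc ((‖psum q ξ‖ ^ 2 : ℝ) : ℂ) = psum q ξ * star (psum q ξ) := by
        rw [Complex.star_def, Complex.mul_conj, Complex.normSq_eq_norm_sq]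
    _ = _ := hmul
    _ = _ := by
        rw [htail, star_sub, star_coeff_zero_corr_self, psum]
        ring

theorem re_psum_herglotz_corr (hq : l1norm q ≠ ∞) (hξ : ‖ξ‖ = 1) :
    (psum (herglotz (corr q q)) ξ).re = ‖psum q ξ‖ ^ 2 := by
  have hsq := congrArg Complex.re (norm_psum_sq hq hξ)
  rw [Complex.ofReal_re] at hsq
  rw [hsq, psum_herglotz (summable_psum (summable_pow_one (l1norm_corr_ne_top hq hq)) hξ.le),
    two_mul]
  simp only [Complex.sub_re, Complex.add_re, Complex.star_def, Complex.conj_re]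

theorem re_eq_zero_of_re_eq_zero_on_circle {c : ℂ → ℂ} (hc : DiffContOnCl ℂ c (Metric.ball 0 1))
    (hre : ∀ ξ : ℂ, ‖ξ‖ = 1 → (c ξ).re = 0) {z : ℂ} (hz : z ∈ Metric.ball (0 : ℂ) 1) :
    (c z).re = 0 := by
  have hbound (s : ℝ) : Real.exp (s * (c z).re) ≤ 1 := by
    have hd : DiffContOnCl ℂ (fun z => Complex.exp (s * c z)) (Metric.ball 0 1) :=
      Complex.differentiable_exp.comp_diffContOnCl ((diffContOnCl_const (c := (s : ℂ))).smul hc)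
    have hmax := Complex.norm_le_of_forall_mem_frontier_norm_le Metric.isBounded_ball hd (C := 1)
      (fun w hw => ?_) (subset_closure hz)
    · simpa [Complex.norm_exp] using hmax
    · rw [frontier_ball _ one_ne_zero] at hw
      simp [Complex.norm_exp, hre w (by simpa using hw)]
  have hpos := Real.exp_le_one_iff.1 (hbound 1)
  have hneg := Real.exp_le_one_iff.1 (hbound (-1))
  linarith

theorem eq_zero_of_re_eq_zero_on_circle {c : ℂ → ℂ} (hc : DiffContOnCl ℂ c (Metric.ball 0 1))
    (hre : ∀ ξ : ℂ, ‖ξ‖ = 1 → (c ξ).re = 0) (h0 : (c 0).im = 0) (hξ : ‖ξ‖ < 1) :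
    c ξ = 0 := by
  have h0mem : (0 : ℂ) ∈ Metric.ball (0 : ℂ) 1 := by simp
  have hre' : ∀ z ∈ Metric.ball (0 : ℂ) 1, (c z).re = 0 := fun z =>
    re_eq_zero_of_re_eq_zero_on_circle hc hre
  obtain ⟨k, hk⟩ := AnalyticOnNhd.eq_const_of_re_eq_const
    (hc.differentiableOn.analyticOnNhd Metric.isOpen_ball) hre' Metric.isOpen_ball
    ((convex_ball (0 : ℂ) 1).isConnected ⟨0, h0mem⟩)
  rw [hk ξ (mem_ball_zero_iff.2 hξ), ← hk 0 h0mem]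
  exact Complex.ext (hre' 0 h0mem) h0

end Circle

section Univalent

variable {f : ℂ → ℂ} {U : Set ℂ} {z : ℂ}

theorem not_eventually_eq_const_of_injOn (hU : IsOpen U) (hinj : InjOn f U) (hz : z ∈ U) (c : ℂ) :
    ¬∀ᶠ w in 𝓝 z, f w = c := by
  intro h
  have hU' : ∀ᶠ w in 𝓝 z, w ∈ U := hU.mem_nhds hz
  obtain ⟨w, ⟨hw, hwU⟩, hwz⟩ :=
    ((h.and hU').filter_mono nhdsWithin_le_nhds |>.and (self_mem_nhdsWithin (s := {z}ᶜ))).exists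
  exact hwz (hinj hwU hz (hw.trans h.self_of_nhds.symm))

theorem eventually_deriv_ne_zero_of_injOn (hU : IsOpen U) (hf : DifferentiableOn ℂ f U)
    (hinj : InjOn f U) (hz : z ∈ U) : ∀ᶠ w in 𝓝[≠] z, deriv f w ≠ 0 := by
  have hd : AnalyticAt ℂ (deriv f) z := (hf.analyticAt (hU.mem_nhds hz)).deriv
  refine hd.eventually_eq_zero_or_eventually_ne_zero.resolve_left fun h => ?_
  obtain ⟨ε, hε, hball⟩ := Metric.eventually_nhds_iff_ball.1 (h.and (hU.mem_nhds hz))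
  obtain ⟨c, hc⟩ := Metric.isOpen_ball.exists_is_const_of_deriv_eq_zero
    (convex_ball z ε).isPreconnected (hf.mono fun w hw => (hball w hw).2) fun w hw => (hball w hw).1
  exact not_eventually_eq_const_of_injOn hU hinj hz c
    (eventually_of_mem (Metric.ball_mem_nhds z hε) hc)

theorem nhds_le_map_nhds_of_injOn (hU : IsOpen U) (hf : DifferentiableOn ℂ f U)
    (hinj : InjOn f U) (hz : z ∈ U) : 𝓝 (f z) ≤ map f (𝓝 z) :=
  (hf.analyticAt (hU.mem_nhds hz)).eventually_constant_or_nhds_le_map_nhds.resolve_left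
    (not_eventually_eq_const_of_injOn hU hinj hz _)

theorem continuousAt_invFunOn (hU : IsOpen U) (hf : DifferentiableOn ℂ f U)
    (hinj : InjOn f U) (hz : z ∈ U) : ContinuousAt (Function.invFunOn f U) (f z) := by
  have hleft := hinj.leftInvOn_invFunOn
  rw [ContinuousAt, hleft hz]
  refine Tendsto.mono_left (tendsto_map'_iff.2 ?_) (nhds_le_map_nhds_of_injOn hU hf hinj hz)
  exact tendsto_id.congr' ((hU.eventually_mem hz).mono fun w hw => (hleft hw).symm)

-- The continuous inverse is differentiable at the image of every nearby point other than `z`,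
-- hence at `f z` by the removable singularity theorem, and the chain rule applies.
theorem deriv_ne_zero_of_injOn (hU : IsOpen U) (hf : DifferentiableOn ℂ f U)
    (hinj : InjOn f U) (hz : z ∈ U) : deriv f z ≠ 0 := by
  set g := Function.invFunOn f U
  have hleft : LeftInvOn g f U := hinj.leftInvOn_invFunOn
  have hgf : ∀ᶠ w in 𝓝 z, g (f w) = w := (hU.eventually_mem hz).mono hleft
  have hdiff {w : ℂ} (hw : w ∈ U) (hd : deriv f w ≠ 0) : DifferentiableAt ℂ g (f w) := by
    refine (HasDerivAt.of_local_left_inverse (continuousAt_invFunOn hU hf hinj hw)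
      (f := f) (f' := deriv f w) ?_ hd ?_).differentiableAt
    · rw [show Function.invFunOn f U (f w) = w from hleft hw]
      exact (hf.differentiableAt (hU.mem_nhds hw)).hasDerivAt
    · refine nhds_le_map_nhds_of_injOn hU hf hinj hw (eventually_map.2 ?_)
      exact (hU.eventually_mem hw).mono fun v hv => congrArg f (hleft hv)
  have hpunct : ∀ᶠ y in 𝓝[≠] f z, DifferentiableAt ℂ g y := by
    refine eventually_nhdsWithin_iff.2
      (nhds_le_map_nhds_of_injOn hU hf hinj hz (eventually_map.2 ?_))
    filter_upwards [hU.mem_nhds hz,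
      eventually_nhdsWithin_iff.1 (eventually_deriv_ne_zero_of_injOn hU hf hinj hz)]
      with w hwU hw hne
    exact hdiff hwU (hw fun h => hne (congrArg f h))
  have hg : DifferentiableAt ℂ g (f z) :=
    (Complex.analyticAt_of_differentiable_on_punctured_nhds_of_continuousAt hpunct
      (continuousAt_invFunOn hU hf hinj hz)).differentiableAt
  have hcomp := hg.hasDerivAt.comp z (hf.differentiableAt (hU.mem_nhds hz)).hasDerivAt
  have hone := hcomp.unique ((hasDerivAt_id z).congr_of_eventuallyEq hgf)
  exact right_ne_zero_of_mul (hone ▸ one_ne_zero)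

end Univalent

section Equation

theorem psum_smul (σ : ℝ) (a : ℂ⟦X⟧) (ξ : ℂ) : psum (σ • a) ξ = σ * psum a ξ := by
  unfold psum
  rw [← tsum_mul_left]
  exact tsum_congr fun n => by rw [coeff_smul, Complex.real_smul, mul_assoc]

theorem diffContOnCl_psum {a : ℂ⟦X⟧} {s : ℝ} (hs : s ≠ 0)
    (ha : Summable fun n => ‖coeff n a‖ * s ^ n) : DiffContOnCl ℂ (psum a) (Metric.ball 0 s) :=
  ⟨differentiableOn_psum ha, by rw [closure_ball _ hs]; exact continuousOn_psum ha⟩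

theorem taylorCoeff_succ_of_dslope_eq_psum {w : ℂ → ℂ} {a : ℂ⟦X⟧} {s : ℝ} (hs : 0 < s)
    (ha : Summable fun n => ‖coeff n a‖ * s ^ n) (hw0 : w 0 = 0)
    (hw : ∀ ξ : ℂ, ‖ξ‖ < s → dslope w 0 ξ = psum a ξ) (j : ℕ) :
    taylorCoeff w (j + 1) = coeff j a := by
  have hsum (ξ : ℂ) (hξ : ‖ξ‖ < s) : HasSum (fun n => coeff n (X * a) * ξ ^ n) (w ξ) := by
    have hwξ : w ξ = ξ * psum a ξ := by
      simpa [hw0, hw ξ hξ] using (sub_smul_dslope w 0 ξ).symm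
    rw [hwξ, ← hasSum_nat_add_iff' 1, range_one, sum_singleton, coeff_zero_X_mul, zero_mul,
      sub_zero]
    refine ((summable_psum ha hξ.le).hasSum.mul_left ξ).congr_fun fun n => ?_
    rw [coeff_succ_X_mul]
    ring
  rw [taylorCoeff_eq_of_hasSum hs hsum, coeff_succ_X_mul]

theorem re_mul_eq_re_mul_norm_sq {W d u ζ : ℂ} (hζ : ‖ζ‖ = 1) (h : d * u = 1) :
    (W * u).re = (ζ * W * (starRingEnd ℂ) (d * ζ)).re * ‖u‖ ^ 2 := by
  have hζ' : ζ * (starRingEnd ℂ) ζ = 1 := by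
    rw [Complex.mul_conj, Complex.normSq_eq_norm_sq, hζ, one_pow, Complex.ofReal_one]
  have hu : ((‖u‖ ^ 2 : ℝ) : ℂ) = u * (starRingEnd ℂ) u := by
    rw [Complex.mul_conj, Complex.normSq_eq_norm_sq]
  have h' : (starRingEnd ℂ) d * (starRingEnd ℂ) u = 1 := by rw [← map_mul, h, map_one]
  rw [← Complex.re_mul_ofReal, hu, map_mul]
  congr 1
  linear_combination (-(W * u)) * h' - W * u * (starRingEnd ℂ) d * (starRingEnd ℂ) u * hζ'

-- Dividing the boundary condition by `|ξ f'|²` turns it into the Schwarz problem for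
-- `w / (ξ f')`, whose solution is unique up to an imaginary constant.
theorem dslope_mul_psum_eq {σ R : ℝ} (hR : 1 < R) {f' w : ℂ → ℂ} {q : ℂ⟦X⟧}
    (hw : DifferentiableOn ℂ w (Metric.ball 0 R)) (hq : l1norm q ≠ ∞) (hw0 : w 0 = 0)
    (hfq : ∀ ξ : ℂ, ‖ξ‖ = 1 → f' ξ * psum q ξ = 1) (him : (deriv w 0 * coeff 0 q).im = 0)
    (hPG : ∀ ξ : ℂ, ‖ξ‖ = 1 → (w ξ * (starRingEnd ℂ) (f' ξ * ξ)).re = σ) {ξ : ℂ}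
    (hξ : ‖ξ‖ < 1) :
    dslope w 0 ξ * psum q ξ = σ * psum (herglotz (corr q q)) ξ := by
  have hH := summable_pow_one (l1norm_herglotz_ne_top (l1norm_corr_ne_top hq hq))
  have hW : DiffContOnCl ℂ (dslope w 0) (Metric.ball 0 1) := by
    refine DifferentiableOn.diffContOnCl_ball (U := Metric.ball 0 R) ?_
      (Metric.closedBall_subset_ball hR)
    exact (Complex.differentiableOn_dslope (Metric.ball_mem_nhds _ (one_pos.trans hR))).2 hw
  refine sub_eq_zero.1 (eq_zero_of_re_eq_zero_on_circle
    (c := fun ξ => dslope w 0 ξ * psum q ξ - σ * psum (herglotz (corr q q)) ξ)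
    ((hW.smul (diffContOnCl_psum one_ne_zero (summable_pow_one hq))).sub
      ((diffContOnCl_const (c := (σ : ℂ))).smul (diffContOnCl_psum one_ne_zero hH)))
    (fun ζ hζ => ?_) ?_ hξ)
  · have hwζ : ζ * dslope w 0 ζ = w ζ := by simpa [hw0] using sub_smul_dslope w 0 ζ
    rw [Complex.sub_re, Complex.re_ofReal_mul, re_psum_herglotz_corr hq hζ,
      re_mul_eq_re_mul_norm_sq hζ (hfq ζ hζ), hwζ, hPG ζ hζ, sub_self]
  · have hreal : (coeff 0 (corr q q)).im = 0 :=
      Complex.conj_eq_iff_im.1 (star_coeff_zero_corr_self q)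
    simp only [dslope_same, psum_apply_zero, herglotz, two_mul, map_sub, map_add, coeff_zero_C,
      Complex.sub_im, him, Complex.im_ofReal_mul, Complex.add_im, hreal]
    ring

theorem taylorCoeff_succ_eq_coeff_rhs {σ R : ℝ} (hR : 1 < R) {f w : ℂ → ℂ}
    (hf : DifferentiableOn ℂ f (Metric.ball 0 R)) (hw : DifferentiableOn ℂ w (Metric.ball 0 R))
    {q : ℂ⟦X⟧} (hq : taylorSeries (deriv f) * q = 1) (hq1 : l1norm q ≠ ∞)
    (hw0 : w 0 = 0) (him : (deriv w 0 * coeff 0 q).im = 0)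
    (hPG : ∀ ξ : ℂ, ‖ξ‖ = 1 → (w ξ * (starRingEnd ℂ) (deriv f ξ * ξ)).re = σ) (j : ℕ) :
    taylorCoeff w (j + 1) = coeff j (rhs σ (taylorSeries (deriv f))) := by
  have hf' : DifferentiableOn ℂ (deriv f) (Metric.ball 0 R) := hf.deriv Metric.isOpen_ball
  have hD : Summable fun n => ‖coeff n (taylorSeries (deriv f))‖ * (1 : ℝ) ^ n := by
    simpa only [coeff_taylorSeries] using summable_norm_taylorCoeff hf' zero_le_one hR
  have hD1 : l1norm (taylorSeries (deriv f)) ≠ ∞ := l1norm_ne_top (by simpa using hD)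
  have hH := summable_pow_one (l1norm_herglotz_ne_top (l1norm_corr_ne_top hq1 hq1))
  have hfq (ξ : ℂ) (hξ : ‖ξ‖ ≤ 1) : deriv f ξ * psum q ξ = 1 := by
    rw [← psum_taylorSeries hf' (hξ.trans_lt hR), ← psum_mul hD (summable_pow_one hq1) hξ, hq,
      psum_one]
  refine taylorCoeff_succ_of_dslope_eq_psum one_pos
    (summable_pow_one (l1norm_rhs_ne_top σ hq hD1 hq1)) hw0 (fun ξ hξ => ?_) j
  have hdslope := dslope_mul_psum_eq hR hw hq1 hw0 (fun ξ hξ => hfq ξ hξ.le) him hPG hξ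
  rw [rhs_eq_of_mul_eq_one σ hq, psum_smul, psum_mul hD hH hξ.le,
    psum_taylorSeries hf' (hξ.trans hR)]
  linear_combination deriv f ξ * hdslope - dslope w 0 ξ * hfq ξ hξ.le

end Equation

section Evaluation

variable {X : Type*} [TopologicalSpace X]

/-- Coefficientwise evaluation at `x` of a power series whose coefficients are functions on `X`. -/
def evalAt (x : X) : C(X, ℂ)⟦X⟧ →+* ℂ⟦X⟧ :=
  PowerSeries.map (ContinuousMap.evalStarAlgHom ℂ ℂ x : C(X, ℂ) →⋆ₐ[ℂ] ℂ)

theorem coeff_evalAt (x : X) (D : C(X, ℂ)⟦X⟧) (n : ℕ) : coeff n (evalAt x D) = coeff n D x := by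
  simp [evalAt]

theorem evalAt_map_algebraMap (x : X) (c : ℂ⟦X⟧) :
    evalAt x (c.map (algebraMap ℂ C(X, ℂ))) = c := by
  ext n
  rw [coeff_evalAt, coeff_map, _root_.algebraMap_apply, smul_eq_mul, mul_one]

variable [CompactSpace X] {D q : C(X, ℂ)⟦X⟧}

theorem l1norm_evalAt_ne_top (x : X) (hD : l1norm D ≠ ∞) : l1norm (evalAt x D) ≠ ∞ := by
  refine l1norm_ne_top (.of_nonneg_of_le (fun _ => norm_nonneg _) (fun n => ?_)
    (summable_norm_coeff hD))
  rw [coeff_evalAt]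
  exact ContinuousMap.norm_coe_le_norm _ _

theorem evalAt_corr (x : X) (hD : l1norm D ≠ ∞) (hq : l1norm q ≠ ∞) :
    evalAt x (corr D q) = corr (evalAt x D) (evalAt x q) := by
  ext n
  have heval := (summable_corr hD hq n).hasSum.map
    (ContinuousMap.evalStarAlgHom ℂ ℂ x : C(X, ℂ) →⋆ₐ[ℂ] ℂ) (continuous_eval_const x)
  rw [coeff_evalAt, coeff_corr, coeff_corr]
  refine heval.tsum_eq.symm.trans (tsum_congr fun i => ?_)
  simp [coeff_evalAt]

theorem evalAt_herglotz (x : X) (c : C(X, ℂ)⟦X⟧) :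
    evalAt x (herglotz c) = herglotz (evalAt x c) := by
  ext n
  simp only [herglotz, two_mul, map_sub, map_add, coeff_evalAt, coeff_C]
  split_ifs <;> simp

theorem evalAt_rhs (σ : ℝ) (x : X) (h : D * q = 1) (hq : l1norm q ≠ ∞) :
    evalAt x (rhs σ D) = rhs σ (evalAt x D) := by
  rw [rhs_eq_of_mul_eq_one σ h,
    rhs_eq_of_mul_eq_one σ (q := evalAt x q) (by rw [← map_mul, h, map_one]),
    ← evalAt_corr x hq hq, ← evalAt_herglotz, ← map_mul]
  ext n
  rw [coeff_evalAt, coeff_smul, ContinuousMap.smul_apply, coeff_smul, coeff_evalAt]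

end Evaluation

section TimeDerivative

variable {U : Set ℂ} {I : Set ℝ} {f ft : ℝ → ℂ → ℂ}

theorem tendsto_iteratedDeriv {ι : Type*} {l : Filter ι} {F : ι → ℂ → ℂ} {g : ℂ → ℂ} {z : ℂ}
    (hU : IsOpen U) (hz : z ∈ U) (hF : ∀ᶠ i in l, DifferentiableOn ℂ (F i) U)
    (h : TendstoLocallyUniformlyOn F g l U) (n : ℕ) :
    Tendsto (fun i => iteratedDeriv n (F i) z) l (𝓝 (iteratedDeriv n g z)) := by
  induction n generalizing F g with
  | zero => simpa using h.tendsto_at hz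
  | succ n ih =>
    simp only [iteratedDeriv_succ']
    exact ih (hF.mono fun i hi => hi.deriv hU) (h.deriv hF hU)

theorem HasContTimeDeriv.mono {V : Set ℂ} {J : Set ℝ} (h : HasContTimeDeriv U I f ft)
    (hV : V ⊆ U) (hJ : J ⊆ I) : HasContTimeDeriv V J f ft where
  analytic t ht := (h.analytic t (hJ ht)).mono hV
  analytic_deriv t ht := (h.analytic_deriv t (hJ ht)).mono hV
  hasDeriv t ht u hu x hx := by
    obtain ⟨v, hv, hev⟩ := h.hasDeriv t (hJ ht) u hu x (hV hx)
    exact ⟨v, nhdsWithin_mono _ hV hv,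
      hev.filter_mono (nhdsWithin_mono _ (sdiff_subset_sdiff_left hJ))⟩
  cont t ht u hu x hx := by
    obtain ⟨v, hv, hev⟩ := h.cont t (hJ ht) u hu x (hV hx)
    exact ⟨v, nhdsWithin_mono _ hV hv, hev.filter_mono (nhdsWithin_mono _ hJ)⟩

theorem IsC1InH.mono {V : Set ℂ} (h : IsC1InH U I f) (hVU : V ⊆ U) :
    IsC1InH V I f :=
  h.imp fun _ hft => hft.mono hVU subset_rfl

theorem HasContTimeDeriv.hasDerivWithinAt_taylorCoeff (h : HasContTimeDeriv U I f ft)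
    (hU : IsOpen U) (h0 : (0 : ℂ) ∈ U) {t : ℝ} (ht : t ∈ I) (n : ℕ) :
    HasDerivWithinAt (fun s => taylorCoeff (f s) n) (taylorCoeff (ft t) n) I t := by
  rw [hasDerivWithinAt_iff_tendsto_slope]
  have hI : ∀ᶠ s in 𝓝[I \ {t}] t, s ∈ I := by
    filter_upwards [self_mem_nhdsWithin] with s hs using hs.1
  have hlim := (tendsto_iteratedDeriv hU h0
    (hI.mono fun s hs => ((h.analytic s hs).sub (h.analytic t ht)).div_const _)
    (h.hasDeriv t ht) n).div_const (n.factorial : ℂ)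
  refine hlim.congr' (hI.mono fun s hs => ?_)
  rw [← taylorCoeff, taylorCoeff_div_const, taylorCoeff_sub
    ((h.analytic s hs).analyticAt (hU.mem_nhds h0)) ((h.analytic t ht).analyticAt (hU.mem_nhds h0)),
    slope_def_module, div_eq_inv_mul, ← Complex.ofReal_sub, ← Complex.ofReal_inv, Complex.real_smul]

theorem HasContTimeDeriv.tendstoLocallyUniformlyOn (h : HasContTimeDeriv U I f ft)
    (hU : IsOpen U) {t : ℝ} (ht : t ∈ I) : TendstoLocallyUniformlyOn f (f t) (𝓝[I] t) U := by
  rw [tendstoLocallyUniformlyOn_iff_forall_isCompact hU]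
  intro K hKU hK
  have hquot := (tendstoLocallyUniformlyOn_iff_forall_isCompact hU).1 (h.hasDeriv t ht) K hKU hK
  obtain ⟨M, hM⟩ := hK.exists_bound_of_continuousOn ((h.analytic_deriv t ht).continuousOn.mono hKU)
  rw [Metric.tendstoUniformlyOn_iff] at hquot ⊢
  intro ε hε
  have hM₁ : 0 < |M| + 1 := by positivity
  have hev := hquot 1 one_pos
  rw [eventually_nhdsWithin_iff] at hev ⊢
  filter_upwards [hev, Metric.ball_mem_nhds t (div_pos hε hM₁)] with s hs hst hsI ξ hξ
  by_cases hts : s = t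
  · simpa [hts] using hε
  have hne : (s : ℂ) - t ≠ 0 := sub_ne_zero.2 (Complex.ofReal_injective.ne hts)
  have hle : ‖(f s ξ - f t ξ) / ((s : ℂ) - t)‖ ≤ |M| + 1 := by
    have hdist := hs ⟨hsI, hts⟩ ξ hξ
    rw [dist_comm, dist_eq_norm] at hdist
    linarith [norm_sub_norm_le ((f s ξ - f t ξ) / ((s : ℂ) - t)) (ft t ξ), hM ξ hξ, le_abs_self M]
  rw [Metric.mem_ball, Real.dist_eq, lt_div_iff₀' hM₁] at hst
  calc dist (f t ξ) (f s ξ) = ‖(f s ξ - f t ξ) / ((s : ℂ) - t)‖ * |s - t| := by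
        rw [← Real.norm_eq_abs, ← Complex.norm_real, Complex.ofReal_sub, norm_div,
          div_mul_cancel₀ _ (norm_ne_zero_iff.2 hne), dist_comm, dist_eq_norm]
    _ ≤ (|M| + 1) * |s - t| := by gcongr
    _ < ε := hst

theorem IsStrongSolution.mono {σ : ℝ} {J : Set ℝ} (h : IsStrongSolution σ I f) (hJ : J ⊆ I) :
    IsStrongSolution σ J f := by
  obtain ⟨hO, ft, hderiv, hPG⟩ := h
  refine ⟨fun t ht => hO t (hJ ht), ft, fun t ht => ?_, fun t ht => hPG t (hJ ht)⟩
  obtain ⟨R, hR, η, hη, hd⟩ := hderiv t (hJ ht)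
  exact ⟨R, hR, η, hη, hd.mono subset_rfl (inter_subset_inter_left _ hJ)⟩

theorem InO.apply_zero {E : Set ℂ} {f : ℂ → ℂ} (h : InO E f) : f 0 = 0 := h.2.1

theorem InO.deriv_ne_zero {E : Set ℂ} {f : ℂ → ℂ} (h : InO E f) {ξ : ℂ} (hξ : ξ ∈ E) :
    deriv f ξ ≠ 0 := by
  obtain ⟨⟨U, hU, hEU, hd, hinj⟩, -⟩ := h
  exact deriv_ne_zero_of_injOn hU hd hinj (hEU hξ)

end TimeDerivative

section StrongSolution

/-- `f` is continuous on the closed disk of radius `R`, analytic inside, and both `|f|` and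
`1 / |f|` are at most `B` there. This is the control on `f'` under which the coefficient equation
is well posed. -/
structure IsBoundedUnit (R B : ℝ) (f : ℂ → ℂ) : Prop where
  diffContOnCl : DiffContOnCl ℂ f (Metric.ball 0 R)
  ne_zero : ∀ ξ, ‖ξ‖ ≤ R → f ξ ≠ 0
  norm_le : ∀ ξ, ‖ξ‖ ≤ R → ‖f ξ‖ ≤ B
  norm_inv_le : ∀ ξ, ‖ξ‖ ≤ R → ‖(f ξ)⁻¹‖ ≤ B

namespace IsBoundedUnit

variable {R B : ℝ} {f : ℂ → ℂ}

theorem mono {R' B' : ℝ} (h : IsBoundedUnit R B f) (hR : R' ≤ R) (hB : B ≤ B') :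
    IsBoundedUnit R' B' f where
  diffContOnCl := h.diffContOnCl.mono (Metric.ball_subset_ball hR)
  ne_zero ξ hξ := h.ne_zero ξ (hξ.trans hR)
  norm_le ξ hξ := (h.norm_le ξ (hξ.trans hR)).trans hB
  norm_inv_le ξ hξ := (h.norm_inv_le ξ (hξ.trans hR)).trans hB

theorem norm_taylorCoeff_le (h : IsBoundedUnit R B f) (hR : 0 < R) (n : ℕ) :
    ‖taylorCoeff f n‖ ≤ B / R ^ n :=
  HeleShaw.norm_taylorCoeff_le hR h.diffContOnCl
    (fun ξ hξ => h.norm_le ξ (mem_sphere_zero_iff_norm.1 hξ).le) n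

theorem inv (h : IsBoundedUnit R B f) (hR : 0 < R) : IsBoundedUnit R B f⁻¹ where
  diffContOnCl := h.diffContOnCl.inv fun ξ hξ => h.ne_zero ξ (by
    rwa [closure_ball _ hR.ne', mem_closedBall_zero_iff] at hξ)
  ne_zero ξ hξ := inv_ne_zero (h.ne_zero ξ hξ)
  norm_le := h.norm_inv_le
  norm_inv_le ξ hξ := by rw [Pi.inv_apply, inv_inv]; exact h.norm_le ξ hξ

theorem taylorSeries_mul_inv (h : IsBoundedUnit R B f) (hR : 0 < R) :
    taylorSeries f * taylorSeries f⁻¹ = 1 :=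
  taylorSeries_mul_taylorSeries_inv
    (h.diffContOnCl.differentiableOn.analyticAt (Metric.ball_mem_nhds 0 hR))
    (h.ne_zero 0 (norm_zero.trans_le hR.le))

theorem exists_series {X : Type*} [TopologicalSpace X] [CompactSpace X] [Nonempty X]
    {F : X → ℂ → ℂ} (h : ∀ x, IsBoundedUnit R B (F x)) (hR : 0 < R)
    (hF : ∀ n, Continuous fun x => taylorCoeff (F x) n) :
    ∃ D q : C(X, ℂ)⟦X⟧, D * q = 1 ∧ (∀ x, evalAt x D = taylorSeries (F x)) ∧
      (∀ n, ‖coeff n D‖ ≤ B / R ^ n) ∧ ∀ n, ‖coeff n q‖ ≤ B / R ^ n := by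
  let D : C(X, ℂ)⟦X⟧ := PowerSeries.mk fun n => ⟨fun x => taylorCoeff (F x) n, hF n⟩
  have hcoeff (n : ℕ) (x : X) : coeff n D x = taylorCoeff (F x) n := by
    simp only [D, coeff_mk, ContinuousMap.coe_mk]
  have hD (x : X) : evalAt x D = taylorSeries (F x) := by
    ext n
    rw [coeff_evalAt, hcoeff, coeff_taylorSeries]
  have hunit : IsUnit D := by
    rw [isUnit_iff_constantCoeff, ContinuousMap.isUnit_iff_forall_ne_zero]
    intro x
    rw [← coeff_zero_eq_constantCoeff_apply, hcoeff, taylorCoeff_zero]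
    exact (h x).ne_zero 0 (norm_zero.trans_le hR.le)
  obtain ⟨q, hq⟩ := hunit.exists_right_inv
  have hqx (x : X) : evalAt x q = taylorSeries (F x)⁻¹ := by
    rw [← ringInverse_eq_of_mul_eq_one ((h x).taylorSeries_mul_inv hR)]
    refine (ringInverse_eq_of_mul_eq_one ?_).symm
    rw [← hD, ← map_mul, hq, map_one]
  refine ⟨D, q, hq, hD, fun n => ?_, fun n => ?_⟩
  · rw [ContinuousMap.norm_le_of_nonempty]
    exact fun x => hcoeff n x ▸ (h x).norm_taylorCoeff_le hR n
  · rw [ContinuousMap.norm_le_of_nonempty]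
    intro x
    rw [← coeff_evalAt, hqx, coeff_taylorSeries]
    exact ((h x).inv hR).norm_taylorCoeff_le hR n

end IsBoundedUnit

theorem eq_zero_of_hasDerivWithinAt_of_forall_eq {E : Type*} [NormedAddCommGroup E]
    [NormedSpace ℝ E] {u : ℝ → E} {u' c : E} {I : Set ℝ} {t : ℝ} (hu : HasDerivWithinAt u u' I t)
    (hI : UniqueDiffOn ℝ I) (ht : t ∈ I) (hc : ∀ s ∈ I, u s = c) : u' = 0 :=
  (hI t ht).eq_deriv _ hu ((hasDerivWithinAt_const t I c).congr hc (hc t ht))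

variable {σ : ℝ} {I : Set ℝ} {f : ℝ → ℂ → ℂ} {t : ℝ}

theorem IsStrongSolution.exists_timeDeriv (h : IsStrongSolution σ I f) (hI : UniqueDiffOn ℝ I)
    (ht : t ∈ I) :
    ∃ w : ℂ → ℂ, (∀ n, HasDerivWithinAt (fun s => taylorCoeff (f s) n) (taylorCoeff w n) I t) ∧
      w 0 = 0 ∧ (deriv w 0).im = 0 ∧
      (∃ R > 1, DifferentiableOn ℂ (f t) (Metric.ball 0 R) ∧
        DifferentiableOn ℂ w (Metric.ball 0 R)) ∧
      ∀ ξ : ℂ, ‖ξ‖ = 1 → (w ξ * (starRingEnd ℂ) (deriv (f t) ξ * ξ)).re = σ := by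
  obtain ⟨hO, w, hw, hPG⟩ := h
  obtain ⟨R, hR, η, hη, hd⟩ := hw t ht
  have htη : t ∈ I ∩ Metric.ball t η := ⟨ht, Metric.mem_ball_self hη⟩
  have hder (n : ℕ) :
      HasDerivWithinAt (fun s => taylorCoeff (f s) n) (taylorCoeff (w t) n) I t :=
    (hasDerivWithinAt_inter (Metric.ball_mem_nhds t hη)).1 (hd.hasDerivWithinAt_taylorCoeff
      Metric.isOpen_ball (Metric.mem_ball_self (one_pos.trans hR)) htη n)
  refine ⟨w t, hder, ?_, ?_, ⟨R, hR, hd.analytic t htη, hd.analytic_deriv t htη⟩, hPG t ht⟩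
  · rw [← taylorCoeff_zero (w t)]
    refine eq_zero_of_hasDerivWithinAt_of_forall_eq (hder 0) hI ht (c := 0) fun s hs => ?_
    rw [taylorCoeff_zero, (hO s hs).apply_zero]
  · rw [← taylorCoeff_one (w t)]
    refine eq_zero_of_hasDerivWithinAt_of_forall_eq
      (Complex.imCLM.hasFDerivAt.comp_hasDerivWithinAt t (hder 1)) hI ht (c := 0) fun s hs => ?_
    rw [Function.comp_apply, taylorCoeff_one]
    exact (hO s hs).2.2.2

theorem IsStrongSolution.continuousOn_taylorCoeff (h : IsStrongSolution σ I f)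
    (hI : UniqueDiffOn ℝ I) (n : ℕ) : ContinuousOn (fun t => taylorCoeff (f t) n) I := fun _ ht =>
  let ⟨_, hder, _⟩ := h.exists_timeDeriv hI ht
  (hder n).continuousWithinAt

theorem IsStrongSolution.hasDerivWithinAt_taylorCoeff_succ (h : IsStrongSolution σ I f)
    (hI : UniqueDiffOn ℝ I) (ht : t ∈ I) {q : ℂ⟦X⟧} (hq : taylorSeries (deriv (f t)) * q = 1)
    (hq1 : l1norm q ≠ ∞) (j : ℕ) :
    HasDerivWithinAt (fun s => taylorCoeff (f s) (j + 1))
      (coeff j (rhs σ (taylorSeries (deriv (f t))))) I t := by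
  obtain ⟨w, hder, hw0, hw1, ⟨R, hR, hfR, hwR⟩, hPG⟩ := h.exists_timeDeriv hI ht
  have hq0 : coeff 0 q = (deriv (f t) 0)⁻¹ := by
    refine eq_inv_of_mul_eq_one_right ?_
    have h0 := congrArg (coeff 0) hq
    rwa [coeff_mul, Nat.antidiagonal_zero, sum_singleton, coeff_taylorSeries, taylorCoeff_zero,
      coeff_zero_one] at h0
  rw [← taylorCoeff_succ_eq_coeff_rhs hR hfR hwR hq hq1 hw0 ?_ hPG j]
  · exact hder (j + 1)
  · rw [hq0, ← div_eq_mul_inv, Complex.div_im, hw1, (h.1 t ht).2.2.2]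
    simp

theorem IsStrongSolution.eq_add_primSeries {a b : ℝ} (h : IsStrongSolution σ (Icc a b) f)
    (hab : a < b) {D q : C(Icc a b, ℂ)⟦X⟧} (hD : ∀ t, evalAt t D = taylorSeries (deriv (f t)))
    (hq : D * q = 1) (hq1 : l1norm q ≠ ∞) :
    D = (taylorSeries (deriv (f a))).map (algebraMap ℂ C(Icc a b, ℂ)) +
      primSeries hab.le (rhs σ D) := by
  ext j t
  have hI : UniqueDiffOn ℝ (Icc a b) := uniqueDiffOn_Icc hab
  have hder (τ : Icc a b) : HasDerivWithinAt (fun s => taylorCoeff (f s) (j + 1))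
      ((coeff j (rhs σ D) : C(Icc a b, ℂ)) τ) (Icc a b) τ := by
    rw [← coeff_evalAt, evalAt_rhs σ τ hq hq1, hD]
    refine h.hasDerivWithinAt_taylorCoeff_succ hI τ.2 ?_ (l1norm_evalAt_ne_top τ hq1) j
    rw [← hD, ← map_mul, hq, map_one]
  have hint : ∫ τ in a..(t : ℝ), IccExtend hab.le ⇑(coeff j (rhs σ D) : C(Icc a b, ℂ)) τ =
      taylorCoeff (f t) (j + 1) - taylorCoeff (f a) (j + 1) := by
    refine intervalIntegral.integral_eq_sub_of_hasDeriv_right_of_le t.2.1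
      ((h.continuousOn_taylorCoeff hI (j + 1)).mono (Icc_subset_Icc_right t.2.2))
      (fun τ hτ => ?_) ((coeff j (rhs σ D)).continuous.Icc_extend'.intervalIntegrable _ _)
    have hτb : τ < b := hτ.2.trans_le t.2.2
    have hτ' : τ ∈ Icc a b := ⟨hτ.1.le, hτb.le⟩
    rw [IccExtend_of_mem hab.le _ hτ']
    exact ((hder ⟨τ, hτ'⟩).hasDerivAt (Icc_mem_nhds hτ.1 hτb)).hasDerivWithinAt
  rw [map_add, ContinuousMap.add_apply, ← coeff_evalAt, hD, ← coeff_evalAt,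
    evalAt_map_algebraMap, coeff_primSeries, ContinuousMap.nsmul_apply, prim_apply, hint,
    coeff_taylorSeries, coeff_taylorSeries, taylorCoeff_deriv, taylorCoeff_deriv, nsmul_eq_mul]
  push_cast
  ring

end StrongSolution

section Uniqueness

theorem exists_gt_closedBall_subset {r : ℝ} (hr : 0 ≤ r) {U : Set ℂ} (hU : IsOpen U)
    (h : Metric.closedBall 0 r ⊆ U) : ∃ R > r, Metric.closedBall 0 R ⊆ U := by
  obtain ⟨δ, hδ, hthick⟩ := (isCompact_closedBall (0 : ℂ) r).exists_cthickening_subset_open hU h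
  rw [cthickening_closedBall hδ.le hr] at hthick
  exact ⟨δ + r, by linarith, hthick⟩

theorem exists_eventually_norm_le_and_norm_inv_le {ι X : Type*} [TopologicalSpace X]
    {l : Filter ι} {F : ι → X → ℂ} {g : X → ℂ} {K : Set X} (hK : IsCompact K)
    (hg : ContinuousOn g K) (hg0 : ∀ x ∈ K, g x ≠ 0) (hF : TendstoUniformlyOn F g l K) :
    ∃ B, ∀ᶠ i in l, ∀ x ∈ K, F i x ≠ 0 ∧ ‖F i x‖ ≤ B ∧ ‖(F i x)⁻¹‖ ≤ B := by
  obtain ⟨M₁, hM₁⟩ := hK.exists_bound_of_continuousOn hg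
  obtain ⟨M₂, hM₂⟩ := hK.exists_bound_of_continuousOn (hg.inv₀ hg0)
  obtain ⟨M, hM, hM₁M, hM₂M⟩ : ∃ M : ℝ, 1 ≤ M ∧ M₁ ≤ M ∧ M₂ ≤ M :=
    ⟨max 1 (max M₁ M₂), le_max_left _ _, (le_max_left _ _).trans (le_max_right _ _),
      (le_max_right _ _).trans (le_max_right _ _)⟩
  have hM0 : 0 < M := one_pos.trans_le hM
  refine ⟨2 * M, (Metric.tendstoUniformlyOn_iff.1 hF (2 * M)⁻¹ (by positivity)).mono
    fun i hi x hx => ?_⟩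
  have hclose := hi x hx
  rw [dist_eq_norm] at hclose
  have hlower : (2 * M)⁻¹ ≤ ‖F i x‖ := by
    have hgx : M⁻¹ ≤ ‖g x‖ := by
      rw [inv_le_comm₀ hM0 (norm_pos_iff.2 (hg0 x hx)), ← norm_inv]
      exact (hM₂ x hx).trans hM₂M
    have := norm_sub_norm_le (g x) (F i x)
    rw [mul_inv] at hclose ⊢
    linarith
  have hpos : 0 < ‖F i x‖ := (by positivity : 0 < (2 * M)⁻¹).trans_le hlower
  refine ⟨norm_pos_iff.1 hpos, ?_, ?_⟩
  · have hle : (2 * M)⁻¹ ≤ 1 := inv_le_one_of_one_le₀ (by linarith)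
    have := norm_sub_norm_le (F i x) (g x)
    rw [norm_sub_rev] at this
    linarith [hM₁ x hx]
  · rw [norm_inv]
    exact inv_le_of_inv_le₀ (by positivity) hlower

variable {σ : ℝ} {a b : ℝ} {f g : ℝ → ℂ → ℂ}

theorem IsStrongSolution.exists_eventually_isBoundedUnit (h : IsStrongSolution σ (Icc a b) f)
    (hab : a < b) : ∃ R > 1, ∃ B, ∀ᶠ t in 𝓝[≥] a, IsBoundedUnit R B (deriv (f t)) := by
  obtain ⟨hO, w, hderiv, -⟩ := h
  have ha : a ∈ Icc a b := left_mem_Icc.2 hab.le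
  obtain ⟨R₀, hR₀, η, hη, hd⟩ := hderiv a ha
  obtain ⟨⟨U, hU, hEU, hfU, hinj⟩, -⟩ := hO a ha
  have haη : a ∈ Icc a b ∩ Metric.ball a η := ⟨ha, Metric.mem_ball_self hη⟩
  have hnhds : 𝓝[Icc a b ∩ Metric.ball a η] a = 𝓝[≥] a := by
    rw [nhdsWithin_inter_of_mem' (mem_nhdsWithin_of_mem_nhds (Metric.ball_mem_nhds a hη)),
      nhdsWithin_Icc_eq_nhdsGE hab]
  obtain ⟨R, hR, hRU⟩ := exists_gt_closedBall_subset zero_le_one (hU.inter Metric.isOpen_ball)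
    (subset_inter hEU (Metric.closedBall_subset_ball hR₀))
  have hball : Metric.closedBall (0 : ℂ) R ⊆ Metric.ball 0 R₀ := hRU.trans inter_subset_right
  have hanalytic : ∀ᶠ t in 𝓝[≥] a, DifferentiableOn ℂ (f t) (Metric.ball 0 R₀) :=
    hnhds ▸ eventually_nhdsWithin_of_forall hd.analytic
  have hlim : TendstoUniformlyOn (fun t => deriv (f t)) (deriv (f a)) (𝓝[≥] a)
      (Metric.closedBall 0 R) := by
    refine (tendstoLocallyUniformlyOn_iff_forall_isCompact Metric.isOpen_ball).1
      (TendstoLocallyUniformlyOn.deriv ?_ hanalytic Metric.isOpen_ball) _ hball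
      (isCompact_closedBall _ _)
    exact hnhds ▸ hd.tendstoLocallyUniformlyOn Metric.isOpen_ball haη
  obtain ⟨B, hB⟩ := exists_eventually_norm_le_and_norm_inv_le (isCompact_closedBall 0 R)
    (((hd.analytic a haη).deriv Metric.isOpen_ball).continuousOn.mono hball)
    (fun ξ hξ => deriv_ne_zero_of_injOn hU hfU hinj (hRU hξ).1) hlim
  refine ⟨R, hR, B, ?_⟩
  filter_upwards [hanalytic, hB] with t ht htB
  simp only [mem_closedBall_zero_iff] at htB
  refine ⟨((ht.deriv Metric.isOpen_ball).mono ?_).diffContOnCl, fun ξ hξ => (htB ξ hξ).1,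
    fun ξ hξ => (htB ξ hξ).2.1, fun ξ hξ => (htB ξ hξ).2.2⟩
  exact Metric.closure_ball_subset_closedBall.trans hball

theorem rnorm_le_tsum_geometric {A : Type*} [NormedCommRing A] {S R B : ℝ} (hS : 0 ≤ S)
    {x : A⟦X⟧} (hx : ∀ n, ‖coeff n x‖ ≤ B / R ^ n) :
    rnorm S x ≤ ∑' n, ENNReal.ofReal (B * (S / R) ^ n) := by
  refine ENNReal.tsum_le_tsum fun n => ENNReal.ofReal_le_ofReal ?_
  calc ‖coeff n x‖ * S ^ n ≤ B / R ^ n * S ^ n := by gcongr; exact hx n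
    _ = B * (S / R) ^ n := by rw [div_pow]; ring

theorem l1norm_le_rnorm {A : Type*} [NormedCommRing A] {S : ℝ} (hS : 1 ≤ S) (x : A⟦X⟧) :
    l1norm x ≤ rnorm S x := by
  rw [l1norm_eq_tsum_enorm]
  refine ENNReal.tsum_le_tsum fun n => ?_
  rw [← ofReal_norm]
  exact ENNReal.ofReal_le_ofReal (le_mul_of_one_le_right (norm_nonneg _) (one_le_pow₀ hS))

theorem IsStrongSolution.taylorCoeff_eq_of_isBoundedUnit (hf : IsStrongSolution σ (Icc a b) f)
    (hg : IsStrongSolution σ (Icc a b) g) (hab : a < b)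
    (hinit : ∀ n, taylorCoeff (f a) n = taylorCoeff (g a) n) {R B K S : ℝ} (hR : 0 < R)
    (hfB : ∀ t ∈ Icc a b, IsBoundedUnit R B (deriv (f t)))
    (hgB : ∀ t ∈ Icc a b, IsBoundedUnit R B (deriv (g t))) (hS : 1 ≤ S) {Q : ℝ≥0∞}
    (hQ : ∑' n, ENNReal.ofReal (B * (S / R) ^ n) ≤ Q) (hQ_top : Q ≠ ∞) (hK : 0 < K)
    (hKS : Real.exp (K * (b - a)) ≤ S)
    (hKL : ENNReal.ofReal K⁻¹ * (‖σ‖ₑ * (4 * Q ^ 2 + 4 * Q * Q ^ 3)) ≤ 2⁻¹) {t : ℝ}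
    (ht : t ∈ Icc a b) (n : ℕ) : taylorCoeff (f t) n = taylorCoeff (g t) n := by
  have : Nonempty (Icc a b) := ⟨⟨t, ht⟩⟩
  have hcont {u : ℝ → ℂ → ℂ} (hu : IsStrongSolution σ (Icc a b) u) (n : ℕ) :
      Continuous fun t : Icc a b => taylorCoeff (deriv (u t)) n := by
    simp only [taylorCoeff_deriv]
    exact continuous_const.mul
      (hu.continuousOn_taylorCoeff (uniqueDiffOn_Icc hab) (n + 1)).domRestrict
  have hrnorm {x : C(Icc a b, ℂ)⟦X⟧} (hx : ∀ n, ‖coeff n x‖ ≤ B / R ^ n) : rnorm S x ≤ Q :=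
    (rnorm_le_tsum_geometric (zero_le_one.trans hS) hx).trans hQ
  have hl1norm {x : C(Icc a b, ℂ)⟦X⟧} (hx : ∀ n, ‖coeff n x‖ ≤ B / R ^ n) : l1norm x ≤ Q :=
    (l1norm_le_rnorm hS x).trans (hrnorm hx)
  obtain ⟨D₁, q₁, h₁, hD₁, hDB₁, hqB₁⟩ :=
    IsBoundedUnit.exists_series (fun t : Icc a b => hfB t t.2) hR (hcont hf)
  obtain ⟨D₂, q₂, h₂, hD₂, hDB₂, hqB₂⟩ :=
    IsBoundedUnit.exists_series (fun t : Icc a b => hgB t t.2) hR (hcont hg)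
  have hD : D₁ = D₂ := by
    refine eq_of_sub_eq_primSeries hab.le hK hKS h₁ h₂ hQ_top (hl1norm hqB₁) (hl1norm hqB₂)
      hQ_top (hrnorm hDB₁) (hrnorm hDB₂) hKL ?_
    have heq₁ := hf.eq_add_primSeries hab hD₁ h₁ (ne_top_of_le_ne_top hQ_top (hl1norm hqB₁))
    have heq₂ := hg.eq_add_primSeries hab hD₂ h₂ (ne_top_of_le_ne_top hQ_top (hl1norm hqB₂))
    have hseries : taylorSeries (deriv (f a)) = taylorSeries (deriv (g a)) := by
      ext j
      simp only [coeff_taylorSeries, taylorCoeff_deriv, hinit]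
    rw [hseries] at heq₁
    rw [primSeries_sub]
    linear_combination heq₁ - heq₂
  cases n with
  | zero => rw [taylorCoeff_zero, taylorCoeff_zero, (hf.1 t ht).apply_zero, (hg.1 t ht).apply_zero]
  | succ j =>
    have hcoeff : taylorCoeff (deriv (f t)) j = taylorCoeff (deriv (g t)) j := by
      rw [← coeff_taylorSeries, ← coeff_taylorSeries, ← hD₁ ⟨t, ht⟩, ← hD₂ ⟨t, ht⟩, hD]
    rw [taylorCoeff_deriv, taylorCoeff_deriv] at hcoeff
    exact mul_left_cancel₀ (Nat.cast_add_one_ne_zero j) hcoeff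

theorem IsStrongSolution.eventually_taylorCoeff_eq (hf : IsStrongSolution σ (Icc a b) f)
    (hg : IsStrongSolution σ (Icc a b) g) (hab : a < b)
    (hinit : ∀ n, taylorCoeff (f a) n = taylorCoeff (g a) n) :
    ∀ᶠ t in 𝓝[≥] a, ∀ n, taylorCoeff (f t) n = taylorCoeff (g t) n := by
  obtain ⟨R₁, hR₁, B₁, hfB⟩ := hf.exists_eventually_isBoundedUnit hab
  obtain ⟨R₂, hR₂, B₂, hgB⟩ := hg.exists_eventually_isBoundedUnit hab
  obtain ⟨S, hS, hSR⟩ := exists_between (lt_min hR₁ hR₂)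
  have hR : 0 < min R₁ R₂ := by linarith
  set Q := ∑' n, ENNReal.ofReal (max B₁ B₂ * (S / min R₁ R₂) ^ n) with hQ
  have hQ_top : Q ≠ ∞ := ((summable_geometric_of_lt_one (by positivity)
    ((div_lt_one hR).2 hSR)).mul_left _).tsum_ofReal_ne_top
  obtain ⟨κ, hκ, hκL⟩ := exists_pos_ofReal_mul_le
    (L := ‖σ‖ₑ * (4 * Q ^ 2 + 4 * Q * Q ^ 3)) (by finiteness)
  have hexp : ∀ᶠ t in 𝓝[≥] a, Real.exp (κ⁻¹ * (t - a)) ≤ S := by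
    have hcont : ContinuousAt (fun t => Real.exp (κ⁻¹ * (t - a))) a := by fun_prop
    exact nhdsWithin_le_nhds (hcont.eventually_le_const
      (by simpa only [sub_self, mul_zero, Real.exp_zero] using hS))
  have hb : ∀ᶠ t in 𝓝[≥] a, t ≤ b := nhdsWithin_le_nhds (Iic_mem_nhds hab)
  obtain ⟨c, hc, hsub⟩ :=
    mem_nhdsGE_iff_exists_Icc_subset.1 (hfB.and (hgB.and (hexp.and hb)))
  have hcb : Icc a c ⊆ Icc a b := Icc_subset_Icc_right (hsub (right_mem_Icc.2 hc.le)).2.2.2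
  refine mem_of_superset (Icc_mem_nhdsGE hc) fun t ht n => ?_
  exact (hf.mono hcb).taylorCoeff_eq_of_isBoundedUnit (hg.mono hcb) hc hinit hR
    (fun τ hτ => (hsub hτ).1.mono (min_le_left _ _) (le_max_left _ _))
    (fun τ hτ => (hsub hτ).2.1.mono (min_le_right _ _) (le_max_right _ _)) hS.le hQ.ge hQ_top
    (inv_pos.2 hκ) (hsub (right_mem_Icc.2 hc.le)).2.2.1 (by rwa [inv_inv]) ht n

theorem IsStrongSolution.taylorCoeff_eq (hf : IsStrongSolution σ (Icc a b) f)
    (hg : IsStrongSolution σ (Icc a b) g) (hab : a < b)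
    (hinit : ∀ n, taylorCoeff (f a) n = taylorCoeff (g a) n) {t : ℝ} (ht : t ∈ Icc a b) (n : ℕ) :
    taylorCoeff (f t) n = taylorCoeff (g t) n := by
  set s : Set ℝ := {t | ∀ n, taylorCoeff (f t) n = taylorCoeff (g t) n} with hs
  have hI := uniqueDiffOn_Icc hab
  have hclosed : IsClosed (s ∩ Icc a b) := by
    have hinter : s ∩ Icc a b = ⋂ n, (Icc a b ∩
        (fun t => taylorCoeff (f t) n - taylorCoeff (g t) n) ⁻¹' {0}) := by
      rw [← inter_iInter, inter_comm]
      congr 1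
      ext τ
      simp only [hs, mem_ofPred_eq, mem_iInter, Set.mem_preimage, mem_singleton_iff, sub_eq_zero]
    rw [hinter]
    exact isClosed_iInter fun n => ((hf.continuousOn_taylorCoeff hI n).sub
      (hg.continuousOn_taylorCoeff hI n)).preimage_isClosed_of_isClosed isClosed_Icc
      isClosed_singleton
  refine hclosed.Icc_subset_of_forall_mem_nhdsWithin hinit (fun τ hτ => ?_) ht n
  have hτb : Icc τ b ⊆ Icc a b := Icc_subset_Icc_left hτ.2.1
  exact nhdsWithin_mono τ Ioi_subset_Ici_self
    ((hf.mono hτb).eventually_taylorCoeff_eq (hg.mono hτb) hτ.2.2 hτ.1)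

theorem IsStrongSolution.exists_differentiableOn_ball {I : Set ℝ} {t : ℝ}
    (h : IsStrongSolution σ I f) (ht : t ∈ I) :
    ∃ R > 1, DifferentiableOn ℂ (f t) (Metric.ball 0 R) := by
  obtain ⟨-, w, hderiv, -⟩ := h
  obtain ⟨R, hR, η, hη, hd⟩ := hderiv t ht
  exact ⟨R, hR, hd.analytic t ⟨ht, Metric.mem_ball_self hη⟩⟩

theorem IsStrongSolution.eqOn_of_eqOn (hf : IsStrongSolution σ (Icc a b) f)
    (hg : IsStrongSolution σ (Icc a b) g) (hinit : EqOn (f a) (g a) (Metric.closedBall 0 1))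
    {t : ℝ} (ht : t ∈ Icc a b) : EqOn (f t) (g t) (Metric.closedBall 0 1) := by
  rcases (ht.1.trans ht.2).eq_or_lt with rfl | hab
  · rwa [le_antisymm ht.2 ht.1]
  obtain ⟨R, hR, hfR⟩ := hf.exists_differentiableOn_ball ht
  obtain ⟨R', hR', hgR⟩ := hg.exists_differentiableOn_ball ht
  have hcoeff := hf.taylorCoeff_eq hg hab (taylorCoeff_congr (hinit.eventuallyEq_of_mem
    (Metric.closedBall_mem_nhds 0 one_pos))) ht
  intro ξ hξ
  rw [mem_closedBall_zero_iff] at hξ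
  refine (hasSum_taylorCoeff hfR (hξ.trans_lt hR)).unique ?_
  simp only [hcoeff]
  exact hasSum_taylorCoeff hgR (hξ.trans_lt hR')

end Uniqueness

section Families

variable {ι : Type*} {l : Filter ι} {s : ℝ}

theorem psum_sub {a b : ℂ⟦X⟧} (ha : Summable fun n => ‖coeff n a‖ * s ^ n)
    (hb : Summable fun n => ‖coeff n b‖ * s ^ n) {ξ : ℂ} (hξ : ‖ξ‖ ≤ s) :
    psum (a - b) ξ = psum a ξ - psum b ξ := by
  unfold psum
  rw [← (summable_psum ha hξ).tsum_sub (summable_psum hb hξ)]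
  simp only [map_sub, sub_mul]

theorem norm_psum_le {a : ℂ⟦X⟧} (ha : Summable fun n => ‖coeff n a‖ * s ^ n) {ξ : ℂ}
    (hξ : ‖ξ‖ ≤ s) : ‖psum a ξ‖ ≤ ∑' n, ‖coeff n a‖ * s ^ n :=
  tsum_of_norm_bounded ha.hasSum fun n => norm_coeff_mul_pow_le hξ n

theorem summable_coeff_sub {a b : ℂ⟦X⟧} (hs : 0 ≤ s) (ha : Summable fun n => ‖coeff n a‖ * s ^ n)
    (hb : Summable fun n => ‖coeff n b‖ * s ^ n) :
    Summable fun n => ‖coeff n (a - b)‖ * s ^ n := by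
  refine .of_nonneg_of_le (fun n => by positivity) (fun n => ?_) (ha.add hb)
  rw [map_sub, ← add_mul]
  gcongr
  exact norm_sub_le _ _

theorem summable_of_norm_coeff_le {A : Type*} [NormedRing A] {a : A⟦X⟧} {M : ℕ → ℝ} (hs : 0 ≤ s)
    (hM : Summable fun n => M n * s ^ n) (ha : ∀ n, ‖coeff n a‖ ≤ M n) :
    Summable fun n => ‖coeff n a‖ * s ^ n :=
  .of_nonneg_of_le (fun n => by positivity) (fun n => by gcongr; exact ha n) hM

theorem summable_coeff_X_mul {A : Type*} [NormedRing A] {a : A⟦X⟧}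
    (ha : Summable fun n => ‖coeff n a‖ * s ^ n) : Summable fun n => ‖coeff n (X * a)‖ * s ^ n := by
  rw [← summable_nat_add_iff 1]
  refine (ha.mul_left s).congr fun n => ?_
  rw [coeff_succ_X_mul]
  ring

variable {x : ι → ℂ⟦X⟧} {y : ℂ⟦X⟧} {M : ℕ → ℝ}

theorem tendsto_tsum_norm_coeff_sub (hs : 0 ≤ s) (hM : Summable fun n => M n * s ^ n)
    (hx : ∀ᶠ i in l, ∀ n, ‖coeff n (x i)‖ ≤ M n) (hy : ∀ n, ‖coeff n y‖ ≤ M n)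
    (hlim : ∀ n, Tendsto (fun i => coeff n (x i)) l (𝓝 (coeff n y))) :
    Tendsto (fun i => ∑' n, ‖coeff n (x i - y)‖ * s ^ n) l (𝓝 0) := by
  have hterm (n : ℕ) : Tendsto (fun i => ‖coeff n (x i - y)‖ * s ^ n) l (𝓝 0) := by
    simpa using (tendsto_iff_norm_sub_tendsto_zero.1 (hlim n)).mul_const (s ^ n)
  simpa using tendsto_tsum_of_dominated_convergence (hM.mul_left 2) hterm (by
    filter_upwards [hx] with i hi n
    rw [Real.norm_of_nonneg (by positivity), ← mul_assoc, two_mul, map_sub]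
    gcongr
    exact (norm_sub_le _ _).trans (add_le_add (hi n) (hy n)))

theorem tendstoUniformlyOn_psum (hs : 0 ≤ s) (hM : Summable fun n => M n * s ^ n)
    (hx : ∀ᶠ i in l, ∀ n, ‖coeff n (x i)‖ ≤ M n) (hy : ∀ n, ‖coeff n y‖ ≤ M n)
    (hlim : ∀ n, Tendsto (fun i => coeff n (x i)) l (𝓝 (coeff n y))) :
    TendstoUniformlyOn (fun i => psum (x i)) (psum y) l (Metric.ball 0 s) := by
  have hy' := summable_of_norm_coeff_le hs hM hy
  rw [Metric.tendstoUniformlyOn_iff]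
  intro ε hε
  filter_upwards [hx, (tendsto_tsum_norm_coeff_sub hs hM hx hy hlim).eventually (gt_mem_nhds hε)]
    with i hi hlt ξ hξ
  have hξ' : ‖ξ‖ ≤ s := (mem_ball_zero_iff.1 hξ).le
  have hi' := summable_of_norm_coeff_le hs hM hi
  rw [dist_comm, dist_eq_norm, ← psum_sub hi' hy' hξ']
  exact (norm_psum_le (summable_coeff_sub hs hi' hy') hξ').trans_lt hlt

theorem coeff_slope (x : ℝ → ℂ⟦X⟧) (n : ℕ) (t τ : ℝ) :
    coeff n (slope x t τ) = slope (fun u => coeff n (x u)) t τ := by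
  rw [slope_def_module, slope_def_module, coeff_smul, map_sub]

theorem hasContTimeDeriv_psum {x x' : ℝ → ℂ⟦X⟧} (hs : 0 ≤ s) {I : Set ℝ} (hI : Convex ℝ I)
    (hM : Summable fun n => M n * s ^ n)
    (hx : ∀ t ∈ I, Summable fun n => ‖coeff n (x t)‖ * s ^ n)
    (hx' : ∀ t ∈ I, ∀ n, ‖coeff n (x' t)‖ ≤ M n)
    (hderiv : ∀ n, ∀ t ∈ I, HasDerivWithinAt (fun u => coeff n (x u)) (coeff n (x' t)) I t)
    (hcont : ∀ n, ContinuousOn (fun t => coeff n (x' t)) I) :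
    HasContTimeDeriv (Metric.ball 0 s) I (fun t => psum (x t)) (fun t => psum (x' t)) where
  analytic t ht := differentiableOn_psum (hx t ht)
  analytic_deriv t ht := differentiableOn_psum (summable_of_norm_coeff_le hs hM (hx' t ht))
  hasDeriv t ht := by
    have hmem : ∀ᶠ τ in 𝓝[I \ {t}] t, τ ∈ I \ {t} := self_mem_nhdsWithin
    have hbound : ∀ τ ∈ I \ {t}, ∀ n, ‖coeff n (slope x t τ)‖ ≤ M n := by
      intro τ hτ n
      have hpos : 0 < ‖τ - t‖ := norm_pos_iff.2 (sub_ne_zero.2 hτ.2)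
      rw [coeff_slope, slope_def_module, norm_smul, norm_inv, inv_mul_le_iff₀ hpos, mul_comm]
      exact hI.norm_image_sub_le_of_norm_hasDerivWithin_le (hderiv n) (fun u hu => hx' u hu n)
        ht hτ.1
    refine ((tendstoUniformlyOn_psum hs hM (hmem.mono hbound) (hx' t ht) fun n => ?_).congr
      ?_).tendstoLocallyUniformlyOn
    · simp only [coeff_slope]
      exact hasDerivWithinAt_iff_tendsto_slope.1 (hderiv n t ht)
    · filter_upwards [hmem] with τ hτ ξ hξ
      simp only [slope_def_module]
      rw [psum_smul, psum_sub (hx τ hτ.1) (hx t ht) (mem_ball_zero_iff.1 hξ).le, Complex.ofReal_inv,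
        Complex.ofReal_sub, inv_mul_eq_div]
  cont t ht :=
    (tendstoUniformlyOn_psum hs hM (eventually_nhdsWithin_of_forall hx') (hx' t ht)
      fun n => hcont n t ht).tendstoLocallyUniformlyOn

end Families

section Antiderivative

variable {A : Type*} [NormedCommRing A] [NormedAlgebra ℂ A] {S : ℝ}

/-- The formal antiderivative without constant term; the latter vanishes because `0⁻¹ = 0`. -/
def antideriv (a : A⟦X⟧) : A⟦X⟧ := PowerSeries.mk fun n => (n : ℂ)⁻¹ • coeff (n - 1) a

theorem coeff_zero_antideriv (a : A⟦X⟧) : coeff 0 (antideriv a) = 0 := by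
  simp [antideriv]

theorem coeff_succ_antideriv (a : A⟦X⟧) (n : ℕ) :
    coeff (n + 1) (antideriv a) = ((n : ℂ) + 1)⁻¹ • coeff n a := by
  simp [antideriv]

theorem antideriv_add (a b : A⟦X⟧) : antideriv (a + b) = antideriv a + antideriv b := by
  ext n
  simp [antideriv]

theorem antideriv_sub (a b : A⟦X⟧) : antideriv (a - b) = antideriv a - antideriv b := by
  ext n
  simp [antideriv, smul_sub]

theorem norm_coeff_antideriv_le (a : A⟦X⟧) (n : ℕ) :
    ‖coeff n (antideriv a)‖ ≤ ‖coeff n (X * a)‖ := by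
  cases n with
  | zero => simp [coeff_zero_antideriv]
  | succ n =>
    rw [coeff_succ_antideriv, coeff_succ_X_mul, norm_smul, norm_inv, ← Nat.cast_succ,
      Complex.norm_natCast]
    exact mul_le_of_le_one_left (norm_nonneg _) (inv_le_one_of_one_le₀ (by simp))

theorem summable_coeff_antideriv {a : A⟦X⟧} (hS : 0 ≤ S)
    (ha : Summable fun n => ‖coeff n a‖ * S ^ n) :
    Summable fun n => ‖coeff n (antideriv a)‖ * S ^ n :=
  summable_of_norm_coeff_le hS (summable_coeff_X_mul ha) (norm_coeff_antideriv_le a)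

variable {a : ℂ⟦X⟧}

theorem psum_X_mul (ha : Summable fun n => ‖coeff n a‖ * S ^ n) {ξ : ℂ} (hξ : ‖ξ‖ ≤ S) :
    psum (X * a) ξ = ξ * psum a ξ := by
  unfold psum
  rw [(summable_psum (summable_coeff_X_mul ha) hξ).tsum_eq_zero_add, ← tsum_mul_left,
    coeff_zero_X_mul, zero_mul, zero_add]
  refine tsum_congr fun n => ?_
  rw [coeff_succ_X_mul]
  ring

theorem taylorSeries_deriv_psum_antideriv (hS : 0 < S)
    (ha : Summable fun n => ‖coeff n a‖ * S ^ n) :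
    taylorSeries (deriv (psum (antideriv a))) = a := by
  ext n
  have hn : (n : ℂ) + 1 ≠ 0 := n.cast_add_one_ne_zero
  rw [coeff_taylorSeries, taylorCoeff_deriv,
    taylorCoeff_psum hS (summable_coeff_antideriv hS.le ha), coeff_succ_antideriv, smul_eq_mul,
    mul_inv_cancel_left₀ hn]

theorem deriv_psum_antideriv (ha : Summable fun n => ‖coeff n a‖ * S ^ n)
    {ξ : ℂ} (hξ : ‖ξ‖ < S) : deriv (psum (antideriv a)) ξ = psum a ξ := by
  have hS : 0 < S := (norm_nonneg ξ).trans_lt hξ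
  conv_rhs => rw [← taylorSeries_deriv_psum_antideriv hS ha]
  exact (psum_taylorSeries ((differentiableOn_psum
    (summable_coeff_antideriv hS.le ha)).deriv Metric.isOpen_ball) hξ).symm

end Antiderivative

section AntiderivativeFamily

variable {Y : Type*} [TopologicalSpace Y] [CompactSpace Y] {S : ℝ}

theorem norm_coeff_evalAt_le (x : Y) (D : C(Y, ℂ)⟦X⟧) (n : ℕ) :
    ‖coeff n (evalAt x D)‖ ≤ ‖coeff n D‖ := by
  rw [coeff_evalAt]
  exact ContinuousMap.norm_coe_le_norm _ _

theorem summable_coeff_evalAt (hS : 0 ≤ S) (x : Y) {D : C(Y, ℂ)⟦X⟧}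
    (hD : Summable fun n => ‖coeff n D‖ * S ^ n) :
    Summable fun n => ‖coeff n (evalAt x D)‖ * S ^ n :=
  summable_of_norm_coeff_le hS hD (norm_coeff_evalAt_le x D)

theorem evalAt_antideriv (x : Y) (D : C(Y, ℂ)⟦X⟧) :
    evalAt x (antideriv D) = antideriv (evalAt x D) := by
  ext n
  simp [antideriv, coeff_evalAt]

variable {a b : ℝ} (hab : a ≤ b)

theorem coeff_antideriv_primSeries (W : C(Icc a b, ℂ)⟦X⟧) (n : ℕ) :
    coeff n (antideriv (primSeries hab W)) = prim hab (coeff n (X * W)) := by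
  cases n with
  | zero => simpa [coeff_zero_antideriv] using (prim_sub hab 0 0).symm
  | succ n =>
    have hn : (n : ℂ) + 1 ≠ 0 := n.cast_add_one_ne_zero
    rw [coeff_succ_antideriv, coeff_primSeries, coeff_succ_X_mul, ← Nat.cast_smul_eq_nsmul ℂ,
      Nat.cast_succ, inv_smul_smul₀ hn]

theorem hasDerivAt_integral_IccExtend (x : C(Icc a b, ℂ)) (t : ℝ) :
    HasDerivAt (fun u => ∫ τ in a..u, IccExtend hab x τ) (IccExtend hab x t) t :=
  have hc : Continuous (IccExtend hab x) := x.continuous.Icc_extend'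
  intervalIntegral.integral_hasDerivAt_right (hc.intervalIntegrable _ _)
    (hc.stronglyMeasurableAtFilter _ _) hc.continuousAt

theorem hasDerivWithinAt_prim (x : C(Icc a b, ℂ)) {t : ℝ} (ht : t ∈ Icc a b) :
    HasDerivWithinAt (fun u => prim hab x (projIcc a b hab u)) (x (projIcc a b hab t))
      (Icc a b) t := by
  have heq : ∀ u ∈ Icc a b, prim hab x (projIcc a b hab u) = ∫ τ in a..u, IccExtend hab x τ :=
    fun u hu => by rw [projIcc_of_mem hab hu, prim_apply]
  exact (hasDerivAt_integral_IccExtend hab x t).hasDerivWithinAt.congr heq (heq t ht)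

/-- The family of functions vanishing at `0` whose `ξ`-derivatives have the coefficients `D`; it is
frozen outside the time interval `[a, b]`. -/
def antiderivAt (D : C(Icc a b, ℂ)⟦X⟧) (t : ℝ) : ℂ → ℂ :=
  psum (antideriv (evalAt (projIcc a b hab t) D))

variable {D W : C(Icc a b, ℂ)⟦X⟧}

theorem antiderivAt_coe (t : Icc a b) : antiderivAt hab D t = psum (antideriv (evalAt t D)) := by
  rw [antiderivAt, projIcc_val]

theorem hasContTimeDeriv_antiderivAt (hS : 0 ≤ S) (hD : Summable fun n => ‖coeff n D‖ * S ^ n)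
    (hW : Summable fun n => ‖coeff n W‖ * S ^ n) {c : ℂ⟦X⟧}
    (h : D = c.map (algebraMap ℂ C(Icc a b, ℂ)) + primSeries hab W) :
    HasContTimeDeriv (Metric.ball 0 S) (Icc a b) (antiderivAt hab D)
      (fun t => psum (evalAt (projIcc a b hab t) (X * W))) := by
  have hcoeff (n : ℕ) (t : ℝ) : coeff n (antideriv (evalAt (projIcc a b hab t) D)) =
      coeff n (antideriv c) + prim hab (coeff n (X * W)) (projIcc a b hab t) := by
    rw [h, ← evalAt_antideriv, antideriv_add, map_add, map_add, evalAt_antideriv,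
      evalAt_map_algebraMap, coeff_evalAt, coeff_antideriv_primSeries]
  refine hasContTimeDeriv_psum hS (convex_Icc a b) (summable_coeff_X_mul hW)
    (fun t _ => summable_coeff_antideriv hS (summable_coeff_evalAt hS _ hD))
    (fun t _ => norm_coeff_evalAt_le _ _) (fun n t ht => ?_) (fun n => ?_)
  · simp only [hcoeff, coeff_evalAt]
    exact (hasDerivWithinAt_prim hab _ ht).const_add _
  · simp only [coeff_evalAt]
    exact ((ContinuousMap.continuous _).comp continuous_projIcc).continuousOn

end AntiderivativeFamily

section RNorm

variable {A : Type*} [NormedCommRing A] {S : ℝ}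

theorem rnorm_ne_top_iff (hS : 0 ≤ S) {x : A⟦X⟧} :
    rnorm S x ≠ ∞ ↔ Summable fun n => ‖coeff n x‖ * S ^ n := by
  refine ⟨fun h => ?_, fun h => h.tsum_ofReal_ne_top⟩
  refine (ENNReal.summable_toReal h).congr fun n => ENNReal.toReal_ofReal (by positivity)

variable [NormedAlgebra ℝ A]

theorem enorm_algebraMap_pow_mul (hS : 0 ≤ S) (n : ℕ) (x : A) :
    ‖algebraMap ℝ A (S ^ n) * x‖ₑ = ENNReal.ofReal (‖x‖ * S ^ n) := by
  rw [← Algebra.smul_def, ← ofReal_norm, norm_smul, Real.norm_of_nonneg (pow_nonneg hS n), mul_comm]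

theorem rnorm_eq_wnorm (hS : 0 ≤ S) (x : A⟦X⟧) :
    rnorm S x = wnorm (fun n => algebraMap ℝ A (S ^ n)) x :=
  tsum_congr fun n => (enorm_algebraMap_pow_mul hS n _).symm

variable [StarRing A] [NormedStarGroup A] [CompleteSpace A]

theorem rnorm_rhs_ne_top (σ : ℝ) (hS : 1 ≤ S) {D q : A⟦X⟧} (h : D * q = 1) (hq : l1norm q ≠ ∞)
    (hD : rnorm S D ≠ ∞) : rnorm S (rhs σ D) ≠ ∞ := by
  have hS₀ : 0 ≤ S := zero_le_one.trans hS
  have hDl := ne_top_of_le_ne_top hD (l1norm_le_rnorm hS D)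
  have hmono (x : A) : Monotone fun n => ‖algebraMap ℝ A (S ^ n) * x‖ₑ := by
    intro m n hmn
    simp only [enorm_algebraMap_pow_mul hS₀]
    gcongr
  rw [rnorm_eq_wnorm hS₀] at hD ⊢
  rw [rhs_eq_of_mul_eq_one σ h, eq_sub_of_add_eq (mul_herglotz_add_corr_herglotz hDl hq h)]
  refine ne_top_of_le_ne_top (ENNReal.mul_ne_top enorm_ne_top ?_) (wnorm_smul_le _ σ _)
  refine ne_top_of_le_ne_top (ENNReal.add_ne_top.2 ⟨?_, ?_⟩) (wnorm_sub_le _ _ _)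
  · rw [wnorm_C]
    exact enorm_ne_top
  · exact ne_top_of_le_ne_top (ENNReal.mul_ne_top hD
      (l1norm_herglotz_ne_top (l1norm_corr_ne_top hq hq))) (wnorm_corr_le_left hmono _ _)

end RNorm

section SolutionFromCoefficients

theorem re_mul_psum_rhs_eq (σ : ℝ) {D q : ℂ⟦X⟧} (h : D * q = 1) (hD : l1norm D ≠ ∞)
    (hq : l1norm q ≠ ∞) {ξ : ℂ} (hξ : ‖ξ‖ = 1) :
    (ξ * psum (rhs σ D) ξ * (starRingEnd ℂ) (psum D ξ * ξ)).re = σ := by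
  have hp : l1norm (herglotz (corr q q)) ≠ ∞ := l1norm_herglotz_ne_top (l1norm_corr_ne_top hq hq)
  have hinv : ‖psum D ξ‖ * ‖psum q ξ‖ = 1 := by
    rw [← norm_mul, ← psum_mul (summable_pow_one hD) (summable_pow_one hq) hξ.le, h, psum_one,
      norm_one]
  have hξξ : ξ * (starRingEnd ℂ) ξ = 1 := by
    rw [Complex.mul_conj, Complex.normSq_eq_norm_sq, hξ, one_pow, Complex.ofReal_one]
  have hDD : psum D ξ * (starRingEnd ℂ) (psum D ξ) = ((‖psum D ξ‖ ^ 2 : ℝ) : ℂ) := by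
    rw [Complex.mul_conj, Complex.normSq_eq_norm_sq]
  have hfactor : ξ * psum (rhs σ D) ξ * (starRingEnd ℂ) (psum D ξ * ξ) =
      ((σ * ‖psum D ξ‖ ^ 2 : ℝ) : ℂ) * psum (herglotz (corr q q)) ξ := by
    rw [rhs_eq_of_mul_eq_one σ h, psum_smul, psum_mul (summable_pow_one hD) (summable_pow_one hp)
      hξ.le, map_mul, Complex.ofReal_mul, ← hDD]
    linear_combination (σ * psum D ξ * psum (herglotz (corr q q)) ξ *
      (starRingEnd ℂ) (psum D ξ)) * hξξ
  rw [hfactor, Complex.re_ofReal_mul, re_psum_herglotz_corr hq hξ]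
  calc σ * ‖psum D ξ‖ ^ 2 * ‖psum q ξ‖ ^ 2 = σ * (‖psum D ξ‖ * ‖psum q ξ‖) ^ 2 := by ring
    _ = σ := by rw [hinv, one_pow, mul_one]

variable {a b : ℝ} (hab : a ≤ b)

theorem im_eq_zero_of_eq_add_prim {d H : C(Icc a b, ℂ)} (hH : star H = H) {c : ℂ}
    (hc : c.im = 0) (hd : d = algebraMap ℂ C(Icc a b, ℂ) c + prim hab (d * H)) (t : Icc a b) :
    (d t).im = 0 := by
  have hHim (s : Icc a b) : (H s).im = 0 := Complex.conj_eq_iff_im.1 (DFunLike.congr_fun hH s)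
  let y : ℝ → ℝ := fun s => (∫ τ in a..s, IccExtend hab (d * H) τ).im
  have hy' (s : ℝ) : HasDerivAt y (IccExtend hab (d * H) s).im s :=
    Complex.imCLM.hasFDerivAt.comp_hasDerivAt s (hasDerivAt_integral_IccExtend hab (d * H) s)
  have hy (s : Icc a b) : (d s).im = y s := by
    conv_lhs => rw [hd, ContinuousMap.add_apply, _root_.algebraMap_apply, prim_apply, smul_eq_mul,
      mul_one, Complex.add_im, hc, zero_add]
  rw [hy]
  refine eq_zero_of_abs_deriv_le_mul_abs_self_of_eq_zero_right (K := ‖H‖)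
    (fun s _ => (hy' s).continuousAt.continuousWithinAt) (fun s _ => (hy' s).hasDerivWithinAt)
    (by simp [y]) (fun s hs => ?_) t t.2
  have hsI : s ∈ Icc a b := Ico_subset_Icc_self hs
  rw [IccExtend_of_mem hab _ hsI, ContinuousMap.mul_apply, Complex.mul_im, hHim, mul_zero, zero_add,
    norm_mul, mul_comm, hy]
  gcongr
  exact (Complex.abs_re_le_norm _).trans (ContinuousMap.norm_coe_le_norm H _)

variable {σ S : ℝ} {D q : C(Icc a b, ℂ)⟦X⟧} {c : ℂ⟦X⟧}

theorem im_coeff_zero_eq_zero (h : D * q = 1) (hc : (coeff 0 c).im = 0)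
    (hint : D = c.map (algebraMap ℂ C(Icc a b, ℂ)) + primSeries hab (rhs σ D)) (t : Icc a b) :
    (coeff 0 D t).im = 0 := by
  have hrhs : coeff 0 (rhs σ D) = coeff 0 D * σ • coeff 0 (corr q q) := by
    rw [rhs_eq_of_mul_eq_one σ h, coeff_smul, coeff_mul, Nat.antidiagonal_zero,
      sum_singleton, herglotz, two_mul, map_sub, map_add,
      coeff_zero_C, add_sub_cancel_right, mul_smul_comm]
  refine im_eq_zero_of_eq_add_prim hab (H := σ • coeff 0 (corr q q)) ?_ hc ?_ t
  · rw [star_smul, star_coeff_zero_corr_self, star_trivial]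
  · conv_lhs => rw [hint]
    rw [map_add, coeff_map, coeff_primSeries, zero_add, one_smul, hrhs]

theorem isStrongSolution_antiderivAt (hS : 1 < S) (h : D * q = 1) (hq : l1norm q ≠ ∞)
    (hD : rnorm S D ≠ ∞)
    (hint : D = c.map (algebraMap ℂ C(Icc a b, ℂ)) + primSeries hab (rhs σ D))
    (hO : ∀ t ∈ Icc a b, InO (Metric.closedBall 0 1) (antiderivAt hab D t)) :
    IsStrongSolution σ (Icc a b) (antiderivAt hab D) := by
  have hS₀ : 0 ≤ S := by linarith
  have hDS := (rnorm_ne_top_iff hS₀).1 hD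
  have hW := (rnorm_ne_top_iff hS₀).1 (rnorm_rhs_ne_top σ hS.le h hq hD)
  have hDl := ne_top_of_le_ne_top hD (l1norm_le_rnorm hS.le D)
  refine ⟨hO, _, fun _ _ => ⟨S, hS, 1, one_pos,
    (hasContTimeDeriv_antiderivAt hab hS₀ hDS hW hint).mono subset_rfl inter_subset_left⟩,
    fun t _ ξ hξ => ?_⟩
  have hξS : ‖ξ‖ < S := hξ.trans_lt hS
  rw [antiderivAt, deriv_psum_antideriv (summable_coeff_evalAt hS₀ _ hDS) hξS, map_mul,
    show evalAt (projIcc a b hab t) (X : C(Icc a b, ℂ)⟦X⟧) = X from PowerSeries.map_X _,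
    psum_X_mul (summable_coeff_evalAt hS₀ _ hW) hξS.le, evalAt_rhs σ _ h hq]
  exact re_mul_psum_rhs_eq σ (by rw [← map_mul, h, map_one]) (l1norm_evalAt_ne_top _ hDl)
    (l1norm_evalAt_ne_top _ hq) hξ

end SolutionFromCoefficients

section DividedDifferences

theorem taylorCoeff_eval (p : Polynomial ℂ) (n : ℕ) :
    taylorCoeff (fun ξ => p.eval ξ) n = p.coeff n := by
  refine taylorCoeff_eq_of_hasSum one_pos (fun ξ _ => ?_) n
  rw [Polynomial.eval_eq_sum_range]
  refine hasSum_sum_of_ne_finset_zero fun j hj => ?_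
  rw [Polynomial.coeff_eq_zero_of_natDegree_lt (by simpa [Nat.lt_succ_iff] using hj), zero_mul]

theorem dslope_eval {p : Polynomial ℂ} {k : ℕ} (hp : p.natDegree ≤ k) (x y : ℂ) :
    dslope (fun ξ => p.eval ξ) x y =
      ∑ j ∈ range (k + 1), p.coeff j * ∑ i ∈ range j, y ^ i * x ^ (j - 1 - i) := by
  have hk : p.natDegree < k + 1 := Nat.lt_succ_of_le hp
  rcases eq_or_ne y x with rfl | hyx
  · rw [dslope_same, Polynomial.deriv, Polynomial.derivative_eval,
      p.sum_over_range' (by simp) _ hk]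
    simp only [geom_sum₂_self, mul_assoc]
  · rw [dslope_of_ne _ hyx, slope_def_field, div_eq_iff (sub_ne_zero.2 hyx),
      Polynomial.eval_eq_sum_range' hk, Polynomial.eval_eq_sum_range' hk, ← sum_sub_distrib,
      sum_mul]
    refine sum_congr rfl fun j _ => ?_
    rw [mul_assoc, geom_sum₂_mul, mul_sub]

theorem InO.dslope_ne_zero {E : Set ℂ} {f : ℂ → ℂ} (h : InO E f) {x y : ℂ} (hx : x ∈ E)
    (hy : y ∈ E) : dslope f x y ≠ 0 := by
  rcases eq_or_ne y x with rfl | hyx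
  · rw [dslope_same]
    exact h.deriv_ne_zero hx
  · obtain ⟨⟨U, -, hEU, -, hinj⟩, -⟩ := h
    rw [dslope_of_ne _ hyx, slope_def_field]
    exact div_ne_zero (sub_ne_zero.2 fun heq => hyx (hinj (hEU hy) (hEU hx) heq))
      (sub_ne_zero.2 hyx)

theorem exists_bounds_dslope_eval {Y : Type*} [TopologicalSpace Y] [CompactSpace Y] {K : Set ℂ}
    (hK : IsCompact K) {P : Y → Polynomial ℂ} {k : ℕ} (hdeg : ∀ t, (P t).natDegree ≤ k)
    (hcont : ∀ n, Continuous fun t => (P t).coeff n)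
    (hO : ∀ t, InO K fun ξ => (P t).eval ξ) :
    ∃ c > 0, ∃ M : ℝ, ∀ t, ∀ x ∈ K, ∀ y ∈ K,
      c ≤ ‖dslope (fun ξ => (P t).eval ξ) x y‖ ∧ ‖dslope (fun ξ => (P t).eval ξ) x y‖ ≤ M := by
  let Q : Y × ℂ × ℂ → ℂ := fun z => dslope (fun ξ => (P z.1).eval ξ) z.2.1 z.2.2
  have hQ : Continuous Q := by
    simp only [Q, dslope_eval (hdeg _)]
    exact continuous_finsetSum _ fun j _ =>
      ((hcont j).comp continuous_fst).mul (by fun_prop)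
  have hcompact : IsCompact (Set.univ ×ˢ K ×ˢ K : Set (Y × ℂ × ℂ)) :=
    isCompact_univ.prod (hK.prod hK)
  obtain ⟨c, hc, hcQ⟩ := hcompact.exists_forall_le' hQ.norm.continuousOn (a := 0)
    fun z hz => norm_pos_iff.2 ((hO z.1).dslope_ne_zero hz.2.1 hz.2.2)
  obtain ⟨M, hM⟩ := hcompact.exists_bound_of_continuousOn hQ.continuousOn
  exact ⟨c, hc, M, fun t x hx y hy =>
    ⟨hcQ (t, x, y) ⟨Set.mem_univ t, hx, hy⟩, hM (t, x, y) ⟨Set.mem_univ t, hx, hy⟩⟩⟩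

theorem injOn_of_norm_deriv_sub_le {g₁ g₂ : ℂ → ℂ} {s : Set ℂ} (hs : IsOpen s)
    (hconvex : Convex ℝ s) {c θ : ℝ} (hθ : θ < c) (hg₁ : DifferentiableOn ℂ g₁ s)
    (hg₂ : DifferentiableOn ℂ g₂ s) (hlow : ∀ x ∈ s, ∀ y ∈ s, c ≤ ‖dslope g₁ x y‖)
    (hclose : ∀ x ∈ s, ‖deriv g₂ x - deriv g₁ x‖ ≤ θ) : InjOn g₂ s := by
  intro x hx y hy hxy
  by_contra hne
  have hpos : 0 < ‖y - x‖ := norm_pos_iff.2 (sub_ne_zero.2 (Ne.symm hne))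
  have hmean : ‖g₂ y - g₁ y - (g₂ x - g₁ x)‖ ≤ θ * ‖y - x‖ :=
    hconvex.norm_image_sub_le_of_norm_hasDerivWithin_le (f := fun z => g₂ z - g₁ z)
      (fun z hz => ((hg₂.differentiableAt (hs.mem_nhds hz)).hasDerivAt.sub
        (hg₁.differentiableAt (hs.mem_nhds hz)).hasDerivAt).hasDerivWithinAt) hclose hx hy
  have hlower : c * ‖y - x‖ ≤ ‖g₁ y - g₁ x‖ := by
    have hxyc := hlow x hx y hy
    rwa [dslope_of_ne _ (Ne.symm hne), slope_def_field, norm_div, le_div_iff₀ hpos] at hxyc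
  rw [show g₂ y - g₁ y - (g₂ x - g₁ x) = -(g₁ y - g₁ x) by rw [hxy]; ring, norm_neg] at hmean
  exact hθ.not_ge (le_of_mul_le_mul_right (hlower.trans hmean) hpos)

end DividedDifferences

section RNormSeries

variable {A : Type*} [NormedCommRing A] {S : ℝ}

theorem rnorm_ne_top_of_forall_coeff_eq_zero (hS : 0 ≤ S)
    {k : ℕ} {D : A⟦X⟧} (hD : ∀ j, k ≤ j → coeff j D = 0) : rnorm S D ≠ ∞ :=
  (rnorm_ne_top_iff hS).2 <| summable_of_ne_finset_zero (s := range k) fun j hj => by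
    rw [hD j (not_lt.1 fun hlt => hj (mem_range.2 hlt)), norm_zero, zero_mul]

theorem rnorm_sub_comm (S : ℝ) (x y : A⟦X⟧) :
    rnorm S (x - y) = rnorm S (y - x) := by
  simp only [rnorm, map_sub, norm_sub_rev]

theorem rnorm_ne_top_of_sub (hS : 0 ≤ S) {x y : A⟦X⟧}
    (hxy : rnorm S (x - y) ≠ ∞) (hy : rnorm S y ≠ ∞) : rnorm S x ≠ ∞ := by
  rw [rnorm_ne_top_iff hS] at hxy hy ⊢
  refine .of_nonneg_of_le (fun n => by positivity) (fun n => ?_) (hxy.add hy)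
  rw [map_sub, ← add_mul]
  gcongr
  exact norm_le_norm_sub_add _ _

theorem rnorm_X_mul (hS : 0 ≤ S) (a : A⟦X⟧) : rnorm S (X * a) = ENNReal.ofReal S * rnorm S a := by
  unfold rnorm
  rw [tsum_eq_zero_add' ENNReal.summable, coeff_zero_X_mul, norm_zero, zero_mul,
    ENNReal.ofReal_zero, zero_add, ← ENNReal.tsum_mul_left]
  refine tsum_congr fun n => ?_
  rw [← ENNReal.ofReal_mul hS, coeff_succ_X_mul, pow_succ]
  ring_nf

theorem rnorm_le_of_norm_coeff_le {B : Type*} [NormedCommRing B] (hS : 0 ≤ S) {a : A⟦X⟧}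
    {b : B⟦X⟧} (h : ∀ n, ‖coeff n a‖ ≤ ‖coeff n b‖) : rnorm S a ≤ rnorm S b :=
  ENNReal.tsum_le_tsum fun n => by gcongr; exact h n

theorem rnorm_antideriv_le [NormedAlgebra ℂ A] (hS : 0 ≤ S) (a : A⟦X⟧) :
    rnorm S (antideriv a) ≤ ENNReal.ofReal S * rnorm S a :=
  (rnorm_le_of_norm_coeff_le hS (norm_coeff_antideriv_le a)).trans_eq (rnorm_X_mul hS a)

theorem taylorSeries_psum {a : ℂ⟦X⟧} (hS : 0 < S) (ha : Summable fun n => ‖coeff n a‖ * S ^ n) :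
    taylorSeries (psum a) = a := by
  ext n
  rw [coeff_taylorSeries, taylorCoeff_psum hS ha]

theorem psum_antideriv_taylorSeries_deriv {f : ℂ → ℂ} {R : ℝ}
    (hf : DifferentiableOn ℂ f (Metric.ball 0 R)) (hf₀ : f 0 = 0) {ξ : ℂ} (hξ : ‖ξ‖ < R) :
    psum (antideriv (taylorSeries (deriv f))) ξ = f ξ := by
  rw [← psum_taylorSeries hf hξ]
  congr 1
  ext n
  cases n with
  | zero => rw [coeff_zero_antideriv, coeff_taylorSeries, taylorCoeff_zero, hf₀]
  | succ n =>
    rw [coeff_succ_antideriv, coeff_taylorSeries, coeff_taylorSeries, taylorCoeff_deriv,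
      smul_eq_mul, inv_mul_cancel_left₀ n.cast_add_one_ne_zero]

theorem rnorm_taylorSeries_deriv_le_normRho (hS : 1 ≤ S) (n : ℕ) (v : ℂ → ℂ) :
    rnorm S (taylorSeries (deriv v)) ≤ normRho (2 * S) n v := by
  refine ENNReal.tsum_le_tsum fun j => ENNReal.ofReal_le_ofReal ?_
  have hpow : (j : ℝ) + 1 ≤ 2 ^ (j + 1) := mod_cast (Nat.lt_two_pow_self (n := j + 1)).le
  have hrpow : (1 : ℝ) ≤ ((j : ℝ) + 1) ^ ((1 : ℝ) / 2 + (n : ℝ)) :=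
    Real.one_le_rpow (le_add_of_nonneg_left j.cast_nonneg) (by positivity)
  rw [coeff_taylorSeries, taylorCoeff_deriv, norm_mul, ← Nat.cast_succ, Complex.norm_natCast,
    Nat.cast_succ]
  calc ((j : ℝ) + 1) * ‖taylorCoeff v (j + 1)‖ * S ^ j
      ≤ 2 ^ (j + 1) * ‖taylorCoeff v (j + 1)‖ * S ^ (j + 1) := by gcongr; exact j.le_succ
    _ = ‖taylorCoeff v (j + 1)‖ * (2 * S) ^ (j + 1) := by rw [mul_pow]; ring
    _ ≤ _ := le_mul_of_one_le_right (by positivity) hrpow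

theorem normM_iteratedDeriv_sub_le {g₁ g₂ : ℂ → ℂ} (hS : 1 ≤ S) (hg₁ : AnalyticAt ℂ g₁ 0)
    (hg₂ : AnalyticAt ℂ g₂ 0) (n : ℕ) :
    normM S (fun ξ => iteratedDeriv n g₁ ξ - iteratedDeriv n g₂ ξ) ≤
      ENNReal.ofReal n.factorial * rnorm (2 * S) (taylorSeries g₁ - taylorSeries g₂) := by
  have hanalytic {g : ℂ → ℂ} (hg : AnalyticAt ℂ g 0) : AnalyticAt ℂ (iteratedDeriv n g) 0 := by
    rw [iteratedDeriv_eq_iterate]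
    exact hg.iterated_deriv n
  have hterm (i : ℕ) :
      ‖taylorCoeff (fun ξ => iteratedDeriv n g₁ ξ - iteratedDeriv n g₂ ξ) i‖ * S ^ i ≤
        n.factorial *
          (‖coeff (i + n) (taylorSeries g₁ - taylorSeries g₂)‖ * (2 * S) ^ (i + n)) := by
    have hdesc : ((i + n).descFactorial n : ℝ) ≤ n.factorial * 2 ^ (i + n) := by
      rw [Nat.descFactorial_eq_factorial_mul_choose]
      exact_mod_cast Nat.mul_le_mul_left _ (Nat.choose_le_two_pow _ _)
    rw [show (fun ξ => iteratedDeriv n g₁ ξ - iteratedDeriv n g₂ ξ) =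
        iteratedDeriv n g₁ - iteratedDeriv n g₂ from rfl,
      taylorCoeff_sub (hanalytic hg₁) (hanalytic hg₂), taylorCoeff_iteratedDeriv,
      taylorCoeff_iteratedDeriv, ← mul_sub, norm_mul, Complex.norm_natCast, map_sub,
      coeff_taylorSeries, coeff_taylorSeries]
    set d := ‖taylorCoeff g₁ (i + n) - taylorCoeff g₂ (i + n)‖
    calc ((i + n).descFactorial n : ℝ) * d * S ^ i
        ≤ n.factorial * 2 ^ (i + n) * d * S ^ (i + n) := by
          gcongr
          exact i.le_add_right n
      _ = n.factorial * (d * (2 * S) ^ (i + n)) := by rw [mul_pow]; ring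
  refine (ENNReal.tsum_le_tsum fun i => ENNReal.ofReal_le_ofReal (hterm i)).trans ?_
  simp only [ENNReal.ofReal_mul (Nat.cast_nonneg n.factorial), ENNReal.tsum_mul_left]
  gcongr
  exact ENNReal.tsum_comp_le_tsum_of_injective (add_left_injective n) fun m =>
    ENNReal.ofReal (‖coeff m (taylorSeries g₁ - taylorSeries g₂)‖ * (2 * S) ^ m)

end RNormSeries

section Comparison

theorem InO.mono {E F : Set ℂ} {f : ℂ → ℂ} (h : InO F f) (hEF : E ⊆ F) : InO E f :=
  let ⟨⟨U, hU, hFU, hf⟩, h₀⟩ := h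
  ⟨⟨U, hU, hEF.trans hFU, hf⟩, h₀⟩

theorem InO.of_norm_deriv_sub_le {g₁ g₂ : ℂ → ℂ} {s : Set ℂ} (hs : IsOpen s)
    (hconvex : Convex ℝ s) (hs₀ : (0 : ℂ) ∈ s) {c θ : ℝ} (hθ : θ < c) (hg₁ : InO s g₁)
    (hlow : ∀ x ∈ s, ∀ y ∈ s, c ≤ ‖dslope g₁ x y‖) (hg₂ : DifferentiableOn ℂ g₂ s)
    (hg₂₀ : g₂ 0 = 0) (him : (deriv g₂ 0).im = 0)
    (hclose : ∀ x ∈ s, ‖deriv g₂ x - deriv g₁ x‖ ≤ θ) : InO s g₂ := by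
  obtain ⟨⟨U, -, hsU, hg₁U, -⟩, -, hre₁, him₁⟩ := hg₁
  refine ⟨⟨s, hs, subset_rfl, hg₂, injOn_of_norm_deriv_sub_le hs hconvex hθ (hg₁U.mono hsU) hg₂
    hlow hclose⟩, hg₂₀, ?_, him⟩
  have hc : c ≤ (deriv g₁ 0).re := by
    have hc' := hlow 0 hs₀ 0 hs₀
    rwa [dslope_same, ← Complex.abs_re_eq_norm.2 him₁, abs_of_pos hre₁] at hc'
  have hre := (abs_le.1 ((Complex.abs_re_le_norm _).trans (hclose 0 hs₀))).1
  rw [Complex.sub_re] at hre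
  linarith

variable {a b S θ : ℝ} (hab : a ≤ b) {D D₀ : C(Icc a b, ℂ)⟦X⟧}

theorem norm_deriv_antiderivAt_sub_le (hD : rnorm S D ≠ ∞) (hD₀ : rnorm S D₀ ≠ ∞) (hθ : 0 ≤ θ)
    (h : rnorm S (D - D₀) ≤ ENNReal.ofReal θ) (t : ℝ) {ξ : ℂ} (hξ : ‖ξ‖ < S) :
    ‖deriv (antiderivAt hab D t) ξ - deriv (antiderivAt hab D₀ t) ξ‖ ≤ θ := by
  have hS : 0 ≤ S := (norm_nonneg ξ).trans hξ.le
  have hDt := summable_coeff_evalAt hS (projIcc a b hab t) ((rnorm_ne_top_iff hS).1 hD)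
  have hD₀t := summable_coeff_evalAt hS (projIcc a b hab t) ((rnorm_ne_top_iff hS).1 hD₀)
  rw [antiderivAt, antiderivAt, deriv_psum_antideriv hDt hξ, deriv_psum_antideriv hD₀t hξ,
    ← psum_sub hDt hD₀t hξ.le]
  have hsub := summable_coeff_sub hS hDt hD₀t
  refine (norm_psum_le hsub hξ.le).trans ?_
  rw [← ENNReal.ofReal_le_ofReal_iff hθ,
    ENNReal.ofReal_tsum_of_nonneg (fun n => by positivity) hsub, ← map_sub]
  exact (rnorm_le_of_norm_coeff_le hS (norm_coeff_evalAt_le _ _)).trans h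

theorem normM_iteratedDeriv_antiderivAt_sub_le (hS : 1 ≤ S) (hD : rnorm (2 * S) D ≠ ∞)
    (hD₀ : rnorm (2 * S) D₀ ≠ ∞) (n : ℕ) (t : ℝ) :
    normM S (fun ξ => iteratedDeriv n (antiderivAt hab D t) ξ -
        iteratedDeriv n (antiderivAt hab D₀ t) ξ) ≤
      ENNReal.ofReal n.factorial * (ENNReal.ofReal (2 * S) * rnorm (2 * S) (D - D₀)) := by
  have hS₀ : 0 < 2 * S := by linarith
  have hsummable {V : C(Icc a b, ℂ)⟦X⟧} (hV : rnorm (2 * S) V ≠ ∞) :=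
    summable_coeff_antideriv hS₀.le
      (summable_coeff_evalAt hS₀.le (projIcc a b hab t) ((rnorm_ne_top_iff hS₀.le).1 hV))
  have hanalytic {V : C(Icc a b, ℂ)⟦X⟧} (hV : rnorm (2 * S) V ≠ ∞) :
      AnalyticAt ℂ (antiderivAt hab V t) 0 :=
    (differentiableOn_psum (hsummable hV)).analyticAt (Metric.ball_mem_nhds 0 hS₀)
  refine (normM_iteratedDeriv_sub_le hS (hanalytic hD) (hanalytic hD₀) n).trans ?_
  rw [antiderivAt, antiderivAt, taylorSeries_psum hS₀ (hsummable hD),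
    taylorSeries_psum hS₀ (hsummable hD₀), ← antideriv_sub, ← map_sub]
  gcongr
  refine (rnorm_antideriv_le hS₀.le _).trans ?_
  gcongr
  exact rnorm_le_of_norm_coeff_le hS₀.le (norm_coeff_evalAt_le _ _)

end Comparison

section Perturbation

theorem exists_series_eval {Y : Type*} [TopologicalSpace Y] [CompactSpace Y] [Nonempty Y] {r : ℝ}
    (hr : 1 < r) {P : Y → Polynomial ℂ} {k : ℕ} (hdeg : ∀ t, (P t).natDegree ≤ k)
    (hcont : ∀ n, Continuous fun t => (P t).coeff n)
    (hO : ∀ t, InO (Metric.closedBall 0 r) fun ξ => (P t).eval ξ) :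
    ∃ D q : C(Y, ℂ)⟦X⟧, D * q = 1 ∧ l1norm q ≠ ∞ ∧
      (∀ t, evalAt t D = taylorSeries (deriv fun ξ => (P t).eval ξ)) ∧
      ∀ j, k ≤ j → coeff j D = 0 := by
  have hr₀ : 0 < r := one_pos.trans hr
  obtain ⟨c, hc, M, hbound⟩ :=
    exists_bounds_dslope_eval (isCompact_closedBall 0 r) hdeg hcont hO
  have hunit (t : Y) : IsBoundedUnit r (max M c⁻¹) (deriv fun ξ => (P t).eval ξ) := by
    have hderiv (ξ : ℂ) (hξ : ‖ξ‖ ≤ r) : c ≤ ‖deriv (fun ξ => (P t).eval ξ) ξ‖ ∧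
        ‖deriv (fun ξ => (P t).eval ξ) ξ‖ ≤ M := by
      have hξ' := mem_closedBall_zero_iff.2 hξ
      simpa only [dslope_same] using hbound t ξ hξ' ξ hξ'
    refine ⟨?_, fun ξ hξ => norm_pos_iff.1 (hc.trans_le (hderiv ξ hξ).1),
      fun ξ hξ => (hderiv ξ hξ).2.trans (le_max_left _ _), fun ξ hξ => ?_⟩
    · have hderiv_eq : (deriv fun ξ => (P t).eval ξ) = fun ξ => (P t).derivative.eval ξ :=
        funext fun _ => Polynomial.deriv _
      exact hderiv_eq ▸ (P t).derivative.differentiable.diffContOnCl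
    · rw [norm_inv]
      exact le_max_of_le_right (inv_anti₀ hc (hderiv ξ hξ).1)
  obtain ⟨D, q, h, hD, -, hqB⟩ := IsBoundedUnit.exists_series hunit hr₀ fun n => by
    simp only [taylorCoeff_deriv, taylorCoeff_eval]
    exact continuous_const.mul (hcont (n + 1))
  refine ⟨D, q, h, l1norm_ne_top (.of_nonneg_of_le (fun _ => norm_nonneg _) hqB ?_), hD,
    fun j hj => ?_⟩
  · simpa [div_eq_mul_inv] using (summable_geometric_of_lt_one (inv_nonneg.2 hr₀.le)
      (inv_lt_one_of_one_lt₀ hr)).mul_left (max M c⁻¹)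
  · ext t
    rw [← coeff_evalAt, hD, coeff_taylorSeries, taylorCoeff_deriv, taylorCoeff_eval,
      Polynomial.coeff_eq_zero_of_natDegree_lt ((hdeg t).trans_lt (Nat.lt_succ_of_le hj)), mul_zero,
      ContinuousMap.zero_apply]

variable {a b : ℝ} (hab : a ≤ b) {σ S : ℝ} {D D₀ W q q₀ : C(Icc a b, ℂ)⟦X⟧} {c : ℂ⟦X⟧}

theorem exists_eq_add_primSeries_of_normRho_lt (hS : 1 < S) {k : ℕ} (h₀ : D₀ * q₀ = 1)
    (hD₀ : ∀ j, k ≤ j → coeff j D₀ = 0) (hq₀ : l1norm q₀ ≠ ∞) {p : ℂ → ℂ} (hp : AnalyticAt ℂ p 0)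
    (hint₀ : D₀ = (taylorSeries (deriv p)).map (algebraMap ℂ C(Icc a b, ℂ)) +
      primSeries hab (rhs σ D₀)) {θ : ℝ} (hθ : 0 < θ) (n : ℕ) :
    ∃ δ > 0, ∃ ρ > 1, ∀ f₀ : ℂ → ℂ, AnalyticAt ℂ f₀ 0 →
      normRho ρ n (f₀ - p) < ENNReal.ofReal δ →
      ∃ D q : C(Icc a b, ℂ)⟦X⟧, D * q = 1 ∧ l1norm q ≠ ∞ ∧
        rnorm S (D - D₀) ≤ ENNReal.ofReal θ ∧
        D = (taylorSeries (deriv f₀)).map (algebraMap ℂ C(Icc a b, ℂ)) +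
          primSeries hab (rhs σ D) := by
  obtain ⟨s₀, hs₀, δ, hδ, hexists⟩ := exists_eq_add_primSeries hab σ hS.le (le_max_right k 1) h₀
    (fun j hj => hD₀ j ((le_max_left k 1).trans hj)) hq₀ hθ
  refine ⟨δ, hδ, 2 * s₀, by linarith, fun f₀ hf₀ hsmall => ?_⟩
  obtain ⟨D, q, h, -, hq, hclose, hint⟩ := hexists (taylorSeries (deriv (f₀ - p)))
    ((rnorm_taylorSeries_deriv_le_normRho (hS.le.trans hs₀) n _).trans hsmall.le)
  refine ⟨D, q, h, hq, hclose, ?_⟩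
  rw [taylorSeries_deriv_sub hf₀ hp, map_sub, primSeries_sub] at hint
  linear_combination hint + hint₀

theorem evalAt_left_of_eq_add_primSeries
    (hint : D = c.map (algebraMap ℂ C(Icc a b, ℂ)) + primSeries hab W) :
    evalAt ⟨a, left_mem_Icc.2 hab⟩ D = c := by
  ext n
  rw [hint, map_add, evalAt_map_algebraMap, map_add, coeff_evalAt, coeff_primSeries,
    ContinuousMap.nsmul_apply, prim_apply, intervalIntegral.integral_same, smul_zero, add_zero]

theorem antiderivAt_eq_of_evalAt_eq {f : ℂ → ℂ} {R : ℝ} (t : Icc a b)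
    (hf : DifferentiableOn ℂ f (Metric.ball 0 R)) (hf₀ : f 0 = 0)
    (hD : evalAt t D = taylorSeries (deriv f)) {ξ : ℂ} (hξ : ‖ξ‖ < R) :
    antiderivAt hab D t ξ = f ξ := by
  rw [antiderivAt_coe, hD, psum_antideriv_taylorSeries_deriv hf hf₀ hξ]

theorem inO_antiderivAt {r κ θ : ℝ} (hr : 0 < r) (hrS : r ≤ S) (h : D * q = 1)
    (hD : rnorm S D ≠ ∞) (hD₀ : rnorm S D₀ ≠ ∞) (hc : (coeff 0 c).im = 0)
    (hint : D = c.map (algebraMap ℂ C(Icc a b, ℂ)) + primSeries hab (rhs σ D)) (hθ : 0 ≤ θ)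
    (hclose : rnorm S (D - D₀) ≤ ENNReal.ofReal θ) (hθκ : θ < κ) {t : ℝ}
    (hO : InO (Metric.ball 0 r) (antiderivAt hab D₀ t))
    (hlow : ∀ x ∈ Metric.ball (0 : ℂ) r, ∀ y ∈ Metric.ball (0 : ℂ) r,
      κ ≤ ‖dslope (antiderivAt hab D₀ t) x y‖) :
    InO (Metric.ball 0 r) (antiderivAt hab D t) := by
  have hS : 0 < S := hr.trans_le hrS
  have hDt := summable_coeff_evalAt hS.le (projIcc a b hab t) ((rnorm_ne_top_iff hS.le).1 hD)
  refine .of_norm_deriv_sub_le Metric.isOpen_ball (convex_ball 0 r) (Metric.mem_ball_self hr) hθκ hO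
    hlow ((differentiableOn_psum (summable_coeff_antideriv hS.le hDt)).mono
      (Metric.ball_subset_ball hrS)) ?_ ?_ fun x hx =>
    norm_deriv_antiderivAt_sub_le hab hD hD₀ hθ hclose t ((mem_ball_zero_iff.1 hx).trans_le hrS)
  · rw [antiderivAt, psum_apply_zero, coeff_zero_antideriv]
  · rw [antiderivAt, deriv_psum_antideriv hDt (by rwa [norm_zero]), psum_apply_zero, coeff_evalAt]
    exact im_coeff_zero_eq_zero hab h hc hint _

end Perturbation

section PolynomialSolution

theorem IsStrongSolution.exists_series_of_eval {σ a b r : ℝ} (hab : a < b) (hr : 1 < r)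
    {P : ℝ → Polynomial ℂ} {k : ℕ} (hdeg : ∀ t ∈ Icc a b, (P t).natDegree ≤ k)
    (hsol : IsStrongSolution σ (Icc a b) fun t ξ => (P t).eval ξ)
    (hO : ∀ t ∈ Icc a b, InO (Metric.closedBall 0 r) fun ξ => (P t).eval ξ) :
    ∃ D q : C(Icc a b, ℂ)⟦X⟧, D * q = 1 ∧ l1norm q ≠ ∞ ∧ (∀ j, k ≤ j → coeff j D = 0) ∧
      D = (taylorSeries (deriv fun ξ => (P a).eval ξ)).map (algebraMap ℂ C(Icc a b, ℂ)) +
        primSeries hab.le (rhs σ D) ∧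
      (∀ t ∈ Icc a b, antiderivAt hab.le D t = fun ξ => (P t).eval ξ) ∧
      ∃ κ > 0, ∀ t ∈ Icc a b, ∀ x ∈ Metric.ball (0 : ℂ) r, ∀ y ∈ Metric.ball (0 : ℂ) r,
        κ ≤ ‖dslope (antiderivAt hab.le D t) x y‖ := by
  have : Nonempty (Icc a b) := ⟨⟨a, left_mem_Icc.2 hab.le⟩⟩
  have hcont (n : ℕ) : Continuous fun t : Icc a b => (P t).coeff n := by
    have hcoeff := hsol.continuousOn_taylorCoeff (uniqueDiffOn_Icc hab) n
    simp only [taylorCoeff_eval] at hcoeff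
    exact hcoeff.domRestrict
  obtain ⟨D, q, h, hq, hD, hcoeff⟩ := exists_series_eval hr (fun t : Icc a b => hdeg t t.2) hcont
    fun t => hO t t.2
  obtain ⟨κ, hκ, _, hlow⟩ := exists_bounds_dslope_eval (isCompact_closedBall 0 r)
    (fun t : Icc a b => hdeg t t.2) hcont fun t => hO t t.2
  have hP (t : ℝ) (ht : t ∈ Icc a b) : antiderivAt hab.le D t = fun ξ => (P t).eval ξ :=
    funext fun ξ => antiderivAt_eq_of_evalAt_eq hab.le ⟨t, ht⟩ (P t).differentiable.differentiableOn
      (hO t ht).apply_zero (hD ⟨t, ht⟩) (lt_add_one ‖ξ‖)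
  refine ⟨D, q, h, hq, hcoeff, hsol.eq_add_primSeries hab hD h hq, hP, κ, hκ, fun t ht => ?_⟩
  rw [hP t ht]
  exact fun x hx y hy => (hlow ⟨t, ht⟩ x (Metric.ball_subset_closedBall hx) y
    (Metric.ball_subset_closedBall hy)).1

end PolynomialSolution

section Conclusion

variable {σ a b : ℝ}

theorem antiderivAt_left_eqOn (hab : a ≤ b) {D W : C(Icc a b, ℂ)⟦X⟧} {f₀ : ℂ → ℂ} {s : ℝ}
    (hs : 0 ≤ s) (hf₀ : AnalyticOnNhd ℂ f₀ (Metric.closedBall 0 s)) (hf₀₀ : f₀ 0 = 0)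
    (hint : D = (taylorSeries (deriv f₀)).map (algebraMap ℂ C(Icc a b, ℂ)) + primSeries hab W) :
    EqOn (antiderivAt hab D a) f₀ (Metric.closedBall 0 s) := by
  obtain ⟨R, hR, hRU⟩ := exists_gt_closedBall_subset hs (isOpen_analyticAt ℂ f₀) hf₀
  have hdiff : DifferentiableOn ℂ f₀ (Metric.ball 0 R) := fun ξ hξ =>
    (hRU (Metric.ball_subset_closedBall hξ)).differentiableAt.differentiableWithinAt
  exact fun ξ hξ => antiderivAt_eq_of_evalAt_eq hab ⟨a, left_mem_Icc.2 hab⟩ hdiff hf₀₀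
    (evalAt_left_of_eq_add_primSeries hab hint) ((mem_closedBall_zero_iff.1 hξ).trans_lt hR)

theorem isC1InH_antiderivAt (hab : a ≤ b) {D q : C(Icc a b, ℂ)⟦X⟧} {c : ℂ⟦X⟧} {S : ℝ}
    (hS : 1 ≤ S) (h : D * q = 1) (hq : l1norm q ≠ ∞) (hD : rnorm S D ≠ ∞)
    (hint : D = c.map (algebraMap ℂ C(Icc a b, ℂ)) + primSeries hab (rhs σ D)) :
    IsC1InH (Metric.ball 0 S) (Icc a b) (antiderivAt hab D) :=
  have hS₀ : 0 ≤ S := zero_le_one.trans hS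
  ⟨_, hasContTimeDeriv_antiderivAt hab hS₀ ((rnorm_ne_top_iff hS₀).1 hD)
    ((rnorm_ne_top_iff hS₀).1 (rnorm_rhs_ne_top σ hS h hq hD)) hint⟩

theorem exists_pos_lt_and_mul_lt {c κ ε : ℝ} (hc : 0 < c) (hκ : 0 < κ) (hε : 0 < ε) :
    ∃ θ > 0, θ < κ ∧ c * θ < ε := by
  obtain ⟨θ, hθ, hlt⟩ := exists_between (lt_min hκ (div_pos hε hc))
  exact ⟨θ, hθ, hlt.trans_le (min_le_left _ _),
    (lt_div_iff₀' hc).1 (hlt.trans_le (min_le_right _ _))⟩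

theorem normM_iteratedDeriv_antiderivAt_sub_lt (hab : a ≤ b) {D D₀ : C(Icc a b, ℂ)⟦X⟧}
    {r θ ε : ℝ} (hr : 1 ≤ r) (hD : rnorm (2 * r) D ≠ ∞) (hD₀ : rnorm (2 * r) D₀ ≠ ∞) (hε : 0 < ε)
    (hclose : rnorm (2 * r) (D - D₀) ≤ ENNReal.ofReal θ) {n k : ℕ} (hnk : n ≤ k)
    (hθ : k.factorial * (2 * r) * θ < ε) (t : ℝ) :
    normM r (fun ξ => iteratedDeriv n (antiderivAt hab D t) ξ -
      iteratedDeriv n (antiderivAt hab D₀ t) ξ) < ENNReal.ofReal ε :=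
  calc normM r (fun ξ => iteratedDeriv n (antiderivAt hab D t) ξ -
        iteratedDeriv n (antiderivAt hab D₀ t) ξ)
      ≤ ENNReal.ofReal n.factorial *
          (ENNReal.ofReal (2 * r) * rnorm (2 * r) (D - D₀)) :=
        normM_iteratedDeriv_antiderivAt_sub_le hab hr hD hD₀ n t
    _ ≤ ENNReal.ofReal k.factorial * (ENNReal.ofReal (2 * r) * ENNReal.ofReal θ) := by
        gcongr
    _ = ENNReal.ofReal (k.factorial * (2 * r) * θ) := by
        rw [mul_assoc (k.factorial : ℝ), ← ENNReal.ofReal_mul (by linarith),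
          ← ENNReal.ofReal_mul (by positivity)]
    _ < ENNReal.ofReal ε := (ENNReal.ofReal_lt_ofReal_iff hε).2 hθ

theorem IsStrongSolution.eqOn_of_eqOn_Ico {T : ℝ} {f g : ℝ → ℂ → ℂ}
    (hf : IsStrongSolution σ (Icc a T) f) (hg : IsStrongSolution σ (Ico a b) g)
    (hinit : EqOn (g a) (f a) (Metric.closedBall 0 1)) {t : ℝ} (ht : t ∈ Ico a b) (htT : t ≤ T) :
    EqOn (g t) (f t) (Metric.closedBall 0 1) :=
  (hg.mono (Icc_subset_Ico_right ht.2)).eqOn_of_eqOn (hf.mono (Icc_subset_Icc_right htT)) hinit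
    (right_mem_Icc.2 ht.1)

end Conclusion

end

end HeleShaw

open HeleShaw in
theorem theorem1_general
    (σ : ℝ) (k₀ : ℕ) (T₀ r : ℝ) (hT₀ : 0 < T₀) (hr : 1 < r) (P : ℝ → Polynomial ℂ)
    (hdeg : ∀ t ∈ Set.Icc 0 T₀, (P t).natDegree ≤ k₀)
    (hsol : IsStrongSolution σ (Set.Icc 0 T₀) (fun t ξ => (P t).eval ξ))
    (hO : ∀ t ∈ Set.Icc 0 T₀, InO (Metric.closedBall 0 r) (fun ξ => (P t).eval ξ))
    (ε : ℝ) (hε : 0 < ε) (k m : ℕ) (r' : ℝ)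
    (hr'r : r' < r) :
    ∃ δ > (0 : ℝ), ∃ ρ > (1 : ℝ),
      ∀ f₀ : ℂ → ℂ, AnalyticOnNhd ℂ f₀ (Metric.closedBall 0 1) →
        f₀ 0 = 0 → (deriv f₀ 0).im = 0 →
        normRho ρ m (fun ξ => f₀ ξ - (P 0).eval ξ) < ENNReal.ofReal δ →
        ∃ f : ℝ → ℂ → ℂ,
          IsStrongSolution σ (Set.Icc 0 T₀) f ∧
          Set.EqOn (f 0) f₀ (Metric.closedBall 0 1) ∧
          (∀ t ∈ Set.Icc 0 T₀, InO (Metric.closedBall 0 r') (f t)) ∧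
          IsC1InH (Metric.ball 0 r) (Set.Icc 0 T₀) f ∧
          (∀ n ≤ k, ∀ t ∈ Set.Icc 0 T₀,
            normM r (fun ξ => iteratedDeriv n (fun z => (P t).eval z) ξ -
              iteratedDeriv n (f t) ξ) < ENNReal.ofReal ε) ∧
          (∀ b > (0 : ℝ), ∀ g : ℝ → ℂ → ℂ,
            IsStrongSolution σ (Set.Ico 0 b) g →
            Set.EqOn (g 0) f₀ (Metric.closedBall 0 1) →
            ∀ t ∈ Set.Ico 0 b, t ≤ T₀ → Set.EqOn (g t) (f t) (Metric.closedBall 0 1)) := by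
  have hS : 1 < 2 * r := by linarith
  obtain ⟨D₀, q₀, h₀, hq₀, hcoeff, hint₀, hP, κ, hκ, hlow⟩ :=
    hsol.exists_series_of_eval hT₀ hr hdeg hO
  have hD₀ := rnorm_ne_top_of_forall_coeff_eq_zero (S := 2 * r) (by linarith) hcoeff
  obtain ⟨θ, hθ, hθκ, hθε⟩ :=
    exists_pos_lt_and_mul_lt (c := k.factorial * (2 * r)) (by positivity) hκ hε
  obtain ⟨δ, hδ, ρ, hρ, hexists⟩ := exists_eq_add_primSeries_of_normRho_lt hT₀.le hS h₀ hcoeff hq₀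
    ((P 0).differentiable.analyticAt 0) hint₀ hθ m
  refine ⟨δ, hδ, ρ, hρ, fun f₀ hf₀ hf₀₀ him hsmall => ?_⟩
  obtain ⟨D, q, h, hq, hclose, hint⟩ := hexists f₀ (hf₀ 0 (by simp)) hsmall
  have hD :=
    rnorm_ne_top_of_sub (by linarith) (ne_top_of_le_ne_top ENNReal.ofReal_ne_top hclose) hD₀
  have hfO (t : ℝ) (ht : t ∈ Set.Icc 0 T₀) : InO (Metric.ball 0 r) (antiderivAt hT₀.le D t) :=
    inO_antiderivAt hT₀.le (by linarith) (by linarith) h hD hD₀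
      (by rwa [coeff_taylorSeries, taylorCoeff_zero]) hint hθ.le hclose hθκ
      (hP t ht ▸ (hO t ht).mono Metric.ball_subset_closedBall) (hlow t ht)
  have hf := isStrongSolution_antiderivAt hT₀.le hS h hq hD hint fun t ht =>
    (hfO t ht).mono (Metric.closedBall_subset_ball hr)
  have hinit := antiderivAt_left_eqOn hT₀.le zero_le_one hf₀ hf₀₀ hint
  refine ⟨antiderivAt hT₀.le D, hf, hinit,
    fun t ht => (hfO t ht).mono (Metric.closedBall_subset_ball hr'r),
    (isC1InH_antiderivAt hT₀.le hS.le h hq hD hint).mono (Metric.ball_subset_ball (by linarith)),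
    fun n hn t ht => ?_, fun _ _ _ hg hg₀ _ => hf.eqOn_of_eqOn_Ico hg (hg₀.trans hinit.symm)⟩
  rw [← hP t ht]
  exact normM_iteratedDeriv_antiderivAt_sub_lt hT₀.le hr.le hD₀ hD hε
    (rnorm_sub_comm _ D D₀ ▸ hclose) hn hθε t

theorem theorem1
    (σ : ℝ) (hσ : σ = 1 ∨ σ = -1)
    (k₀ : ℕ) (T₀ r : ℝ) (hT₀ : 0 < T₀) (hr : 1 < r)
    (P : ℝ → Polynomial ℂ)
    (hdeg : ∀ t ∈ Set.Icc 0 T₀, (P t).natDegree = k₀)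
    (hsol : HeleShaw.IsStrongSolution σ (Set.Icc 0 T₀) (fun t ξ => (P t).eval ξ))
    (hO : ∀ t ∈ Set.Icc 0 T₀,
      HeleShaw.InO (Metric.closedBall 0 r) (fun ξ => (P t).eval ξ))
    (ε : ℝ) (hε : 0 < ε) (k : ℕ) (r' : ℝ) (hr' : 1 < r') (hr'r : r' < r) :
    ∃ δ > (0 : ℝ), ∃ ρ > (1 : ℝ),
      ∀ f₀ : ℂ → ℂ, AnalyticOnNhd ℂ f₀ (Metric.closedBall 0 1) →
        f₀ 0 = 0 → 0 < (deriv f₀ 0).re → (deriv f₀ 0).im = 0 →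
        HeleShaw.normRho ρ k (fun ξ => f₀ ξ - (P 0).eval ξ) < ENNReal.ofReal δ →
        ∃ f : ℝ → ℂ → ℂ,
          HeleShaw.IsStrongSolution σ (Set.Icc 0 T₀) f ∧
          Set.EqOn (f 0) f₀ (Metric.closedBall 0 1) ∧
          (∀ t ∈ Set.Icc 0 T₀, HeleShaw.InO (Metric.closedBall 0 r') (f t)) ∧
          HeleShaw.IsC1InH (Metric.ball 0 r) (Set.Icc 0 T₀) f ∧
          (∀ n ≤ k, ∀ t ∈ Set.Icc 0 T₀,
            HeleShaw.normM r (fun ξ => iteratedDeriv n (fun z => (P t).eval z) ξ -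
              iteratedDeriv n (f t) ξ) < ENNReal.ofReal ε) ∧
          -- `f` is the only strong solution with the initial function `f₀`
          (∀ b > (0 : ℝ), ∀ g : ℝ → ℂ → ℂ,
            HeleShaw.IsStrongSolution σ (Set.Ico 0 b) g →
            Set.EqOn (g 0) f₀ (Metric.closedBall 0 1) →
            ∀ t ∈ Set.Ico 0 b, t ≤ T₀ → Set.EqOn (g t) (f t) (Metric.closedBall 0 1)) :=
  let ⟨δ, hδ, ρ, hρ, h⟩ := theorem1_general σ k₀ T₀ r hT₀ hr P (fun t ht => (hdeg t ht).le) hsol hO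
    ε hε k k r' hr'r
  ⟨δ, hδ, ρ, hρ, fun f₀ hf₀ hf₀₀ _ => h f₀ hf₀ hf₀₀⟩
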